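/- **Setting.** Let $\mathcal A,\mathcal B$ be Abelian categories with autoequivalences $\Phi,\Psi$ and natural transformations $w:\mathrm{Id}_{\mathcal A}\to\Phi$, $v:\mathrm{Id}_{\mathcal B}\to\Psi$ such that $w_{\Phi(A)}=\Phi(w_A)$ and $v_{\Psi(B)}=\Psi(v_B)$ for all objects. A *factorization* $E$ of $(\mathcal A,\Phi,w)$ consists of objects $E^{-1},E^0$ (its components) and morphisms $\phi^{-1}_E:\Phi^{-1}(E^0)\to E^{-1}$, $\phi^0_E:E^{-1}\to E^0$ with $\phi^0_E\circ\phi^{-1}_E=\Phi^{-1}(w_{E^0})$ and $\Phi(\phi^{-1}_E)\circ\phi^0_E=w_{E^{-1}}$. A morphism $g$ is a pair $(g^{-1},g^0)$ commuting with these maps. The shift is $E[1]=(E^0,\Phi(E^{-1}),-\phi^0_E,-\Phi(\phi^{-1}_E))$. A homotopy from $g_1$ to $g_2$ is a pair $h^{-1}:E^{-1}\to\Phi^{-1}(F^0)$, $h^0:E^0\to F^{-1}$ with $g_1^{-1}-g_2^{-1}=h^0\phi^0_E+\phi_F^{-1}h^{-1}$ and $g_1^0-g_2^0=\phi^0_Fh^0+\Phi(h^{-1})\Phi(\phi_E^{-1})$.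 Let $K(\mathrm{Fact}\,w)$ be the homotopy category, with its shift and the usual cones. The totalization of a bounded complex $X^\bullet$ of factorizations is $\bigoplus_n X^{-n}[n]$, with structure maps the sum of those of the $X^{-n}[n]$ and of those given by the differential of $X^\bullet$. The *absolutely acyclic* (resp. *co-acyclic*, resp. *contra-acyclic*) factorizations form the smallest thick triangulated subcategory of $K(\mathrm{Fact}\,w)$ that contains the totalizations of bounded exact complexes of factorizations (resp. and is closed under small coproducts, resp. and is closed under small products). The Verdier quotients of $K(\mathrm{Fact}\,w)$ by them are $D^{\mathrm{abs}}(\mathrm{Fact}\,w)$, $D^{\mathrm{co}}(\mathrm{Fact}\,w)$, $D^{\mathrm{ctr}}(\mathrm{Fact}\,w)$. A *factored functor* $\theta$ from $(\mathcal A,\Phi,w)$ to $(\mathcal B,\Psi,v)$ is an additive functor $\theta:\mathcal A\to\mathrm{Ch}^b(\mathcal B)$ with an isomorphism $\theta\circ\Phi\cong\Psi\circ\theta$ under which $\theta(w_A)=v_{\theta(A)}$. Applying $\theta$ to a factorization componentwise and totalizing gives $\theta^f$ on factorizations and on homotopy categories. A *factored natural transformation* $\eta:\theta\to\gamma$ is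 a natural transformation with $\eta_{\Phi(A)}=\Psi(\eta_A)$ under these isomorphisms; it induces $\eta^f:\theta^f\to\gamma^f$. The map $\mathbf R\eta:\mathbf R\theta\to\mathbf R\gamma$ (resp. $\mathbf L\eta:\mathbf L\theta\to\mathbf L\gamma$) of ordinary derived functors is given at an object $A$ by the map of total complexes $\theta(I)\to\gamma(I)$ (resp. $\theta(P)\to\gamma(P)$) for an injective resolution $I$ (resp. a projective resolution $P$) of $A$. The derived factored functor $\mathbf R\theta^f$ (resp. $\mathbf L\theta^f$) between co-derived, contra-derived or absolute derived categories is the right (resp. left) derived functor of $\theta^f$ with respect to the quotient functors, i.e. the universal functor with a natural map from (resp. to) $\theta^f$. We write $\mathbf R\eta^f$, $\mathbf L\eta^f$ for the transformations induced by $\eta^f$. **Lemma.** Let $\theta,\gamma$ be factored functors from $(\mathcal A,\Phi,w)$ to $(\mathcal B,\Psi,v)$ and let $\eta:\theta\to\gamma$ be a factored natural transformation. 1. Assume that $\mathcal A,\mathcal B$ have small coproducts, $\mathcal A$ has enough injectives, and coproducts of injectives in $\mathcal A$ are injective. If $\theta,\gamma$ are left exact and $\mathbf R\eta:\mathbf R\theta\to\mathbf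 R\gamma$ is an isomorphism, then $\mathbf R\eta^f:\mathbf R\theta^f\to\mathbf R\gamma^f$ is an isomorphism of functors $D^{\mathrm{co}}(\mathrm{Fact}\,w)\to D^{\mathrm{co}}(\mathrm{Fact}\,v)$. 2. Assume that $\mathcal A,\mathcal B$ have small products, $\mathcal A$ has enough projectives, and products of projectives in $\mathcal A$ are projective. If $\theta,\gamma$ are right exact and $\mathbf L\eta:\mathbf L\theta\to\mathbf L\gamma$ is an isomorphism, then $\mathbf L\eta^f:\mathbf L\theta^f\to\mathbf L\gamma^f$ is an isomorphism of functors $D^{\mathrm{ctr}}(\mathrm{Fact}\,w)\to D^{\mathrm{ctr}}(\mathrm{Fact}\,v)$. 3. Assume that every object of $\mathcal A$ has a finite injective resolution. If $\theta,\gamma$ are left exact and $\mathbf R\eta$ is an isomorphism, then $\mathbf R\eta^f:\mathbf R\theta^f\to\mathbf R\gamma^f$ is an isomorphism of functors $D^{\mathrm{abs}}(\mathrm{Fact}\,w)\to D^{\mathrm{abs}}(\mathrm{Fact}\,v)$. 4. Assume that every object of $\mathcal A$ has a finite projective resolution. If $\theta,\gamma$ are right exact and $\mathbf L\eta$ is an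 isomorphism, then $\mathbf L\eta^f:\mathbf L\theta^f\to\mathbf L\gamma^f$ is an isomorphism of functors $D^{\mathrm{abs}}(\mathrm{Fact}\,w)\to D^{\mathrm{abs}}(\mathrm{Fact}\,v)$. In each case the derived factored functors exist: the homotopy category of factorizations with injective components (projective components in 2 and 4) is equivalent, through the quotient functor, to the derived category of factorizations in question of $(\mathcal A,\Phi,w)$, and on these factorizations the canonical map between $\theta^f$ and $\mathbf R\theta^f$ (resp. $\mathbf L\theta^f$) is an isomorphism, and likewise for $\gamma$. -/

import Mathlib

open CategoryTheory CategoryTheory.Limits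

universe w v₁ v₂ u₁ u₂

set_option linter.unusedSectionVars false

noncomputable section

namespace FactorizationCategory

theorem hasCoproduct_of_finite_nonzero {C : Type u₁} [Category.{v₁} C] [Preadditive C]
    [HasFiniteCoproducts C] {ι : Type w} (f : ι → C)
    (hf : {i | ¬ IsZero (f i)}.Finite) : HasCoproduct f := by
  classical
  have : Finite {i | ¬ IsZero (f i)} := hf
  let g : {i | ¬ IsZero (f i)} → C := fun i => f i
  let c : Cofan f := Cofan.mk (∐ g) (fun i =>
    if h : ¬ IsZero (f i) then Limits.Sigma.ι g ⟨i, h⟩ else 0)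
  refine ⟨⟨⟨c, Cofan.IsColimit.mk c (fun t => (Limits.Sigma.desc (f := g) (fun i => t.inj i.1) : ∐ g ⟶ t.pt)) ?_ ?_⟩⟩⟩
  · intro t i
    by_cases h : IsZero (f i)
    · exact h.eq_of_src _ _
    · simp [c, h, g]
  · intro t m hm
    refine Limits.Sigma.hom_ext (f := g) _ _ (fun i => ?_)
    have := hm i.1
    have hi : ¬ IsZero (f i.1) := i.2
    simp only [c, Cofan.inj, Cofan.mk_ι_app, dif_pos hi] at this
    exact this.trans (by simp [g, Cofan.inj])

/-- A triple `(A, Φ, w)`: an autoequivalence `Φ` of `A` (with a chosen quasi-inverse) and a natural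
transformation `w : Id ⟶ Φ` with `w_{Φ X} = Φ (w_X)`. -/
structure FactTriple (A : Type u₁) [Category.{v₁} A] where
  Φ : A ≌ A
  w : 𝟭 A ⟶ Φ.functor
  w_map : ∀ X : A, w.app (Φ.functor.obj X) = Φ.functor.map (w.app X)

namespace FactTriple

variable {A : Type u₁} [Category.{v₁} A] (T : FactTriple A)

theorem w_nat {X Y : A} (f : X ⟶ Y) :
    f ≫ T.w.app Y = T.w.app X ≫ T.Φ.functor.map f := T.w.naturality f

instance [Abelian A] : T.Φ.functor.Additive := by
  have := preservesBinaryBiproducts_of_preservesBinaryCoproducts T.Φ.functor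
  exact Functor.additive_of_preservesBinaryBiproducts _

instance [Abelian A] : T.Φ.inverse.Additive := by
  infer_instance

end FactTriple

/-- A factorization of `(A, Φ, w)`: objects `X₁` (in degree `-1`) and `X₀` (in degree `0`), a morphism
`d₁ : X₁ ⟶ X₀` and a morphism `Φ⁻¹ X₀ ⟶ X₁`, where the latter is recorded through the morphism
`d₀ : X₀ ⟶ Φ X₁` adjoint to it (see `phi`, `phi_d₁`, `d₁_map_phi` and `ofPhi` below). -/
structure Factorization {A : Type u₁} [Category.{v₁} A] (T : FactTriple A) where
  X₁ : A
  X₀ : A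
  d₁ : X₁ ⟶ X₀
  d₀ : X₀ ⟶ T.Φ.functor.obj X₁
  d₁_d₀ : d₁ ≫ d₀ = T.w.app X₁
  d₀_d₁ : d₀ ≫ T.Φ.functor.map d₁ = T.w.app X₀

namespace Factorization

attribute [simp] d₁_d₀ d₀_d₁

variable {A : Type u₁} [Category.{v₁} A] {T : FactTriple A}

@[simp] theorem d₁_d₀_assoc (E : Factorization T) {Z : A} (k : T.Φ.functor.obj E.X₁ ⟶ Z) :
    E.d₁ ≫ E.d₀ ≫ k = T.w.app E.X₁ ≫ k := by
  rw [← Category.assoc, E.d₁_d₀]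

@[simp] theorem d₀_d₁_assoc (E : Factorization T) {Z : A} (k : T.Φ.functor.obj E.X₀ ⟶ Z) :
    E.d₀ ≫ T.Φ.functor.map E.d₁ ≫ k = T.w.app E.X₀ ≫ k := by
  rw [← Category.assoc, E.d₀_d₁]

/-- Morphisms of factorizations. -/
@[ext]
structure Hom (E F : Factorization T) where
  f₁ : E.X₁ ⟶ F.X₁
  f₀ : E.X₀ ⟶ F.X₀
  comm₁ : f₁ ≫ F.d₁ = E.d₁ ≫ f₀
  comm₀ : f₀ ≫ F.d₀ = E.d₀ ≫ T.Φ.functor.map f₁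

theorem Hom.comm₁_assoc {E F : Factorization T} (f : Hom E F) {Z : A} (k : F.X₀ ⟶ Z) :
    f.f₁ ≫ F.d₁ ≫ k = E.d₁ ≫ f.f₀ ≫ k := by
  rw [← Category.assoc, f.comm₁, Category.assoc]

theorem Hom.comm₀_assoc {E F : Factorization T} (f : Hom E F) {Z : A}
    (k : T.Φ.functor.obj F.X₁ ⟶ Z) :
    f.f₀ ≫ F.d₀ ≫ k = E.d₀ ≫ T.Φ.functor.map f.f₁ ≫ k := by
  rw [← Category.assoc, f.comm₀, Category.assoc]

instance : Category (Factorization T) where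
  Hom := Hom
  id E := { f₁ := 𝟙 _, f₀ := 𝟙 _, comm₁ := by simp, comm₀ := by simp }
  comp f g :=
    { f₁ := f.f₁ ≫ g.f₁
      f₀ := f.f₀ ≫ g.f₀
      comm₁ := by rw [Category.assoc, g.comm₁, f.comm₁_assoc]
      comm₀ := by rw [Category.assoc, g.comm₀, f.comm₀_assoc, Functor.map_comp] }

@[ext] theorem hom_ext {E F : Factorization T} {f g : E ⟶ F}
    (h₁ : f.f₁ = g.f₁) (h₀ : f.f₀ = g.f₀) : f = g := Hom.ext h₁ h₀

@[simp] theorem id_f₁ (E : Factorization T) : Hom.f₁ (𝟙 E) = 𝟙 _ := rfl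
@[simp] theorem id_f₀ (E : Factorization T) : Hom.f₀ (𝟙 E) = 𝟙 _ := rfl
@[simp] theorem comp_f₁ {E F G : Factorization T} (f : E ⟶ F) (g : F ⟶ G) :
    (f ≫ g).f₁ = f.f₁ ≫ g.f₁ := rfl
@[simp] theorem comp_f₀ {E F G : Factorization T} (f : E ⟶ F) (g : F ⟶ G) :
    (f ≫ g).f₀ = f.f₀ ≫ g.f₀ := rfl

theorem comp_f₁_assoc {E F G : Factorization T} (f : E ⟶ F) (g : F ⟶ G) {Z : A} (k : G.X₁ ⟶ Z) :
    (f ≫ g).f₁ ≫ k = f.f₁ ≫ g.f₁ ≫ k := Category.assoc _ _ _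

theorem comp_f₀_assoc {E F G : Factorization T} (f : E ⟶ F) (g : F ⟶ G) {Z : A} (k : G.X₀ ⟶ Z) :
    (f ≫ g).f₀ ≫ k = f.f₀ ≫ g.f₀ ≫ k := Category.assoc _ _ _

variable [Abelian A]

section
variable {E F : Factorization T}

instance : Zero (E ⟶ F) := ⟨{ f₁ := 0, f₀ := 0, comm₁ := by simp, comm₀ := by simp }⟩
instance : Add (E ⟶ F) := ⟨fun f g =>
  { f₁ := f.f₁ + g.f₁, f₀ := f.f₀ + g.f₀
    comm₁ := by simp [f.comm₁, g.comm₁], comm₀ := by simp [f.comm₀, g.comm₀] }⟩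
instance : Neg (E ⟶ F) := ⟨fun f =>
  { f₁ := -f.f₁, f₀ := -f.f₀
    comm₁ := by simp [f.comm₁], comm₀ := by simp [f.comm₀] }⟩
instance : Sub (E ⟶ F) := ⟨fun f g =>
  { f₁ := f.f₁ - g.f₁, f₀ := f.f₀ - g.f₀
    comm₁ := by simp [f.comm₁, g.comm₁], comm₀ := by simp [f.comm₀, g.comm₀] }⟩
instance : SMul ℕ (E ⟶ F) := ⟨fun n f =>
  { f₁ := n • f.f₁, f₀ := n • f.f₀
    comm₁ := by simp [f.comm₁]
    comm₀ := by simp [f.comm₀] }⟩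
instance : SMul ℤ (E ⟶ F) := ⟨fun n f =>
  { f₁ := n • f.f₁, f₀ := n • f.f₀
    comm₁ := by simp [f.comm₁]
    comm₀ := by simp [f.comm₀] }⟩

@[simp] theorem zero_f₁ : (0 : E ⟶ F).f₁ = 0 := rfl
@[simp] theorem zero_f₀ : (0 : E ⟶ F).f₀ = 0 := rfl
@[simp] theorem add_f₁ (f g : E ⟶ F) : (f + g).f₁ = f.f₁ + g.f₁ := rfl
@[simp] theorem add_f₀ (f g : E ⟶ F) : (f + g).f₀ = f.f₀ + g.f₀ := rfl
@[simp] theorem neg_f₁ (f : E ⟶ F) : (-f).f₁ = -f.f₁ := rfl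
@[simp] theorem neg_f₀ (f : E ⟶ F) : (-f).f₀ = -f.f₀ := rfl
@[simp] theorem sub_f₁ (f g : E ⟶ F) : (f - g).f₁ = f.f₁ - g.f₁ := rfl
@[simp] theorem sub_f₀ (f g : E ⟶ F) : (f - g).f₀ = f.f₀ - g.f₀ := rfl

instance : AddCommGroup (E ⟶ F) :=
  Function.Injective.addCommGroup (fun f : E ⟶ F => ((f.f₁, f.f₀) : (E.X₁ ⟶ F.X₁) × (E.X₀ ⟶ F.X₀)))
    (fun _ _ h => hom_ext (congrArg Prod.fst h) (congrArg Prod.snd h))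
    rfl (fun _ _ => rfl) (fun _ => rfl) (fun _ _ => rfl) (fun _ _ => rfl) (fun _ _ => rfl)

end

instance : Preadditive (Factorization T) where
  add_comp := by intros; ext <;> simp
  comp_add := by intros; ext <;> simp

variable (T) in
/-- The component in degree `-1`. -/
@[simps]
def ev₁ : Factorization T ⥤ A where
  obj E := E.X₁
  map f := f.f₁

variable (T) in
/-- The component in degree `0`. -/
@[simps]
def ev₀ : Factorization T ⥤ A where
  obj E := E.X₀
  map f := f.f₀

instance : (ev₁ T).Additive where
instance : (ev₀ T).Additive where

theorem isZero {E : Factorization T} (h₁ : IsZero E.X₁) (h₀ : IsZero E.X₀) : IsZero E := by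
  rw [IsZero.iff_id_eq_zero]
  ext
  · exact h₁.eq_of_src _ _
  · exact h₀.eq_of_src _ _

variable (T) in
/-- The shift `[1]`. -/
@[simps]
abbrev shift : Factorization T ⥤ Factorization T where
  obj E :=
    { X₁ := E.X₀
      X₀ := T.Φ.functor.obj E.X₁
      d₁ := -E.d₀
      d₀ := -T.Φ.functor.map E.d₁
      d₁_d₀ := by simp
      d₀_d₁ := by simp [← Functor.map_comp, T.w_map] }
  map f :=
    { f₁ := f.f₀
      f₀ := T.Φ.functor.map f.f₁
      comm₁ := by simp [f.comm₀]
      comm₀ := by simp [← Functor.map_comp, f.comm₁] }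

variable (T) in
/-- The inverse shift `[-1]`. -/
@[simps]
abbrev unshift : Factorization T ⥤ Factorization T where
  obj E :=
    { X₁ := T.Φ.inverse.obj E.X₀
      X₀ := E.X₁
      d₁ := -(T.Φ.inverse.map E.d₀ ≫ T.Φ.unitInv.app E.X₁)
      d₀ := -(E.d₁ ≫ T.Φ.counitInv.app E.X₀)
      d₁_d₀ := by
        apply T.Φ.functor.map_injective
        have h := T.w_nat (T.Φ.counitInv.app E.X₀)
        dsimp at h
        simp [← T.w_map, ← h]
      d₀_d₁ := by simp }
  map f :=
    { f₁ := T.Φ.inverse.map f.f₀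
      f₀ := f.f₁
      comm₁ := by
        have h := T.Φ.unitInv.naturality f.f₁
        dsimp at h
        have h' := congrArg T.Φ.inverse.map f.comm₀
        simp only [Functor.map_comp] at h'
        simp only [Preadditive.comp_neg, Preadditive.neg_comp, Category.assoc, reassoc_of% h', ← h]
      comm₀ := by
        simp [f.comm₁_assoc] }

instance : (shift T).Additive where
instance : (unshift T).Additive where


variable (T) in
/-- The shift `[n]` for `n ≥ 0`. -/
def shiftNat : ℕ → (Factorization T ⥤ Factorization T)
  | 0 => 𝟭 _
  | k + 1 => shiftNat k ⋙ shift T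

variable (T) in
/-- The shift `[-n]` for `n ≥ 0`. -/
def unshiftNat : ℕ → (Factorization T ⥤ Factorization T)
  | 0 => 𝟭 _
  | k + 1 => unshiftNat k ⋙ unshift T

variable (T) in
/-- The shift `[n]` for an integer `n`. -/
def shiftZ : ℤ → (Factorization T ⥤ Factorization T)
  | .ofNat k => shiftNat T k
  | .negSucc k => unshiftNat T (k + 1)

theorem shiftNat_additive (k : ℕ) : (shiftNat T k).Additive := by
  induction k with
  | zero => dsimp [shiftNat]; infer_instance
  | succ k ih => dsimp [shiftNat]; infer_instance

theorem unshiftNat_additive (k : ℕ) : (unshiftNat T k).Additive := by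
  induction k with
  | zero => dsimp [unshiftNat]; infer_instance
  | succ k ih => dsimp [unshiftNat]; infer_instance

instance (n : ℤ) : (shiftZ T n).Additive := by
  cases n with
  | ofNat k => exact shiftNat_additive k
  | negSucc k => exact unshiftNat_additive (k + 1)

/-- A description of the functor `G` as `F[1]`: isomorphisms `F(E)^0 ≅ G(E)^{-1}` and
`G(E)^0 ≅ Φ (F(E)^{-1})` under which the differentials agree up to sign. -/
structure Link (F G : Factorization T ⥤ Factorization T) where
  c₀ : ∀ E, (F.obj E).X₀ ≅ (G.obj E).X₁
  c₁ : ∀ E, (G.obj E).X₀ ≅ T.Φ.functor.obj (F.obj E).X₁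
  nat₀ : ∀ {E E'} (f : E ⟶ E'), (F.map f).f₀ ≫ (c₀ E').hom = (c₀ E).hom ≫ (G.map f).f₁
  nat₁ : ∀ {E E'} (f : E ⟶ E'),
    (G.map f).f₀ ≫ (c₁ E').hom = (c₁ E).hom ≫ T.Φ.functor.map (F.map f).f₁
  d₁_eq : ∀ E, (G.obj E).d₁ ≫ (c₁ E).hom = -((c₀ E).inv ≫ (F.obj E).d₀)
  d₀_eq : ∀ E, (G.obj E).d₀ ≫ T.Φ.functor.map (c₀ E).inv =
    -((c₁ E).hom ≫ T.Φ.functor.map (F.obj E).d₁)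

/-- `F[1]` is the shift of `F`. -/
abbrev linkShift (F : Factorization T ⥤ Factorization T) : Link F (F ⋙ shift T) where
  c₀ E := Iso.refl _
  c₁ E := Iso.refl _
  nat₀ f := (Category.comp_id _).trans (Category.id_comp _).symm
  nat₁ f := (Category.comp_id _).trans (Category.id_comp _).symm
  d₁_eq E := by
    change (-(F.obj E).d₀) ≫ 𝟙 (T.Φ.functor.obj _) = -(𝟙 _ ≫ (F.obj E).d₀)
    simp
  d₀_eq E := by
    change (-T.Φ.functor.map (F.obj E).d₁) ≫ T.Φ.functor.map (𝟙 (F.obj E).X₀) =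
      -(𝟙 (T.Φ.functor.obj _) ≫ T.Φ.functor.map (F.obj E).d₁)
    simp

/-- `G` is the shift of `G[-1]`. -/
abbrev linkUnshift (G : Factorization T ⥤ Factorization T) : Link (G ⋙ unshift T) G where
  c₀ E := Iso.refl _
  c₁ E := (T.Φ.counitIso.app (G.obj E).X₀).symm
  nat₀ f := (Category.comp_id _).trans (Category.id_comp _).symm
  nat₁ f := T.Φ.counitInv.naturality ((G.map f).f₀)
  d₁_eq E := by
    change (G.obj E).d₁ ≫ T.Φ.counitInv.app (G.obj E).X₀ =
      -(𝟙 (G.obj E).X₁ ≫ (-((G.obj E).d₁ ≫ T.Φ.counitInv.app (G.obj E).X₀)))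
    simp
  d₀_eq E := by
    change (G.obj E).d₀ ≫ T.Φ.functor.map (𝟙 (G.obj E).X₁) =
      -(T.Φ.counitInv.app (G.obj E).X₀ ≫ T.Φ.functor.map
        (-(T.Φ.inverse.map (G.obj E).d₀ ≫ T.Φ.unitInv.app (G.obj E).X₁)))
    simp

variable (T) in
/-- `[n + 1]` is the shift of `[n]`. -/
def linkZ : (n : ℤ) → Link (shiftZ T n) (shiftZ T (n + 1))
  | .ofNat k => linkShift (shiftNat T k)
  | .negSucc 0 => linkUnshift (𝟭 _)
  | .negSucc (k + 1) => linkUnshift (unshiftNat T (k + 1))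

variable (T) in
/-- `[m]` is the shift of `[n]` if `m = n + 1`. -/
def link (n m : ℤ) (h : n + 1 = m) : Link (shiftZ T n) (shiftZ T m) := by
  subst h; exact linkZ T n

theorem Link.nat₁_assoc {F G : Factorization T ⥤ Factorization T} (l : Link F G) {E E'}
    (f : E ⟶ E') {Z : A} (k : T.Φ.functor.obj (F.obj E').X₁ ⟶ Z) :
    (G.map f).f₀ ≫ (l.c₁ E').hom ≫ k =
      (l.c₁ E).hom ≫ T.Φ.functor.map (F.map f).f₁ ≫ k := by
  rw [← Category.assoc, l.nat₁, Category.assoc]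

/-- A bounded complex of factorizations. -/
class IsBdd (X : CochainComplex (Factorization T) ℤ) : Prop where
  bounded : ∃ a b : ℤ, ∀ i, (i < a ∨ b < i) → IsZero (X.X i)

variable (X Y : CochainComplex (Factorization T) ℤ)

theorem IsBdd.hasCoproduct (X : CochainComplex (Factorization T) ℤ) [hX : IsBdd X]
    (F : ℤ → (Factorization T ⥤ A)) [∀ n, (F n).Additive] :
    HasCoproduct (fun n : ℤ => (F n).obj (X.X (-n))) := by
  obtain ⟨a, b, h⟩ := hX.bounded
  refine hasCoproduct_of_finite_nonzero _ ((Set.finite_Icc (-b) (-a)).subset ?_)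
  intro n hn
  simp only [Set.mem_ofPred_eq] at hn
  by_contra h'
  refine hn ((F n).map_isZero (h _ ?_))
  simp only [Set.mem_Icc, not_and_or, not_le] at h'
  omega

instance [IsBdd X] : HasCoproduct (fun n : ℤ => ((shiftZ T n).obj (X.X (-n))).X₁) :=
  IsBdd.hasCoproduct X (fun n => shiftZ T n ⋙ ev₁ T)

instance [IsBdd X] : HasCoproduct (fun n : ℤ => ((shiftZ T n).obj (X.X (-n))).X₀) :=
  IsBdd.hasCoproduct X (fun n => shiftZ T n ⋙ ev₀ T)

/-- The component in degree `-1` of the totalization, `⨁ₙ (X^{-n}[n])^{-1}`. -/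
abbrev tot₁ [IsBdd X] : A := ∐ fun n : ℤ => ((shiftZ T n).obj (X.X (-n))).X₁
/-- The component in degree `0` of the totalization, `⨁ₙ (X^{-n}[n])^0`. -/
abbrev tot₀ [IsBdd X] : A := ∐ fun n : ℤ => ((shiftZ T n).obj (X.X (-n))).X₀
/-- The inclusion of a summand of the totalization. -/
abbrev ι₁ [IsBdd X] (n : ℤ) : ((shiftZ T n).obj (X.X (-n))).X₁ ⟶ tot₁ X :=
  Limits.Sigma.ι (fun n : ℤ => ((shiftZ T n).obj (X.X (-n))).X₁) n
/-- The inclusion of a summand of the totalization. -/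
abbrev ι₀ [IsBdd X] (n : ℤ) : ((shiftZ T n).obj (X.X (-n))).X₀ ⟶ tot₀ X :=
  Limits.Sigma.ι (fun n : ℤ => ((shiftZ T n).obj (X.X (-n))).X₀) n

/-- The map `(X^{-n}[n])^{-1} ⟶ (X^{-n+1}[n])^{-1} = (X^{-n+1}[n-1])^0` given by the differential
of `X`. -/
def g₁ (n : ℤ) : ((shiftZ T n).obj (X.X (-n))).X₁ ⟶
    ((shiftZ T (n - 1)).obj (X.X (-(n - 1)))).X₀ :=
  ((shiftZ T n).map (X.d (-n) (-(n - 1)))).f₁ ≫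
    ((link T (n - 1) n (by omega)).c₀ (X.X (-(n - 1)))).inv

/-- The map `(X^{-n}[n])^0 ⟶ (X^{-n+1}[n])^0 = Φ ((X^{-n+1}[n-1])^{-1})` given by the differential
of `X`. -/
def g₀ (n : ℤ) : ((shiftZ T n).obj (X.X (-n))).X₀ ⟶
    T.Φ.functor.obj ((shiftZ T (n - 1)).obj (X.X (-(n - 1)))).X₁ :=
  ((shiftZ T n).map (X.d (-n) (-(n - 1)))).f₀ ≫
    ((link T (n - 1) n (by omega)).c₁ (X.X (-(n - 1)))).hom

/-- The structure map `d₁` of the totalization. -/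
def totd₁ [IsBdd X] : tot₁ X ⟶ tot₀ X :=
  Limits.Sigma.desc fun n => ((shiftZ T n).obj (X.X (-n))).d₁ ≫ ι₀ X n + g₁ X n ≫ ι₀ X (n - 1)

/-- The structure map `d₀` of the totalization. -/
def totd₀ [IsBdd X] : tot₀ X ⟶ T.Φ.functor.obj (tot₁ X) :=
  Limits.Sigma.desc fun n => ((shiftZ T n).obj (X.X (-n))).d₀ ≫ T.Φ.functor.map (ι₁ X n) +
    g₀ X n ≫ T.Φ.functor.map (ι₁ X (n - 1))

@[simp]
theorem ι₁_totd₁ [IsBdd X] (n : ℤ) : ι₁ X n ≫ totd₁ X =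
    ((shiftZ T n).obj (X.X (-n))).d₁ ≫ ι₀ X n + g₁ X n ≫ ι₀ X (n - 1) := by
  simp [totd₁, ι₁]

@[simp]
theorem ι₁_totd₁_assoc [IsBdd X] (n : ℤ) {Z : A} (k : tot₀ X ⟶ Z) : ι₁ X n ≫ totd₁ X ≫ k =
    (((shiftZ T n).obj (X.X (-n))).d₁ ≫ ι₀ X n + g₁ X n ≫ ι₀ X (n - 1)) ≫ k := by
  rw [← Category.assoc, ι₁_totd₁]

@[simp]
theorem ι₀_totd₀ [IsBdd X] (n : ℤ) : ι₀ X n ≫ totd₀ X =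
    ((shiftZ T n).obj (X.X (-n))).d₀ ≫ T.Φ.functor.map (ι₁ X n) +
    g₀ X n ≫ T.Φ.functor.map (ι₁ X (n - 1)) := by
  simp [totd₀, ι₀]

@[simp]
theorem ι₀_totd₀_assoc [IsBdd X] (n : ℤ) {Z : A} (k : T.Φ.functor.obj (tot₁ X) ⟶ Z) :
    ι₀ X n ≫ totd₀ X ≫ k =
      (((shiftZ T n).obj (X.X (-n))).d₀ ≫ T.Φ.functor.map (ι₁ X n) +
        g₀ X n ≫ T.Φ.functor.map (ι₁ X (n - 1))) ≫ k := by
  rw [← Category.assoc, ι₀_totd₀]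

theorem Link.nat₀' {F G : Factorization T ⥤ Factorization T} (l : Link F G) {E E'} (f : E ⟶ E') :
    (l.c₀ E).inv ≫ (F.map f).f₀ = (G.map f).f₁ ≫ (l.c₀ E').inv := by
  rw [Iso.inv_comp_eq, ← Category.assoc, Iso.eq_comp_inv, l.nat₀]

theorem Link.nat₀'_assoc {F G : Factorization T ⥤ Factorization T} (l : Link F G) {E E'}
    (f : E ⟶ E') {Z : A} (k : (F.obj E').X₀ ⟶ Z) :
    (l.c₀ E).inv ≫ (F.map f).f₀ ≫ k = (G.map f).f₁ ≫ (l.c₀ E').inv ≫ k := by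
  rw [← Category.assoc, l.nat₀', Category.assoc]

theorem d₁_g₀ (n : ℤ) :
    ((shiftZ T n).obj (X.X (-n))).d₁ ≫ g₀ X n +
      g₁ X n ≫ ((shiftZ T (n - 1)).obj (X.X (-(n - 1)))).d₀ = 0 := by
  simp only [g₀, g₁, Category.assoc]
  rw [← Hom.comm₁_assoc, Link.d₁_eq]
  simp

theorem d₀_g₁ (n : ℤ) :
    ((shiftZ T n).obj (X.X (-n))).d₀ ≫ T.Φ.functor.map (g₁ X n) +
      g₀ X n ≫ T.Φ.functor.map ((shiftZ T (n - 1)).obj (X.X (-(n - 1)))).d₁ = 0 := by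
  simp only [g₀, g₁, Category.assoc, Functor.map_comp]
  rw [← Hom.comm₀_assoc, Link.d₀_eq]
  simp

theorem g₁_g₀ (n : ℤ) : g₁ X n ≫ g₀ X (n - 1) = 0 := by
  simp only [g₀, g₁, Category.assoc]
  rw [Link.nat₀'_assoc, ← comp_f₁_assoc, ← Functor.map_comp]
  simp

theorem g₀_g₁ (n : ℤ) : g₀ X n ≫ T.Φ.functor.map (g₁ X (n - 1)) = 0 := by
  simp only [g₀, g₁, Category.assoc, Functor.map_comp]
  rw [← (link T (n - 1) n (by omega)).nat₁_assoc, ← comp_f₀_assoc, ← Functor.map_comp]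
  simp

/-- The totalization of a bounded complex of factorizations: the sum of the `X^{-n}[n]`, with
structure maps the sum of those of the `X^{-n}[n]` and of the differential of `X`. -/
abbrev tot [IsBdd X] : Factorization T where
  X₁ := tot₁ X
  X₀ := tot₀ X
  d₁ := totd₁ X
  d₀ := totd₀ X
  d₁_d₀ := by
    refine Limits.Sigma.hom_ext _ _ (fun n => ?_)
    have h1 := d₁_g₀ X n
    have h2 := g₁_g₀ X n
    have h3 := T.w_nat (ι₁ X n)
    rw [add_eq_zero_iff_eq_neg] at h1
    rw [ι₁_totd₁_assoc, h3]
    simp only [Preadditive.add_comp, Category.assoc, ι₀_totd₀, Preadditive.comp_add, d₁_d₀_assoc,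
      reassoc_of% h1, reassoc_of% h2]
    simp
  d₀_d₁ := by
    refine Limits.Sigma.hom_ext _ _ (fun n => ?_)
    have h1 := d₀_g₁ X n
    have h2 := g₀_g₁ X n
    have h3 := T.w_nat (ι₀ X n)
    rw [add_eq_zero_iff_eq_neg] at h1
    rw [ι₀_totd₀_assoc, h3]
    simp only [Preadditive.add_comp, Category.assoc, ← Functor.map_comp, ι₁_totd₁,
      Preadditive.comp_add, Functor.map_add]
    simp only [Functor.map_comp, d₀_d₁_assoc, reassoc_of% h1, reassoc_of% h2]
    simp


theorem g₁_nat {X Y : CochainComplex (Factorization T) ℤ} (f : X ⟶ Y) (n : ℤ) :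
    ((shiftZ T n).map (f.f (-n))).f₁ ≫ g₁ Y n =
      g₁ X n ≫ ((shiftZ T (n - 1)).map (f.f (-(n - 1)))).f₀ := by
  simp only [g₁, Category.assoc]
  rw [Link.nat₀', ← comp_f₁_assoc, ← comp_f₁_assoc, ← Functor.map_comp, ← Functor.map_comp, f.comm]

theorem g₀_nat {X Y : CochainComplex (Factorization T) ℤ} (f : X ⟶ Y) (n : ℤ) :
    ((shiftZ T n).map (f.f (-n))).f₀ ≫ g₀ Y n =
      g₀ X n ≫ T.Φ.functor.map ((shiftZ T (n - 1)).map (f.f (-(n - 1)))).f₁ := by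
  simp only [g₀, Category.assoc]
  rw [← Link.nat₁, ← comp_f₀_assoc, ← comp_f₀_assoc, ← Functor.map_comp, ← Functor.map_comp, f.comm]

variable {X Y} in
/-- Functoriality of the totalization. -/
def totMap [IsBdd X] [IsBdd Y] (f : X ⟶ Y) : tot X ⟶ tot Y where
  f₁ := Limits.Sigma.desc fun n => ((shiftZ T n).map (f.f (-n))).f₁ ≫ ι₁ Y n
  f₀ := Limits.Sigma.desc fun n => ((shiftZ T n).map (f.f (-n))).f₀ ≫ ι₀ Y n
  comm₁ := by
    refine Limits.Sigma.hom_ext _ _ (fun n => ?_)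
    change _ ≫ _ ≫ totd₁ Y = ι₁ X n ≫ totd₁ X ≫ _
    rw [ι₁_totd₁_assoc]
    simp [(reassoc_of% (g₁_nat f n)), Hom.comm₁_assoc]
  comm₀ := by
    refine Limits.Sigma.hom_ext _ _ (fun n => ?_)
    change _ ≫ _ ≫ totd₀ Y = ι₀ X n ≫ totd₀ X ≫ _
    rw [ι₀_totd₀_assoc]
    simp [(reassoc_of% (g₀_nat f n)), Hom.comm₀_assoc, ← Functor.map_comp]

variable {X Y} in
@[simp]
theorem ι₁_totMap [IsBdd X] [IsBdd Y] (f : X ⟶ Y) (n : ℤ) :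
    ι₁ X n ≫ (totMap f).f₁ = ((shiftZ T n).map (f.f (-n))).f₁ ≫ ι₁ Y n := by
  simp [totMap, ι₁]

variable {X Y} in
@[simp]
theorem ι₀_totMap [IsBdd X] [IsBdd Y] (f : X ⟶ Y) (n : ℤ) :
    ι₀ X n ≫ (totMap f).f₀ = ((shiftZ T n).map (f.f (-n))).f₀ ≫ ι₀ Y n := by
  simp [totMap, ι₀]

theorem ι₁_totMap_assoc {X Y : CochainComplex (Factorization T) ℤ} [IsBdd X] [IsBdd Y]
    (f : X ⟶ Y) (n : ℤ) {Z : A} (k : tot₁ Y ⟶ Z) :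
    ι₁ X n ≫ (totMap f).f₁ ≫ k = ((shiftZ T n).map (f.f (-n))).f₁ ≫ ι₁ Y n ≫ k := by
  rw [← Category.assoc, ι₁_totMap, Category.assoc]

theorem ι₀_totMap_assoc {X Y : CochainComplex (Factorization T) ℤ} [IsBdd X] [IsBdd Y]
    (f : X ⟶ Y) (n : ℤ) {Z : A} (k : tot₀ Y ⟶ Z) :
    ι₀ X n ≫ (totMap f).f₀ ≫ k = ((shiftZ T n).map (f.f (-n))).f₀ ≫ ι₀ Y n ≫ k := by
  rw [← Category.assoc, ι₀_totMap, Category.assoc]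

theorem totMap_id [IsBdd X] : totMap (𝟙 X) = 𝟙 (tot X) := by
  ext n
  · exact (ι₁_totMap _ n).trans (by simp)
  · exact (ι₀_totMap _ n).trans (by simp)

theorem totMap_comp {X Y Z : CochainComplex (Factorization T) ℤ} [IsBdd X] [IsBdd Y] [IsBdd Z]
    (f : X ⟶ Y) (g : Y ⟶ Z) : totMap (f ≫ g) = totMap f ≫ totMap g := by
  ext n
  · exact (ι₁_totMap _ n).trans (by rw [comp_f₁, ι₁_totMap_assoc, ι₁_totMap]; simp)
  · exact (ι₀_totMap _ n).trans (by rw [comp_f₀, ι₀_totMap_assoc, ι₀_totMap]; simp)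

theorem totMap_sub {X Y : CochainComplex (Factorization T) ℤ} [IsBdd X] [IsBdd Y]
    (f g : X ⟶ Y) : totMap (f - g) = totMap f - totMap g := by
  ext n
  · exact (ι₁_totMap _ n).trans (by
      rw [sub_f₁, Preadditive.comp_sub, ι₁_totMap, ι₁_totMap]; simp [Functor.map_sub])
  · exact (ι₀_totMap _ n).trans (by
      rw [sub_f₀, Preadditive.comp_sub, ι₀_totMap, ι₀_totMap]; simp [Functor.map_sub])

/-! ### Homotopies -/

/-- The morphism `φ^{-1} : Φ⁻¹ X₀ ⟶ X₁` of a factorization. -/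
def phi (F : Factorization T) : T.Φ.inverse.obj F.X₀ ⟶ F.X₁ :=
  T.Φ.inverse.map F.d₀ ≫ T.Φ.unitInv.app F.X₁

theorem phi_d₁ (F : Factorization T) :
    F.phi ≫ F.d₁ = T.Φ.inverse.map (T.w.app F.X₀) ≫ T.Φ.unitInv.app F.X₀ := by
  have := T.Φ.unitInv.naturality F.d₁
  dsimp at this
  rw [phi, Category.assoc, ← this, ← F.d₀_d₁, Functor.map_comp, Category.assoc]

theorem d₁_map_phi (F : Factorization T) :
    F.d₁ ≫ T.Φ.counitInv.app F.X₀ ≫ T.Φ.functor.map F.phi = T.w.app F.X₁ := by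
  simp [phi]

/-- The factorization with given `φ^{-1} : Φ⁻¹ X₀ ⟶ X₁` and `φ^0 : X₁ ⟶ X₀`. -/
def ofPhi (X₁ X₀ : A) (p : T.Φ.inverse.obj X₀ ⟶ X₁) (q : X₁ ⟶ X₀)
    (hpq : p ≫ q = T.Φ.inverse.map (T.w.app X₀) ≫ T.Φ.unitInv.app X₀)
    (hqp : q ≫ T.Φ.counitInv.app X₀ ≫ T.Φ.functor.map p = T.w.app X₁) : Factorization T where
  X₁ := X₁
  X₀ := X₀
  d₁ := q
  d₀ := T.Φ.counitInv.app X₀ ≫ T.Φ.functor.map p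
  d₁_d₀ := hqp
  d₀_d₁ := by
    rw [Category.assoc, ← Functor.map_comp, hpq]
    simp

theorem phi_ofPhi (X₁ X₀ : A) (p : T.Φ.inverse.obj X₀ ⟶ X₁) (q : X₁ ⟶ X₀)
    (hpq : p ≫ q = T.Φ.inverse.map (T.w.app X₀) ≫ T.Φ.unitInv.app X₀)
    (hqp : q ≫ T.Φ.counitInv.app X₀ ≫ T.Φ.functor.map p = T.w.app X₁) :
    (ofPhi X₁ X₀ p q hpq hqp).phi = p := by
  simp [phi, ofPhi]

/-- The two components `h^{-1} : E^{-1} ⟶ Φ⁻¹ F^0` and `h^0 : E^0 ⟶ F^{-1}` of a homotopy. -/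
structure HData (E F : Factorization T) where
  h₁ : E.X₁ ⟶ T.Φ.inverse.obj F.X₀
  h₀ : E.X₀ ⟶ F.X₁

/-- `h` is a homotopy from `f` to zero. -/
structure HData.IsNull {E F : Factorization T} (h : HData E F) (f : E ⟶ F) : Prop where
  eq₁ : f.f₁ = E.d₁ ≫ h.h₀ + h.h₁ ≫ F.phi
  eq₀ : f.f₀ = h.h₀ ≫ F.d₁ + (E.d₀ ≫ T.Φ.functor.map h.h₁ ≫ T.Φ.counit.app F.X₀ : E.X₀ ⟶ F.X₀)

/-- The shift of a homotopy. -/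
def HData.shift {E F : Factorization T} (h : HData E F) :
    HData ((shift T).obj E) ((Factorization.shift T).obj F) where
  h₁ := -(h.h₀ ≫ T.Φ.unit.app F.X₁)
  h₀ := -(T.Φ.functor.map h.h₁ ≫ T.Φ.counit.app F.X₀)

/-- The inverse shift of a homotopy. -/
def HData.unshift {E F : Factorization T} (h : HData E F) :
    HData ((unshift T).obj E) ((Factorization.unshift T).obj F) where
  h₁ := -T.Φ.inverse.map h.h₀
  h₀ := -h.h₁

/-- The `n`-fold shift of a homotopy. -/
def HData.shiftNat {E F : Factorization T} (h : HData E F) :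
    (k : ℕ) → HData ((shiftNat T k).obj E) ((Factorization.shiftNat T k).obj F)
  | 0 => h
  | k + 1 => (h.shiftNat k).shift

/-- The `n`-fold inverse shift of a homotopy. -/
def HData.unshiftNat {E F : Factorization T} (h : HData E F) :
    (k : ℕ) → HData ((unshiftNat T k).obj E) ((Factorization.unshiftNat T k).obj F)
  | 0 => h
  | k + 1 => (h.unshiftNat k).unshift

/-- The shift of a homotopy by an integer. -/
def HData.shiftZ {E F : Factorization T} (h : HData E F) :
    (n : ℤ) → HData ((shiftZ T n).obj E) ((Factorization.shiftZ T n).obj F)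
  | .ofNat k => h.shiftNat k
  | .negSucc k => h.unshiftNat (k + 1)

theorem HData.IsNull.shift {E F : Factorization T} {h : HData E F} {f : E ⟶ F} (H : h.IsNull f) :
    h.shift.IsNull ((Factorization.shift T).map f) where
  eq₁ := by
    dsimp
    rw [H.eq₀]
    simp [HData.shift, phi]
    abel
  eq₀ := by
    dsimp
    rw [H.eq₁]
    simp [HData.shift, phi]
    abel

theorem HData.IsNull.unshift {E F : Factorization T} {h : HData E F} {f : E ⟶ F} (H : h.IsNull f) :
    h.unshift.IsNull ((Factorization.unshift T).map f) where
  eq₁ := by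
    dsimp
    rw [H.eq₀]
    simp [HData.unshift, phi]
    abel
  eq₀ := by
    dsimp
    rw [H.eq₁]
    simp [HData.unshift, phi]
    abel

theorem HData.IsNull.shiftZ {E F : Factorization T} {h : HData E F} {f : E ⟶ F} (H : h.IsNull f)
    (n : ℤ) : (h.shiftZ n).IsNull ((Factorization.shiftZ T n).map f) := by
  have h1 : ∀ k, (h.shiftNat k).IsNull ((Factorization.shiftNat T k).map f) := by
    intro k
    induction k with
    | zero => exact H
    | succ k ih => exact ih.shift
  have h2 : ∀ k, (h.unshiftNat k).IsNull ((Factorization.unshiftNat T k).map f) := by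
    intro k
    induction k with
    | zero => exact H
    | succ k ih => exact ih.unshift
  cases n with
  | ofNat k => exact h1 k
  | negSucc k => exact h2 (k + 1)

/-- Compatibility of homotopies with morphisms of factorizations. -/
structure HData.Comm {E F E' F' : Factorization T} (h : HData E F) (h' : HData E' F')
    (u : E ⟶ E') (v : F ⟶ F') : Prop where
  eq₁ : u.f₁ ≫ h'.h₁ = h.h₁ ≫ T.Φ.inverse.map v.f₀
  eq₀ : u.f₀ ≫ h'.h₀ = h.h₀ ≫ v.f₁

theorem HData.Comm.shift {E F E' F' : Factorization T} {h : HData E F} {h' : HData E' F'}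
    {u : E ⟶ E'} {v : F ⟶ F'} (H : h.Comm h' u v) :
    h.shift.Comm h'.shift ((Factorization.shift T).map u) ((Factorization.shift T).map v) where
  eq₁ := by
    simp [HData.shift, reassoc_of% H.eq₀]
  eq₀ := by
    have := congrArg T.Φ.functor.map H.eq₁
    simp only [Functor.map_comp] at this
    simp [HData.shift, reassoc_of% this]

theorem HData.Comm.unshift {E F E' F' : Factorization T} {h : HData E F} {h' : HData E' F'}
    {u : E ⟶ E'} {v : F ⟶ F'} (H : h.Comm h' u v) :
    h.unshift.Comm h'.unshift ((Factorization.unshift T).map u)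
      ((Factorization.unshift T).map v) where
  eq₁ := by
    simp [HData.unshift, ← Functor.map_comp, H.eq₀]
  eq₀ := by
    simp [HData.unshift, H.eq₁]

theorem HData.Comm.shiftZ {E F E' F' : Factorization T} {h : HData E F} {h' : HData E' F'}
    {u : E ⟶ E'} {v : F ⟶ F'} (H : h.Comm h' u v) (n : ℤ) :
    (h.shiftZ n).Comm (h'.shiftZ n) ((Factorization.shiftZ T n).map u)
      ((Factorization.shiftZ T n).map v) := by
  have h1 : ∀ k, (h.shiftNat k).Comm (h'.shiftNat k) ((Factorization.shiftNat T k).map u)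
      ((Factorization.shiftNat T k).map v) := by
    intro k
    induction k with
    | zero => exact H
    | succ k ih => exact ih.shift
  have h2 : ∀ k, (h.unshiftNat k).Comm (h'.unshiftNat k) ((Factorization.unshiftNat T k).map u)
      ((Factorization.unshiftNat T k).map v) := by
    intro k
    induction k with
    | zero => exact H
    | succ k ih => exact ih.unshift
  cases n with
  | ofNat k => exact h1 k
  | negSucc k => exact h2 (k + 1)

/-- Compatibility of homotopies with a `Link`. -/
structure Link.Compat {F G : Factorization T ⥤ Factorization T} (l : Link F G)
    {E E' : Factorization T} (h : HData (F.obj E) (F.obj E')) (h' : HData (G.obj E) (G.obj E')) :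
    Prop where
  eq₀ : (l.c₀ E).inv ≫ h.h₀ = -(h'.h₁ ≫ T.Φ.inverse.map (l.c₁ E').hom ≫ T.Φ.unitInv.app _)
  eq₁ : (l.c₁ E).hom ≫ T.Φ.functor.map h.h₁ ≫ T.Φ.counit.app _ = -(h'.h₀ ≫ (l.c₀ E').inv)

theorem linkShift_compat (F : Factorization T ⥤ Factorization T) {E E' : Factorization T}
    (h : HData (F.obj E) (F.obj E')) : (linkShift F).Compat h h.shift where
  eq₀ := by
    change 𝟙 (F.obj E).X₀ ≫ h.h₀ = -((-(h.h₀ ≫ T.Φ.unit.app (F.obj E').X₁)) ≫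
      T.Φ.inverse.map (𝟙 (T.Φ.functor.obj _)) ≫ T.Φ.unitInv.app _)
    simp
  eq₁ := by
    change 𝟙 (T.Φ.functor.obj (F.obj E).X₁) ≫ T.Φ.functor.map h.h₁ ≫ T.Φ.counit.app _ =
      -((-(T.Φ.functor.map h.h₁ ≫ T.Φ.counit.app (F.obj E').X₀)) ≫ 𝟙 (F.obj E').X₀)
    simp

theorem linkUnshift_compat (G : Factorization T ⥤ Factorization T) {E E' : Factorization T}
    (h : HData (G.obj E) (G.obj E')) : (linkUnshift G).Compat h.unshift h where
  eq₀ := by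
    change 𝟙 (G.obj E).X₁ ≫ (-h.h₁) = -(h.h₁ ≫
      T.Φ.inverse.map (T.Φ.counitInv.app (G.obj E').X₀) ≫ T.Φ.unitInv.app _)
    simp
  eq₁ := by
    change T.Φ.counitInv.app (G.obj E).X₀ ≫ T.Φ.functor.map (-T.Φ.inverse.map h.h₀) ≫
      T.Φ.counit.app (G.obj E').X₁ = -(h.h₀ ≫ 𝟙 (G.obj E').X₁)
    simp

theorem link_compat {n m : ℤ} (hnm : n + 1 = m) {E E' : Factorization T} (h : HData E E') :
    (link T n m hnm).Compat (h.shiftZ n) (h.shiftZ m) := by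
  subst hnm
  match n with
  | .ofNat k => exact linkShift_compat _ (h.shiftNat k)
  | .negSucc 0 => exact linkUnshift_compat (𝟭 _) h
  | .negSucc (k + 1) => exact linkUnshift_compat _ (h.unshiftNat (k + 1))

variable {X Y} in
theorem totMap_null [IsBdd X] [IsBdd Y] (f : X ⟶ Y) (h : ∀ i, HData (X.X i) (Y.X i))
    (hf : ∀ i, (h i).IsNull (f.f i)) (hd : ∀ i j, (h i).Comm (h j) (X.d i j) (Y.d i j)) :
    ∃ H : HData (tot X) (tot Y), H.IsNull (totMap f) := by
  have hn := fun n : ℤ => (hf (-n)).shiftZ n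
  have hl := fun n : ℤ => link_compat (show (n - 1) + 1 = n by omega) (h (-(n - 1)))
  have hc := fun n : ℤ => (hd (-n) (-(n - 1))).shiftZ n
  have k₁ : ∀ n : ℤ, g₁ X n ≫ ((h (-(n - 1))).shiftZ (n - 1)).h₀ =
      -(((h (-n)).shiftZ n).h₁ ≫ T.Φ.inverse.map (g₀ Y n) ≫ T.Φ.unitInv.app _) := by
    intro n
    have := (hc n).eq₁
    simp only [g₁, g₀, Category.assoc, (hl n).eq₀, Preadditive.comp_neg, reassoc_of% this,
      Functor.map_comp]
  have k₀ : ∀ n : ℤ, g₀ X n ≫ T.Φ.functor.map ((h (-(n - 1))).shiftZ (n - 1)).h₁ ≫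
      T.Φ.counit.app _ = -(((h (-n)).shiftZ n).h₀ ≫ g₁ Y n) := by
    intro n
    have := (hc n).eq₀
    simp only [g₁, g₀, Category.assoc, (hl n).eq₁, Preadditive.comp_neg, reassoc_of% this]
  let H₁ : (tot X).X₁ ⟶ T.Φ.inverse.obj (tot Y).X₀ :=
    Limits.Sigma.desc fun n => ((h (-n)).shiftZ n).h₁ ≫ T.Φ.inverse.map (ι₀ Y n)
  let H₀ : (tot X).X₀ ⟶ (tot Y).X₁ :=
    Limits.Sigma.desc fun n => ((h (-n)).shiftZ n).h₀ ≫ ι₁ Y n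
  have e₁ : ∀ n, ι₁ X n ≫ H₁ = ((h (-n)).shiftZ n).h₁ ≫ T.Φ.inverse.map (ι₀ Y n) := by
    intro n; simp [H₁]
  have e₀ : ∀ n, ι₀ X n ≫ H₀ = ((h (-n)).shiftZ n).h₀ ≫ ι₁ Y n := by
    intro n; simp [H₀]
  refine ⟨⟨H₁, H₀⟩, ?_, ?_⟩
  · ext n
    refine (ι₁_totMap _ n).trans ?_
    have e₂ : T.Φ.inverse.map (ι₀ Y n) ≫ phi (tot Y) =
        T.Φ.inverse.map (ι₀ Y n ≫ totd₀ Y) ≫ T.Φ.unitInv.app _ := by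
      simp only [phi, Functor.map_comp, Category.assoc]
    rw [Preadditive.comp_add, ι₁_totd₁_assoc, (hn n).eq₁, reassoc_of% (e₁ n), Preadditive.add_comp,
      Preadditive.add_comp, Category.assoc, Category.assoc, Category.assoc, Category.assoc]
    dsimp only
    rw [e₀, e₀, reassoc_of% (k₁ n), e₂, ι₀_totd₀]
    simp [phi]
    abel
  · ext n
    refine (ι₀_totMap _ n).trans ?_
    have e₂ : ∀ m, T.Φ.functor.map (ι₁ X m) ≫ T.Φ.functor.map H₁ ≫ T.Φ.counit.app (tot Y).X₀ =
        (T.Φ.functor.map ((h (-m)).shiftZ m).h₁ ≫ T.Φ.counit.app _) ≫ ι₀ Y m := by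
      intro m
      rw [← Functor.map_comp_assoc, e₁]
      simp
    rw [Preadditive.comp_add, ι₀_totd₀_assoc, (hn n).eq₀, reassoc_of% (e₀ n), Preadditive.add_comp,
      Preadditive.add_comp, Category.assoc, Category.assoc, Category.assoc, Category.assoc,
      Category.assoc]
    dsimp only
    rw [e₂, e₂, Category.assoc, Category.assoc, reassoc_of% (k₀ n), ι₁_totd₁]
    simp
    try abel

/-- Homotopy of morphisms of factorizations. -/
def Homotopic (T : FactTriple A) : HomRel (Factorization T) :=
  fun E F f g => ∃ h : HData E F, h.IsNull (f - g)

/-- The cone of a morphism of factorizations. -/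
def cone {E F : Factorization T} (g : E ⟶ F) : Factorization T where
  X₁ := E.X₀ ⊞ F.X₁
  X₀ := T.Φ.functor.obj E.X₁ ⊞ F.X₀
  d₁ := biprod.desc (-E.d₀ ≫ biprod.inl + g.f₀ ≫ biprod.inr) (F.d₁ ≫ biprod.inr)
  d₀ := biprod.desc
    (T.Φ.functor.map (-E.d₁ ≫ biprod.inl + g.f₁ ≫ biprod.inr))
    (F.d₀ ≫ T.Φ.functor.map biprod.inr)
  d₁_d₀ := by
    ext
    · have h := T.w_nat (biprod.inl : E.X₀ ⟶ E.X₀ ⊞ F.X₁)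
      simp [h, g.comm₀_assoc]
    · have h := T.w_nat (biprod.inr : F.X₁ ⟶ E.X₀ ⊞ F.X₁)
      simp [h]
  d₀_d₁ := by
    apply biprod.hom_ext'
    · have h := T.w_nat (biprod.inl : T.Φ.functor.obj E.X₁ ⟶ T.Φ.functor.obj E.X₁ ⊞ F.X₀)
      rw [h]
      simp only [biprod.inl_desc_assoc, ← Functor.map_comp]
      simp [T.w_map, g.comm₁_assoc, ← Functor.map_comp]
    · have h := T.w_nat (biprod.inr : F.X₀ ⟶ T.Φ.functor.obj E.X₁ ⊞ F.X₀)
      rw [h]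
      simp only [biprod.inr_desc_assoc, Category.assoc, ← Functor.map_comp, biprod.inr_desc]
      simp
end Factorization

open Factorization

section
variable {A : Type u₁} [Category.{v₁} A] [Abelian A] (T : FactTriple A)

/-- The homotopy category of factorizations. -/
abbrev K := CategoryTheory.Quotient (Homotopic T)

/-- The functor from factorizations to the homotopy category. -/
abbrev K.of : Factorization T ⥤ K T := CategoryTheory.Quotient.functor (Homotopic T)

variable {T}

/-- `N` is a thick triangulated subcategory of the homotopy category: it is closed under shifts in
both directions, cones, and retracts (hence isomorphisms). -/
structure IsThick (N : ObjectProperty (K T)) : Prop where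
  shift_iff (E : Factorization T) : N ((K.of T).obj ((shift T).obj E)) ↔ N ((K.of T).obj E)
  cone {E F : Factorization T} (f : E ⟶ F) (hE : N ((K.of T).obj E)) (hF : N ((K.of T).obj F)) :
    N ((K.of T).obj (cone f))
  retract : N.IsStableUnderRetracts

/-- An exact complex of factorizations (exactness is componentwise). -/
structure IsExact (X : CochainComplex (Factorization T) ℤ) : Prop where
  acyclic₁ : (((ev₁ T).mapHomologicalComplex (.up ℤ)).obj X).Acyclic
  acyclic₀ : (((ev₀ T).mapHomologicalComplex (.up ℤ)).obj X).Acyclic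

/-- `N` contains the totalizations of bounded exact complexes of factorizations. -/
def ContainsExactTotalizations (N : ObjectProperty (K T)) : Prop :=
  ∀ (X : CochainComplex (Factorization T) ℤ) [IsBdd X], IsExact X → N ((K.of T).obj (tot X))

variable (T) in
/-- The absolutely acyclic factorizations: the smallest thick subcategory which contains the
totalizations of bounded exact complexes. -/
def absAcyclic : ObjectProperty (K T) := fun E =>
  ∀ N : ObjectProperty (K T), IsThick N → ContainsExactTotalizations N → N E

variable (T) in
/-- The co-acyclic factorizations: the smallest thick subcategory which contains the totalizations
of bounded exact complexes and is closed under small coproducts. -/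
def coAcyclic : ObjectProperty (K T) := fun E =>
  ∀ N : ObjectProperty (K T), IsThick N → ContainsExactTotalizations N →
    (∀ J : Type w, N.IsClosedUnderColimitsOfShape (Discrete J)) → N E

variable (T) in
/-- The contra-acyclic factorizations: the smallest thick subcategory which contains the
totalizations of bounded exact complexes and is closed under small products. -/
def ctrAcyclic : ObjectProperty (K T) := fun E =>
  ∀ N : ObjectProperty (K T), IsThick N → ContainsExactTotalizations N →
    (∀ J : Type w, N.IsClosedUnderLimitsOfShape (Discrete J)) → N E

/-- The morphisms of the homotopy category with cone in `N`. -/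
def quasiIso (N : ObjectProperty (K T)) : MorphismProperty (K T) := fun X Y f =>
  ∃ g : X.as ⟶ Y.as, (K.of T).map g = f ∧ N ((K.of T).obj (cone g))

/-- The Verdier quotient of the homotopy category by `N`. For `N` the absolutely acyclic, co-acyclic
or contra-acyclic factorizations this is the absolute derived, co-derived or contra-derived category
of factorizations. -/
abbrev VerdierQuotient (N : ObjectProperty (K T)) := (quasiIso N).Localization

/-- The quotient functor. -/
abbrev toVerdier (N : ObjectProperty (K T)) : K T ⥤ VerdierQuotient N := (quasiIso N).Q

variable (T) in
/-- Factorizations with injective components. -/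
def injectiveComponents : ObjectProperty (K T) := fun E => Injective E.as.X₁ ∧ Injective E.as.X₀

variable (T) in
/-- Factorizations with projective components. -/
def projectiveComponents : ObjectProperty (K T) :=
  fun E => Projective E.as.X₁ ∧ Projective E.as.X₀

/-- The functor from the homotopy category of factorizations with injective components to the
Verdier quotient by `N`. -/
abbrev injectivesToVerdier (N : ObjectProperty (K T)) :
    (injectiveComponents T).FullSubcategory ⥤ VerdierQuotient N :=
  (injectiveComponents T).ι ⋙ toVerdier N

/-- The functor from the homotopy category of factorizations with projective components to the
Verdier quotient by `N`. -/
abbrev projectivesToVerdier (N : ObjectProperty (K T)) :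
    (projectiveComponents T).FullSubcategory ⥤ VerdierQuotient N :=
  (projectiveComponents T).ι ⋙ toVerdier N

end

section Factored

variable {A : Type u₁} [Category.{v₁} A] [Abelian A] {B : Type u₂} [Category.{v₂} B] [Abelian B]

/-- A factored functor from `(A, Φ, w)` to `(B, Ψ, v)`: an additive functor `F` from `A` to bounded
complexes in `B` with an isomorphism `ε : F ∘ Φ ≅ Ψ ∘ F` under which `F (w_X)` becomes `v_{F X}`. -/
structure FactoredFunctor (T : FactTriple A) (U : FactTriple B) where
  F : A ⥤ CochainComplex B ℤ
  additive : F.Additive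
  bounded : ∀ X : A, ∃ a b : ℤ, ∀ i, (i < a ∨ b < i) → IsZero ((F.obj X).X i)
  ε : T.Φ.functor ⋙ F ≅ F ⋙ U.Φ.functor.mapHomologicalComplex (.up ℤ)
  map_w : ∀ (X : A) (i : ℤ),
    (F.map (T.w.app X)).f i ≫ (ε.hom.app X).f i = U.w.app ((F.obj X).X i)

namespace FactoredFunctor

variable {T : FactTriple A} {U : FactTriple B} (θ : FactoredFunctor T U)

instance : θ.F.Additive := θ.additive

/-- The components of `ε`. -/
def e (X : A) (i : ℤ) : (θ.F.obj (T.Φ.functor.obj X)).X i ≅ U.Φ.functor.obj ((θ.F.obj X).X i) :=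
  HomologicalComplex.Hom.isoApp (θ.ε.app X) i

theorem e_nat {X Y : A} (f : X ⟶ Y) (i : ℤ) :
    (θ.F.map (T.Φ.functor.map f)).f i ≫ (θ.e Y i).hom =
      (θ.e X i).hom ≫ U.Φ.functor.map ((θ.F.map f).f i) :=
  congrArg (fun g => HomologicalComplex.Hom.f g i) (θ.ε.hom.naturality f)

theorem e_d (X : A) (i j : ℤ) :
    (θ.F.obj (T.Φ.functor.obj X)).d i j ≫ (θ.e X j).hom =
      (θ.e X i).hom ≫ U.Φ.functor.map ((θ.F.obj X).d i j) :=
  ((θ.ε.hom.app X).comm i j).symm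

theorem map_w' (X : A) (i : ℤ) :
    (θ.F.map (T.w.app X)).f i ≫ (θ.e X i).hom = U.w.app ((θ.F.obj X).X i) := θ.map_w X i

/-- The factorization `θ(E)^i` obtained from `E` by applying the degree `i` part of `θ`. -/
abbrev degree (E : Factorization T) (i : ℤ) : Factorization U where
  X₁ := (θ.F.obj E.X₁).X i
  X₀ := (θ.F.obj E.X₀).X i
  d₁ := (θ.F.map E.d₁).f i
  d₀ := (θ.F.map E.d₀).f i ≫ (θ.e E.X₁ i).hom
  d₁_d₀ := by
    rw [← θ.map_w', ← E.d₁_d₀, Functor.map_comp, HomologicalComplex.comp_f, Category.assoc]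
  d₀_d₁ := by
    rw [← θ.map_w', ← E.d₀_d₁, Category.assoc, ← e_nat, Functor.map_comp,
      HomologicalComplex.comp_f, Category.assoc]

/-- The bounded complex of factorizations `θ(E)`. -/
abbrev complex (E : Factorization T) : CochainComplex (Factorization U) ℤ where
  X i := θ.degree E i
  d i j :=
    { f₁ := (θ.F.obj E.X₁).d i j
      f₀ := (θ.F.obj E.X₀).d i j
      comm₁ := ((θ.F.map E.d₁).comm i j).symm
      comm₀ := by
        dsimp only
        rw [Category.assoc, ← e_d, HomologicalComplex.Hom.comm_assoc] }
  shape i j hij := by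
    apply Factorization.hom_ext
    · exact (θ.F.obj E.X₁).shape i j hij
    · exact (θ.F.obj E.X₀).shape i j hij
  d_comp_d' i j k _ _ := by
    apply Factorization.hom_ext
    · exact (θ.F.obj E.X₁).d_comp_d i j k
    · exact (θ.F.obj E.X₀).d_comp_d i j k

instance (E : Factorization T) : IsBdd (θ.complex E) where
  bounded := by
    obtain ⟨a, b, h⟩ := θ.bounded E.X₁
    obtain ⟨a', b', h'⟩ := θ.bounded E.X₀
    refine ⟨min a a', max b b', fun i hi => Factorization.isZero (h i ?_) (h' i ?_)⟩
    · rcases hi with hi | hi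
      · exact Or.inl (lt_of_lt_of_le hi (min_le_left _ _))
      · exact Or.inr (lt_of_le_of_lt (le_max_left _ _) hi)
    · rcases hi with hi | hi
      · exact Or.inl (lt_of_lt_of_le hi (min_le_right _ _))
      · exact Or.inr (lt_of_le_of_lt (le_max_right _ _) hi)

/-- Functoriality of `θ(E)` in `E`. -/
abbrev complexMap {E E' : Factorization T} (f : E ⟶ E') : θ.complex E ⟶ θ.complex E' where
  f i :=
    { f₁ := (θ.F.map f.f₁).f i
      f₀ := (θ.F.map f.f₀).f i
      comm₁ := by
        dsimp
        rw [← HomologicalComplex.comp_f, ← HomologicalComplex.comp_f, ← Functor.map_comp,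
          ← Functor.map_comp, f.comm₁]
      comm₀ := by
        dsimp
        rw [Category.assoc, ← e_nat, ← HomologicalComplex.comp_f_assoc,
          ← HomologicalComplex.comp_f_assoc, ← Functor.map_comp,
          ← Functor.map_comp, f.comm₀] }
  comm' i j _ := by
    apply Factorization.hom_ext
    · exact (θ.F.map f.f₁).comm i j
    · exact (θ.F.map f.f₀).comm i j

/-- The functor `θ^f` on factorizations: the totalization of `θ(E)`. -/
abbrev onFact : Factorization T ⥤ Factorization U where
  obj E := tot (θ.complex E)
  map f := totMap (θ.complexMap f)
  map_id E := by
    rw [← totMap_id]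
    congr 1
    ext i
    · exact congrArg (fun g => HomologicalComplex.Hom.f g i) (θ.F.map_id E.X₁)
    · exact congrArg (fun g => HomologicalComplex.Hom.f g i) (θ.F.map_id E.X₀)
  map_comp f g := by
    rw [← totMap_comp]
    congr 1
    ext i
    · exact congrArg (fun g => HomologicalComplex.Hom.f g i) (θ.F.map_comp f.f₁ g.f₁)
    · exact congrArg (fun g => HomologicalComplex.Hom.f g i) (θ.F.map_comp f.f₀ g.f₀)

/-- The image of a homotopy. -/
def hData {E E' : Factorization T} (h : HData E E') (i : ℤ) :
    HData (θ.degree E i) (θ.degree E' i) where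
  h₁ := (θ.F.map h.h₁).f i ≫ U.Φ.unit.app ((θ.F.obj (T.Φ.inverse.obj E'.X₀)).X i) ≫
    U.Φ.inverse.map ((θ.e _ i).inv ≫ (θ.F.map (T.Φ.counit.app E'.X₀)).f i)
  h₀ := (θ.F.map h.h₀).f i

theorem e_phi (E : Factorization T) (i : ℤ) :
    (θ.e _ i).inv ≫ (θ.F.map (T.Φ.counit.app E.X₀)).f i ≫ (θ.F.map E.d₀).f i ≫ (θ.e E.X₁ i).hom =
      U.Φ.functor.map ((θ.F.map E.phi).f i) := by
  rw [Iso.inv_comp_eq, ← e_nat, ← HomologicalComplex.comp_f_assoc, ← Functor.map_comp]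
  congr 3
  simp [phi]

theorem hData_h₁_phi {E E' : Factorization T} (h : HData E E') (i : ℤ) :
    (θ.hData h i).h₁ ≫ (θ.degree E' i).phi = (θ.F.map (h.h₁ ≫ E'.phi)).f i := by
  have h1 := U.Φ.unit.naturality ((θ.F.map E'.phi).f i)
  dsimp only [Functor.id_map, Functor.comp_map] at h1
  have h2 : (θ.degree E' i).phi = U.Φ.inverse.map
    ((θ.F.map E'.d₀).f i ≫ (θ.e E'.X₁ i).hom) ≫ U.Φ.unitInv.app _ := rfl
  simp only [hData, h2, Category.assoc]
  rw [← Functor.map_comp_assoc, Category.assoc, e_phi, ← reassoc_of% h1,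
    Functor.map_comp θ.F, HomologicalComplex.comp_f]
  simp

theorem hData_h₁_counit {E E' : Factorization T} (h : HData E E') (i : ℤ) :
    U.Φ.functor.map (θ.hData h i).h₁ ≫ U.Φ.counit.app _ =
      (θ.e _ i).inv ≫ (θ.F.map (T.Φ.functor.map h.h₁ ≫ T.Φ.counit.app E'.X₀)).f i := by
  rw [Iso.eq_inv_comp, Functor.map_comp, HomologicalComplex.comp_f]
  have := θ.e_nat h.h₁ i
  rw [reassoc_of% ((Iso.eq_comp_inv _).2 this)]
  simp [hData]

theorem hData_isNull {E E' : Factorization T} {h : HData E E'} {f : E ⟶ E'} (hh : h.IsNull f)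
    (i : ℤ) : (θ.hData h i).IsNull ((θ.complexMap f).f i) := by
  refine ⟨?_, ?_⟩
  · change (θ.F.map f.f₁).f i = _
    rw [hh.eq₁, hData_h₁_phi, Functor.map_add, HomologicalComplex.add_f_apply, Functor.map_comp,
      HomologicalComplex.comp_f]
    rfl
  · change (θ.F.map f.f₀).f i = _
    rw [hh.eq₀, Functor.map_add, HomologicalComplex.add_f_apply, Functor.map_comp,
      HomologicalComplex.comp_f, Functor.map_comp, HomologicalComplex.comp_f]
    congr 1
    rw [hData_h₁_counit]
    simp

theorem hData_comm {E E' : Factorization T} (h : HData E E') (i j : ℤ) :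
    (θ.hData h i).Comm (θ.hData h j) ((θ.complex E).d i j) ((θ.complex E').d i j) := by
  refine ⟨?_, ?_⟩
  · change (θ.F.obj E.X₁).d i j ≫ (θ.hData h j).h₁ = (θ.hData h i).h₁ ≫ U.Φ.inverse.map ((θ.F.obj E'.X₀).d i j)
    have h1 := U.Φ.unit.naturality ((θ.F.obj (T.Φ.inverse.obj E'.X₀)).d i j)
    dsimp only [Functor.id_map, Functor.comp_map] at h1
    have h2 : U.Φ.functor.map ((θ.F.obj (T.Φ.inverse.obj E'.X₀)).d i j) ≫ (θ.e _ j).inv =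
        (θ.e _ i).inv ≫ (θ.F.obj (T.Φ.functor.obj (T.Φ.inverse.obj E'.X₀))).d i j := by
      rw [Iso.comp_inv_eq, Category.assoc, e_d, Iso.inv_hom_id_assoc]
    simp only [hData, Category.assoc]
    rw [← HomologicalComplex.Hom.comm_assoc, reassoc_of% h1, ← Functor.map_comp,
      reassoc_of% h2, ← Functor.map_comp, Category.assoc,
      ← HomologicalComplex.Hom.comm]
    rfl
  · exact ((θ.F.map h.h₀).comm i j).symm

theorem onFact_homotopic {E E' : Factorization T} (f g : E ⟶ E') (hfg : Homotopic T f g) :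
    Homotopic U (θ.onFact.map f) (θ.onFact.map g) := by
  obtain ⟨h, hh⟩ := hfg
  have : θ.onFact.map f - θ.onFact.map g = totMap (θ.complexMap (f - g)) := by
    change totMap _ - totMap _ = _
    rw [← totMap_sub]
    congr 1
    ext i
    · exact congrArg (fun g => HomologicalComplex.Hom.f g i) (θ.F.map_sub (f := f.f₁) (g := g.f₁)).symm
    · exact congrArg (fun g => HomologicalComplex.Hom.f g i) (θ.F.map_sub (f := f.f₀) (g := g.f₀)).symm
  dsimp only [Homotopic]
  rw [this]
  exact totMap_null _ (θ.hData h) (θ.hData_isNull hh) (θ.hData_comm h)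

/-- The functor `θ^f` on homotopy categories. -/
def onK : K T ⥤ K U :=
  CategoryTheory.Quotient.lift _ (θ.onFact ⋙ K.of U) (fun _ _ f g h =>
    CategoryTheory.Quotient.sound _ (θ.onFact_homotopic f g h))

/-- The functor `θ^f` with values in a Verdier quotient of the target. -/
abbrev toD (N : ObjectProperty (K U)) : K T ⥤ VerdierQuotient N := θ.onK ⋙ toVerdier N

end FactoredFunctor

/-- A factored natural transformation `η : θ ⟶ γ`: a natural transformation of functors to
bounded complexes with `η_{Φ X} = Ψ (η_X)` modulo the identifications `θ ∘ Φ ≅ Ψ ∘ θ` and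
`γ ∘ Φ ≅ Ψ ∘ γ`. -/
structure FactoredNatTrans {T : FactTriple A} {U : FactTriple B} (θ γ : FactoredFunctor T U) where
  app : θ.F ⟶ γ.F
  map_shift : ∀ X : A, app.app (T.Φ.functor.obj X) ≫ γ.ε.hom.app X =
    θ.ε.hom.app X ≫ (U.Φ.functor.mapHomologicalComplex (.up ℤ)).map (app.app X)

namespace FactoredNatTrans

variable {T : FactTriple A} {U : FactTriple B} {θ γ : FactoredFunctor T U}
  (η : FactoredNatTrans θ γ)

theorem app_e (X : A) (i : ℤ) :
    (η.app.app (T.Φ.functor.obj X)).f i ≫ (γ.e X i).hom =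
      (θ.e X i).hom ≫ U.Φ.functor.map ((η.app.app X).f i) :=
  congrArg (fun g => HomologicalComplex.Hom.f g i) (η.map_shift X)

theorem app_nat {X Y : A} (f : X ⟶ Y) (i : ℤ) :
    (θ.F.map f).f i ≫ (η.app.app Y).f i = (η.app.app X).f i ≫ (γ.F.map f).f i :=
  congrArg (fun g => HomologicalComplex.Hom.f g i) (η.app.naturality f)

/-- The morphism of complexes of factorizations `θ(E) ⟶ γ(E)` given by `η`. -/
abbrev complexMap (E : Factorization T) : θ.complex E ⟶ γ.complex E where
  f i :=
    { f₁ := (η.app.app E.X₁).f i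
      f₀ := (η.app.app E.X₀).f i
      comm₁ := (η.app_nat E.d₁ i).symm
      comm₀ := by
        dsimp only
        rw [Category.assoc, ← η.app_e, ← reassoc_of% (η.app_nat E.d₀ i)] }
  comm' i j _ := by
    apply Factorization.hom_ext
    · exact (η.app.app E.X₁).comm i j
    · exact (η.app.app E.X₀).comm i j

/-- The natural transformation `η^f : θ^f ⟶ γ^f`. -/
def onFact : θ.onFact ⟶ γ.onFact where
  app E := totMap (η.complexMap E)
  naturality E E' f := by
    change totMap _ ≫ totMap _ = totMap _ ≫ totMap _
    rw [← totMap_comp, ← totMap_comp]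
    congr 1
    ext i
    · exact η.app_nat f.f₁ i
    · exact η.app_nat f.f₀ i

/-- `η^f` on homotopy categories. -/
def onK : θ.onK ⟶ γ.onK :=
  CategoryTheory.Quotient.natTransLift (Homotopic T)
    (Functor.whiskerRight η.onFact (K.of U) : θ.onFact ⋙ K.of U ⟶ γ.onFact ⋙ K.of U)

/-- `η^f` with values in a Verdier quotient of the target. -/
abbrev toD (N : ObjectProperty (K U)) : θ.toD N ⟶ γ.toD N :=
  Functor.whiskerRight η.onK (toVerdier N)

/-- For a complex `X` in `A`, the functor `θ` to complexes gives a bicomplex `θ(X)`, and `η` gives a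
morphism of bicomplexes `θ(X) ⟶ γ(X)`. -/
abbrev bicomplexMap (X : CochainComplex A ℤ) :
    (θ.F.mapHomologicalComplex (.up ℤ)).obj X ⟶ (γ.F.mapHomologicalComplex (.up ℤ)).obj X :=
  (NatTrans.mapHomologicalComplex η.app (.up ℤ)).app X

/-- `η` induces a quasi-isomorphism from the total complex of `θ(X)` to that of `γ(X)`
(and these total complexes make sense). -/
def IsTotalQuasiIso (X : CochainComplex A ℤ) : Prop :=
  ∃ (_ : HomologicalComplex₂.HasTotal
      ((θ.F.mapHomologicalComplex (.up ℤ)).obj X) (.up ℤ))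
    (_ : HomologicalComplex₂.HasTotal
      ((γ.F.mapHomologicalComplex (.up ℤ)).obj X) (.up ℤ)),
    QuasiIso (HomologicalComplex₂.total.map (η.bicomplexMap X) (.up ℤ))

/-- `η` induces an isomorphism `Rθ ≅ Rγ` of ordinary right derived functors: as `Rη` at an object `X`
is represented by the map of total complexes `θ(I) ⟶ γ(I)`, for an injective resolution `I` of `X`,
this says that the latter is a quasi-isomorphism. -/
def InducesOrdinaryRightIso : Prop :=
  ∀ (X : A) (I : InjectiveResolution X), η.IsTotalQuasiIso I.cochainComplex

/-- `η` induces an isomorphism `Rθ ≅ Rγ` on objects which have a finite injective resolution. -/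
def InducesOrdinaryRightIsoFinite : Prop :=
  ∀ (X : A) (I : InjectiveResolution X), (∃ n : ℕ, ∀ m, n < m → IsZero (I.cocomplex.X m)) →
    η.IsTotalQuasiIso I.cochainComplex

/-- `η` induces an isomorphism `Lθ ≅ Lγ` of ordinary left derived functors; as
`InducesOrdinaryRightIso`, with projective resolutions. -/
def InducesOrdinaryLeftIso : Prop :=
  ∀ (X : A) (P : ProjectiveResolution X), η.IsTotalQuasiIso P.cochainComplex

/-- `η` induces an isomorphism `Lθ ≅ Lγ` on objects which have a finite projective resolution. -/
def InducesOrdinaryLeftIsoFinite : Prop :=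
  ∀ (X : A) (P : ProjectiveResolution X), (∃ n : ℕ, ∀ m, n < m → IsZero (P.complex.X m)) →
    η.IsTotalQuasiIso P.cochainComplex

end FactoredNatTrans

/-! ### Derived factored functors -/

/-- A right derived functor (with respect to the Verdier quotients by `N` and `N'`) of the factored
functor `θ`: a functor `R` between the Verdier quotients with a natural transformation
`θ^f ⟶ R` which is universal, i.e. a left Kan extension along the localization functor. -/
structure RightDerived {T : FactTriple A} {U : FactTriple B} (θ : FactoredFunctor T U)
    (N : ObjectProperty (K T)) (N' : ObjectProperty (K U)) where
  functor : VerdierQuotient N ⥤ VerdierQuotient N'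
  unit : θ.toD N' ⟶ toVerdier N ⋙ functor
  isDerived : functor.IsRightDerivedFunctor unit (quasiIso N)

/-- `R` is computed by factorizations with injective components: `θ^f(J) ≅ R(J)` through the
canonical map, for each factorization `J` with injective components. -/
def RightDerived.ComputedByInjectives {T : FactTriple A} {U : FactTriple B}
    {θ : FactoredFunctor T U} {N : ObjectProperty (K T)} {N' : ObjectProperty (K U)}
    (R : RightDerived θ N N') : Prop :=
  ∀ J : K T, injectiveComponents T J → IsIso (R.unit.app J)

/-- The natural transformation `Rη^f : Rθ^f ⟶ Rγ^f` induced by `η`: the unique one which is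
compatible with `η^f : θ^f ⟶ γ^f`. -/
def RightDerived.map {T : FactTriple A} {U : FactTriple B} {θ γ : FactoredFunctor T U}
    (η : FactoredNatTrans θ γ) {N : ObjectProperty (K T)} {N' : ObjectProperty (K U)}
    (R : RightDerived θ N N') (S : RightDerived γ N N') : R.functor ⟶ S.functor :=
  have := R.isDerived
  Functor.rightDerivedNatTrans R.functor S.functor R.unit S.unit (quasiIso N) (η.toD N')

/-- A left derived functor (with respect to the Verdier quotients by `N` and `N'`) of the factored
functor `θ`: a functor `L` between the Verdier quotients with a natural transformation
`L ⟶ θ^f` which is universal, i.e. a right Kan extension along the localization functor. -/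
structure LeftDerived {T : FactTriple A} {U : FactTriple B} (θ : FactoredFunctor T U)
    (N : ObjectProperty (K T)) (N' : ObjectProperty (K U)) where
  functor : VerdierQuotient N ⥤ VerdierQuotient N'
  counit : toVerdier N ⋙ functor ⟶ θ.toD N'
  isDerived : functor.IsLeftDerivedFunctor counit (quasiIso N)

/-- `L` is computed by factorizations with projective components: `L(P) ≅ θ^f(P)` through the
canonical map, for each factorization `P` with projective components. -/
def LeftDerived.ComputedByProjectives {T : FactTriple A} {U : FactTriple B}
    {θ : FactoredFunctor T U} {N : ObjectProperty (K T)} {N' : ObjectProperty (K U)}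
    (L : LeftDerived θ N N') : Prop :=
  ∀ P : K T, projectiveComponents T P → IsIso (L.counit.app P)

/-- The natural transformation `Lη^f : Lθ^f ⟶ Lγ^f` induced by `η`: the unique one which is
compatible with `η^f : θ^f ⟶ γ^f`. -/
def LeftDerived.map {T : FactTriple A} {U : FactTriple B} {θ γ : FactoredFunctor T U}
    (η : FactoredNatTrans θ γ) {N : ObjectProperty (K T)} {N' : ObjectProperty (K U)}
    (R : LeftDerived θ N N') (S : LeftDerived γ N N') : R.functor ⟶ S.functor :=
  have := S.isDerived
  Functor.leftDerivedNatTrans R.functor S.functor R.counit S.counit (quasiIso N) (η.toD N')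

/-- `Rη^f : Rθ^f ⟶ Rγ^f` is a natural isomorphism. This includes that the derived functors exist
and that they are what they should be: the factorizations with injective components are equivalent
to the Verdier quotient by `N`, right derived functors of `θ` and `γ` exist, they are given by `θ^f`
and `γ^f` on the factorizations with injective components, and for any choice of them the
transformation `Rη^f` is invertible. -/
def InducesRightIso {T : FactTriple A} {U : FactTriple B} {θ γ : FactoredFunctor T U}
    (η : FactoredNatTrans θ γ) (N : ObjectProperty (K T)) (N' : ObjectProperty (K U)) : Prop :=
  (injectivesToVerdier N).IsEquivalence ∧
  Nonempty (RightDerived θ N N') ∧ Nonempty (RightDerived γ N N') ∧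
  ∀ (R : RightDerived θ N N') (S : RightDerived γ N N'),
    R.ComputedByInjectives ∧ S.ComputedByInjectives ∧ IsIso (RightDerived.map η R S)

/-- `Lη^f : Lθ^f ⟶ Lγ^f` is a natural isomorphism; dual to `InducesRightIso`. -/
def InducesLeftIso {T : FactTriple A} {U : FactTriple B} {θ γ : FactoredFunctor T U}
    (η : FactoredNatTrans θ γ) (N : ObjectProperty (K T)) (N' : ObjectProperty (K U)) : Prop :=
  (projectivesToVerdier N).IsEquivalence ∧
  Nonempty (LeftDerived θ N N') ∧ Nonempty (LeftDerived γ N N') ∧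
  ∀ (R : LeftDerived θ N N') (S : LeftDerived γ N N'),
    R.ComputedByProjectives ∧ S.ComputedByProjectives ∧ IsIso (LeftDerived.map η R S)

end Factored

end FactorizationCategory

end

open FactorizationCategory

/-! The right-derived and left-derived cases are dual; the injective version is described.
Everything rests on one computation: on a factorization `J` with injective components, `η^f` is
already invertible in the derived category of the target, and such factorizations compute the
derived functors.

For the computation: an injective object is its own injective resolution, so the hypothesis on
ordinary derived functors says that `η` is a quasi-isomorphism of complexes at each component of `J`
(`quasiIso_app_of_injective`). Thus `θ(J) ⟶ γ(J)` is a componentwise quasi-isomorphism of bounded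
complexes of factorizations, its mapping cone is exact, and the totalization of the mapping cone is
the cone of the totalized map (`totConeIso`). Hence the cone of `η^f` at `J` is acyclic
(`IsThick.cone_totMap`, `isIso_toD_app`).

That factorizations with injective components compute the derived functors needs two facts. First,
they are local: every morphism from an acyclic factorization to one of them is null-homotopic. The
factorizations with this property form a thick class closed under coproducts, and it contains the
totalizations of bounded exact complexes, where a null-homotopy is built one summand at a time by
extending maps into injectives (`null_of_tot`). Minimality of the acyclic class gives the rest
(`absAcyclic_le_leftOrthInjective`, `coAcyclic_le_leftOrthInjective`).

Second, every factorization `E` admits a morphism with acyclic cone to one with injective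
components. `E` embeds in some `I` with injective components; then `E ⟶ cone (I ⟶ I/E)[-1]` has
acyclic cone by `IsThick.cone_coneTo`. When injective dimensions are finite, `I/E` is replaced by a
resolution of it, by induction on the dimension. In general the step is iterated and the colimit of
the resulting sequence of monomorphisms is taken. Its transition maps factor through injectives, so
the colimit is a retract of a countable coproduct of injectives (`IsSeqColim.injective`); the cone
of the map from `E` to it is a sequential colimit of acyclic cones, acyclic by the telescope
sequence (`IsThick.of_isSeqColim`).

Formally, enough local objects make the quotient functor a left adjoint, and composing its right
adjoint with `θ^f` gives the derived functor. The transformation `Rη^f` is then tested on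
factorizations with injective components (`inducesRightIso_of_resolutions`). -/

noncomputable section

namespace FactorizationCategory

open Factorization

variable {A : Type u₁} [Category.{v₁} A] [Abelian A] {T : FactTriple A}

section

namespace Factorization

/-! ### Null-homotopic morphisms -/

/-- `f` is homotopic to zero. -/
def Null {E F : Factorization T} (f : E ⟶ F) : Prop := ∃ h : HData E F, h.IsNull f

/-- Homotopies to zero in terms of `s : Φ E₁ ⟶ F₀` instead of its mate `E₁ ⟶ Φ⁻¹ F₀`. -/
structure IsNullBy {E F : Factorization T} (f : E ⟶ F) (s : T.Φ.functor.obj E.X₁ ⟶ F.X₀)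
    (t : E.X₀ ⟶ F.X₁) : Prop where
  eq₁ : T.Φ.functor.map f.f₁ = T.Φ.functor.map E.d₁ ≫ T.Φ.functor.map t + s ≫ F.d₀
  eq₀ : f.f₀ = t ≫ F.d₁ + E.d₀ ≫ s

/-- Applying `Φ` trades `φ^{-1}` for `d₀`; after this the quasi-inverse enters a homotopy only
through the mate of its first component. -/
theorem map_comp_phi {E F : Factorization T} (h : E.X₁ ⟶ T.Φ.inverse.obj F.X₀) :
    T.Φ.functor.map (h ≫ F.phi) = (T.Φ.functor.map h ≫ T.Φ.counit.app F.X₀) ≫ F.d₀ := by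
  simp [phi]

theorem HData.IsNull.isNullBy {E F : Factorization T} {f : E ⟶ F} {h : HData E F}
    (H : h.IsNull f) : IsNullBy f (T.Φ.functor.map h.h₁ ≫ T.Φ.counit.app F.X₀) h.h₀ where
  eq₁ := by rw [H.eq₁, Functor.map_add, map_comp_phi, Functor.map_comp]
  eq₀ := H.eq₀

/-- The homotopy given by `s` and `t`. -/
def hDataOf {E F : Factorization T} (s : T.Φ.functor.obj E.X₁ ⟶ F.X₀) (t : E.X₀ ⟶ F.X₁) :
    HData E F where
  h₁ := T.Φ.unit.app E.X₁ ≫ T.Φ.inverse.map s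
  h₀ := t

theorem map_hDataOf_h₁ {E F : Factorization T} (s : T.Φ.functor.obj E.X₁ ⟶ F.X₀)
    (t : E.X₀ ⟶ F.X₁) :
    T.Φ.functor.map (hDataOf s t).h₁ ≫ T.Φ.counit.app F.X₀ = s := by
  simp [hDataOf]

theorem IsNullBy.isNull {E F : Factorization T} {f : E ⟶ F} {s : T.Φ.functor.obj E.X₁ ⟶ F.X₀}
    {t : E.X₀ ⟶ F.X₁} (H : IsNullBy f s t) : (hDataOf s t).IsNull f where
  eq₁ := by
    apply T.Φ.functor.map_injective
    rw [H.eq₁, Functor.map_add, map_comp_phi, map_hDataOf_h₁, Functor.map_comp]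
    rfl
  eq₀ := by
    rw [map_hDataOf_h₁]
    exact H.eq₀

/-- The mate correspondence is a bijection and `Φ` is faithful, so null-homotopies can be handled as
pairs `(s, t)` without the quasi-inverse. The homotopies constructed below take this form. -/
theorem null_iff {E F : Factorization T} (f : E ⟶ F) : Null f ↔ ∃ s t, IsNullBy f s t :=
  ⟨fun ⟨_, h⟩ => ⟨_, _, h.isNullBy⟩, fun ⟨_, _, h⟩ => ⟨_, h.isNull⟩⟩

theorem IsNullBy.null {E F : Factorization T} {f : E ⟶ F} {s : T.Φ.functor.obj E.X₁ ⟶ F.X₀}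
    {t : E.X₀ ⟶ F.X₁} (H : IsNullBy f s t) : Null f := (null_iff f).2 ⟨s, t, H⟩

theorem Null.exists_isNullBy {E F : Factorization T} {f : E ⟶ F} (H : Null f) :
    ∃ s t, IsNullBy f s t := (null_iff f).1 H

theorem null_zero (E F : Factorization T) : Null (0 : E ⟶ F) :=
  IsNullBy.null (s := 0) (t := 0) ⟨by simp, by simp⟩

theorem Null.add {E F : Factorization T} {f g : E ⟶ F} (hf : Null f) (hg : Null g) :
    Null (f + g) := by
  obtain ⟨s, t, h⟩ := hf.exists_isNullBy
  obtain ⟨s', t', h'⟩ := hg.exists_isNullBy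
  refine IsNullBy.null (s := s + s') (t := t + t') ⟨?_, ?_⟩
  · simp only [add_f₁, Functor.map_add, h.eq₁, h'.eq₁, Preadditive.comp_add, Preadditive.add_comp]
    abel
  · simp only [add_f₀, h.eq₀, h'.eq₀, Preadditive.comp_add, Preadditive.add_comp]
    abel

theorem Null.neg {E F : Factorization T} {f : E ⟶ F} (hf : Null f) : Null (-f) := by
  obtain ⟨s, t, h⟩ := hf.exists_isNullBy
  refine IsNullBy.null (s := -s) (t := -t) ⟨?_, ?_⟩
  · simp only [neg_f₁, Functor.map_neg, h.eq₁, Preadditive.comp_neg, Preadditive.neg_comp]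
    abel
  · simp only [neg_f₀, h.eq₀, Preadditive.comp_neg, Preadditive.neg_comp]
    abel

theorem Null.sub {E F : Factorization T} {f g : E ⟶ F} (hf : Null f) (hg : Null g) :
    Null (f - g) := by
  rw [sub_eq_add_neg]
  exact hf.add hg.neg

theorem Null.comp_right {E F G : Factorization T} {f : E ⟶ F} (hf : Null f) (g : F ⟶ G) :
    Null (f ≫ g) := by
  obtain ⟨s, t, h⟩ := hf.exists_isNullBy
  refine IsNullBy.null (s := s ≫ g.f₀) (t := t ≫ g.f₁) ⟨?_, ?_⟩
  · simp [h.eq₁, g.comm₀]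
  · simp [h.eq₀, g.comm₁]

theorem Null.comp_left {E F G : Factorization T} {g : F ⟶ G} (hg : Null g) (f : E ⟶ F) :
    Null (f ≫ g) := by
  obtain ⟨s, t, h⟩ := hg.exists_isNullBy
  refine IsNullBy.null (s := T.Φ.functor.map f.f₁ ≫ s) (t := f.f₀ ≫ t) ⟨?_, ?_⟩
  · have := congrArg T.Φ.functor.map f.comm₁
    simp only [Functor.map_comp] at this
    simp [h.eq₁, reassoc_of% this]
  · simp [h.eq₀, f.comm₀_assoc]

theorem homotopic_iff {E F : Factorization T} (f g : E ⟶ F) :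
    Homotopic T f g ↔ Null (f - g) := Iff.rfl

/-- Homotopy is itself a congruence, so equality in the quotient category is homotopy and not merely
the relation generated by it; `K.map_eq_iff` depends on this. -/
instance : Congruence (Homotopic T) where
  equivalence :=
    { refl f := by rw [homotopic_iff, sub_self]; exact null_zero _ _
      symm h := by rw [homotopic_iff] at h ⊢; simpa using h.neg
      trans h h' := by rw [homotopic_iff] at h h' ⊢; simpa using h.add h' }
  comp_left f _ _ h := by
    rw [homotopic_iff] at h ⊢
    rw [← Preadditive.comp_sub]
    exact h.comp_left f
  comp_right g h := by
    rw [homotopic_iff] at h ⊢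
    rw [← Preadditive.sub_comp]
    exact h.comp_right g

end Factorization

theorem K.map_eq_iff {E F : Factorization T} (f g : E ⟶ F) :
    (K.of T).map f = (K.of T).map g ↔ Null (f - g) :=
  CategoryTheory.Quotient.functor_map_eq_iff _ f g

theorem K.map_surjective {E F : Factorization T} (f : (K.of T).obj E ⟶ (K.of T).obj F) :
    ∃ g : E ⟶ F, (K.of T).map g = f := (K.of T).map_surjective f

namespace Factorization

/-! ### Shifts -/

/-- A homotopy for `f[1]` consists of maps `Φ E₀ ⟶ Φ F₁` and `Φ E₁ ⟶ F₀`. Fullness of `Φ` descends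
the first, and exchanging the two with a sign gives a homotopy for `f`. -/
theorem null_shift_iff {E F : Factorization T} (f : E ⟶ F) :
    Null ((shift T).map f) ↔ Null f := by
  refine ⟨fun h => ?_, fun ⟨h, H⟩ => ⟨_, H.shift⟩⟩
  obtain ⟨s, t, H⟩ := h.exists_isNullBy
  obtain ⟨s', rfl⟩ := T.Φ.functor.map_surjective s
  change E.X₀ ⟶ F.X₁ at s'
  change T.Φ.functor.obj E.X₁ ⟶ F.X₀ at t
  have h₁ : T.Φ.functor.map f.f₀ = T.Φ.functor.map (-E.d₀) ≫ T.Φ.functor.map t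
    + T.Φ.functor.map s' ≫ (-T.Φ.functor.map F.d₁) := H.eq₁
  have h₀ : T.Φ.functor.map f.f₁ = t ≫ (-F.d₀) + (-T.Φ.functor.map E.d₁) ≫ T.Φ.functor.map s' :=
    H.eq₀
  refine IsNullBy.null (s := -t) (t := -s') ⟨?_, T.Φ.functor.map_injective ?_⟩
  · rw [h₀]; simp; abel
  · rw [h₁]; simp; abel

/-- `E[-1][1] ≅ E`. -/
def shiftUnshift (E : Factorization T) : (shift T).obj ((unshift T).obj E) ≅ E where
  hom := { f₁ := 𝟙 _, f₀ := T.Φ.counit.app _, comm₁ := by simp, comm₀ := by simp }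
  inv := { f₁ := 𝟙 _, f₀ := T.Φ.counitInv.app _, comm₁ := by simp, comm₀ := by simp }

/-- `E[1][-1] ≅ E`. -/
def unshiftShift (E : Factorization T) : (unshift T).obj ((shift T).obj E) ≅ E where
  hom := { f₁ := T.Φ.unitInv.app _, f₀ := 𝟙 _, comm₁ := by simp, comm₀ := by simp }
  inv :=
    { f₁ := T.Φ.unit.app _
      f₀ := 𝟙 _
      comm₁ := by simp
      comm₀ := by simp [T.Φ.counitInv_app_functor] }

end Factorization

end

section

namespace Factorization

/-! ### Cones -/

/-- A morphism of factorizations with invertible components is invertible. -/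
@[simps]
def isoMk {E F : Factorization T} (f : E ⟶ F) (e₁ : E.X₁ ≅ F.X₁) (e₀ : E.X₀ ≅ F.X₀)
    (h₁ : e₁.hom = f.f₁) (h₀ : e₀.hom = f.f₀) : E ≅ F where
  hom := f
  inv :=
    { f₁ := e₁.inv
      f₀ := e₀.inv
      comm₁ := by rw [Iso.inv_comp_eq, h₁, f.comm₁_assoc, ← h₀]; simp
      comm₀ := by
        rw [Iso.inv_comp_eq, h₀, f.comm₀_assoc, ← h₁, ← Functor.map_comp]; simp }
  hom_inv_id := by ext <;> simp [← h₁, ← h₀]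
  inv_hom_id := by ext <;> simp [← h₁, ← h₀]

theorem Hom.map_comm₁ {E F : Factorization T} (f : E ⟶ F) :
    T.Φ.functor.map f.f₁ ≫ T.Φ.functor.map F.d₁ = T.Φ.functor.map E.d₁ ≫ T.Φ.functor.map f.f₀ := by
  rw [← Functor.map_comp, f.comm₁, Functor.map_comp]

theorem Hom.map_comm₁_assoc {E F : Factorization T} (f : E ⟶ F) {Z : A}
    (k : T.Φ.functor.obj F.X₀ ⟶ Z) :
    T.Φ.functor.map f.f₁ ≫ T.Φ.functor.map F.d₁ ≫ k =
      T.Φ.functor.map E.d₁ ≫ T.Φ.functor.map f.f₀ ≫ k := by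
  rw [← Category.assoc, f.map_comm₁, Category.assoc]

namespace cone

variable {E F : Factorization T} (g : E ⟶ F)

/-- The inclusion of `E[1]` in degree `-1`. -/
def inl₁ : E.X₀ ⟶ (cone g).X₁ := (biprod.inl : E.X₀ ⟶ E.X₀ ⊞ F.X₁)
/-- The inclusion of `F` in degree `-1`. -/
def inr₁ : F.X₁ ⟶ (cone g).X₁ := (biprod.inr : F.X₁ ⟶ E.X₀ ⊞ F.X₁)
/-- The projection to `E[1]` in degree `-1`. -/
def fst₁ : (cone g).X₁ ⟶ E.X₀ := (biprod.fst : E.X₀ ⊞ F.X₁ ⟶ E.X₀)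
/-- The projection to `F` in degree `-1`. -/
def snd₁ : (cone g).X₁ ⟶ F.X₁ := (biprod.snd : E.X₀ ⊞ F.X₁ ⟶ F.X₁)
/-- The inclusion of `E[1]` in degree `0`. -/
def inl₀ : T.Φ.functor.obj E.X₁ ⟶ (cone g).X₀ :=
  (biprod.inl : _ ⟶ T.Φ.functor.obj E.X₁ ⊞ F.X₀)
/-- The inclusion of `F` in degree `0`. -/
def inr₀ : F.X₀ ⟶ (cone g).X₀ := (biprod.inr : _ ⟶ T.Φ.functor.obj E.X₁ ⊞ F.X₀)
/-- The projection to `E[1]` in degree `0`. -/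
def fst₀ : (cone g).X₀ ⟶ T.Φ.functor.obj E.X₁ :=
  (biprod.fst : T.Φ.functor.obj E.X₁ ⊞ F.X₀ ⟶ _)
/-- The projection to `F` in degree `0`. -/
def snd₀ : (cone g).X₀ ⟶ F.X₀ := (biprod.snd : T.Φ.functor.obj E.X₁ ⊞ F.X₀ ⟶ _)

-- The biproduct identities for the components of `cone g` and their images under `Φ`, followed by
-- the structure maps in these terms. With them, identities of maps out of or into a cone are
-- checked on its two summands.
@[simp] theorem inl_fst₁ : inl₁ g ≫ fst₁ g = 𝟙 _ := biprod.inl_fst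
@[simp] theorem inl_fst₁_assoc {Z : A} (k : _ ⟶ Z) : inl₁ g ≫ fst₁ g ≫ k = k :=
  biprod.inl_fst_assoc _
@[simp] theorem inr_snd₁ : inr₁ g ≫ snd₁ g = 𝟙 _ := biprod.inr_snd
@[simp] theorem inr_snd₁_assoc {Z : A} (k : _ ⟶ Z) : inr₁ g ≫ snd₁ g ≫ k = k :=
  biprod.inr_snd_assoc _
@[simp] theorem inl_snd₁ : inl₁ g ≫ snd₁ g = 0 := biprod.inl_snd
@[simp] theorem inl_snd₁_assoc {Z : A} (k : _ ⟶ Z) : inl₁ g ≫ snd₁ g ≫ k = 0 := by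
  rw [← Category.assoc, inl_snd₁, zero_comp]
@[simp] theorem inr_fst₁ : inr₁ g ≫ fst₁ g = 0 := biprod.inr_fst
@[simp] theorem inr_fst₁_assoc {Z : A} (k : _ ⟶ Z) : inr₁ g ≫ fst₁ g ≫ k = 0 := by
  rw [← Category.assoc, inr_fst₁, zero_comp]
theorem total₁ : fst₁ g ≫ inl₁ g + snd₁ g ≫ inr₁ g = 𝟙 _ := biprod.total
theorem ext_from₁ {Z : A} {a b : (cone g).X₁ ⟶ Z} (hl : inl₁ g ≫ a = inl₁ g ≫ b)
    (hr : inr₁ g ≫ a = inr₁ g ≫ b) : a = b := biprod.hom_ext' _ _ hl hr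
@[simp] theorem inl_fst₀ : inl₀ g ≫ fst₀ g = 𝟙 _ := biprod.inl_fst
@[simp] theorem inl_fst₀_assoc {Z : A} (k : _ ⟶ Z) : inl₀ g ≫ fst₀ g ≫ k = k :=
  biprod.inl_fst_assoc _
@[simp] theorem inr_snd₀ : inr₀ g ≫ snd₀ g = 𝟙 _ := biprod.inr_snd
@[simp] theorem inr_snd₀_assoc {Z : A} (k : _ ⟶ Z) : inr₀ g ≫ snd₀ g ≫ k = k :=
  biprod.inr_snd_assoc _
@[simp] theorem inl_snd₀ : inl₀ g ≫ snd₀ g = 0 := biprod.inl_snd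
@[simp] theorem inl_snd₀_assoc {Z : A} (k : _ ⟶ Z) : inl₀ g ≫ snd₀ g ≫ k = 0 := by
  rw [← Category.assoc, inl_snd₀, zero_comp]
@[simp] theorem inr_fst₀ : inr₀ g ≫ fst₀ g = 0 := biprod.inr_fst
@[simp] theorem inr_fst₀_assoc {Z : A} (k : _ ⟶ Z) : inr₀ g ≫ fst₀ g ≫ k = 0 := by
  rw [← Category.assoc, inr_fst₀, zero_comp]
theorem total₀ : fst₀ g ≫ inl₀ g + snd₀ g ≫ inr₀ g = 𝟙 _ := biprod.total
theorem ext_from₀ {Z : A} {a b : (cone g).X₀ ⟶ Z} (hl : inl₀ g ≫ a = inl₀ g ≫ b)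
    (hr : inr₀ g ≫ a = inr₀ g ≫ b) : a = b := biprod.hom_ext' _ _ hl hr
theorem ext_to₀ {Z : A} {a b : Z ⟶ (cone g).X₀} (hl : a ≫ fst₀ g = b ≫ fst₀ g)
    (hr : a ≫ snd₀ g = b ≫ snd₀ g) : a = b := biprod.hom_ext _ _ hl hr
@[simp] theorem map_inl_fst₁ : T.Φ.functor.map (inl₁ g) ≫ T.Φ.functor.map (fst₁ g) = 𝟙 _ := by
  rw [← Functor.map_comp, inl_fst₁, CategoryTheory.Functor.map_id]
@[simp] theorem map_inl_fst₁_assoc {Z : A} (k : _ ⟶ Z) :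
    T.Φ.functor.map (inl₁ g) ≫ T.Φ.functor.map (fst₁ g) ≫ k = k := by
  rw [← Category.assoc, map_inl_fst₁, Category.id_comp]
@[simp] theorem map_inr_snd₁ : T.Φ.functor.map (inr₁ g) ≫ T.Φ.functor.map (snd₁ g) = 𝟙 _ := by
  rw [← Functor.map_comp, inr_snd₁, CategoryTheory.Functor.map_id]
@[simp] theorem map_inr_snd₁_assoc {Z : A} (k : _ ⟶ Z) :
    T.Φ.functor.map (inr₁ g) ≫ T.Φ.functor.map (snd₁ g) ≫ k = k := by
  rw [← Category.assoc, map_inr_snd₁, Category.id_comp]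
@[simp] theorem map_inl_snd₁ : T.Φ.functor.map (inl₁ g) ≫ T.Φ.functor.map (snd₁ g) = 0 := by
  rw [← Functor.map_comp, inl_snd₁, Functor.map_zero]
@[simp] theorem map_inl_snd₁_assoc {Z : A} (k : _ ⟶ Z) :
    T.Φ.functor.map (inl₁ g) ≫ T.Φ.functor.map (snd₁ g) ≫ k = 0 := by
  rw [← Category.assoc, map_inl_snd₁, zero_comp]
@[simp] theorem map_inr_fst₁ : T.Φ.functor.map (inr₁ g) ≫ T.Φ.functor.map (fst₁ g) = 0 := by
  rw [← Functor.map_comp, inr_fst₁, Functor.map_zero]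
@[simp] theorem map_inr_fst₁_assoc {Z : A} (k : _ ⟶ Z) :
    T.Φ.functor.map (inr₁ g) ≫ T.Φ.functor.map (fst₁ g) ≫ k = 0 := by
  rw [← Category.assoc, map_inr_fst₁, zero_comp]
theorem map_ext_from₁ {Z : A} {a b : T.Φ.functor.obj (cone g).X₁ ⟶ Z}
    (hl : T.Φ.functor.map (inl₁ g) ≫ a = T.Φ.functor.map (inl₁ g) ≫ b)
    (hr : T.Φ.functor.map (inr₁ g) ≫ a = T.Φ.functor.map (inr₁ g) ≫ b) : a = b := by
  rw [← Category.id_comp a, ← Category.id_comp b, ← CategoryTheory.Functor.map_id, ← total₁ g]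
  simp [hl, hr]
theorem map_ext_to₁ {Z : A} {a b : Z ⟶ T.Φ.functor.obj (cone g).X₁}
    (hl : a ≫ T.Φ.functor.map (fst₁ g) = b ≫ T.Φ.functor.map (fst₁ g))
    (hr : a ≫ T.Φ.functor.map (snd₁ g) = b ≫ T.Φ.functor.map (snd₁ g)) : a = b := by
  rw [← Category.comp_id a, ← Category.comp_id b, ← CategoryTheory.Functor.map_id, ← total₁ g]
  simp [reassoc_of% hl, reassoc_of% hr]
@[simp] theorem map_inr_snd₀ : T.Φ.functor.map (inr₀ g) ≫ T.Φ.functor.map (snd₀ g) = 𝟙 _ := by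
  rw [← Functor.map_comp, inr_snd₀, CategoryTheory.Functor.map_id]
@[simp] theorem map_inr_snd₀_assoc {Z : A} (k : _ ⟶ Z) :
    T.Φ.functor.map (inr₀ g) ≫ T.Φ.functor.map (snd₀ g) ≫ k = k := by
  rw [← Category.assoc, map_inr_snd₀, Category.id_comp]
@[simp] theorem map_inr_fst₀ : T.Φ.functor.map (inr₀ g) ≫ T.Φ.functor.map (fst₀ g) = 0 := by
  rw [← Functor.map_comp, inr_fst₀, Functor.map_zero]
@[simp] theorem map_inr_fst₀_assoc {Z : A} (k : _ ⟶ Z) :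
    T.Φ.functor.map (inr₀ g) ≫ T.Φ.functor.map (fst₀ g) ≫ k = 0 := by
  rw [← Category.assoc, map_inr_fst₀, zero_comp]
@[simp] theorem inl₁_d₁ : inl₁ g ≫ (cone g).d₁ =
    -(E.d₀ ≫ inl₀ g) + g.f₀ ≫ inr₀ g :=
  (biprod.inl_desc _ _).trans (by simp [inl₀, inr₀]; rfl)
@[simp] theorem inl₁_d₁_assoc {Z : A} (k : _ ⟶ Z) : inl₁ g ≫ (cone g).d₁ ≫ k =
    (-(E.d₀ ≫ inl₀ g) + g.f₀ ≫ inr₀ g) ≫ k := by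
  rw [← inl₁_d₁, Category.assoc]
@[simp] theorem inr₁_d₁ : inr₁ g ≫ (cone g).d₁ =
    F.d₁ ≫ inr₀ g :=
  biprod.inr_desc _ _
@[simp] theorem inr₁_d₁_assoc {Z : A} (k : _ ⟶ Z) : inr₁ g ≫ (cone g).d₁ ≫ k =
    (F.d₁ ≫ inr₀ g) ≫ k := by
  rw [← inr₁_d₁, Category.assoc]
@[simp] theorem inl₀_d₀ : inl₀ g ≫ (cone g).d₀ =
    -(T.Φ.functor.map E.d₁ ≫ T.Φ.functor.map (inl₁ g)) +
      T.Φ.functor.map g.f₁ ≫ T.Φ.functor.map (inr₁ g) :=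
  (biprod.inl_desc _ _).trans (by simp [inl₁, inr₁]; rfl)
@[simp] theorem inl₀_d₀_assoc {Z : A} (k : _ ⟶ Z) : inl₀ g ≫ (cone g).d₀ ≫ k =
    (-(T.Φ.functor.map E.d₁ ≫ T.Φ.functor.map (inl₁ g)) +
      T.Φ.functor.map g.f₁ ≫ T.Φ.functor.map (inr₁ g)) ≫ k := by
  rw [← inl₀_d₀, Category.assoc]
@[simp] theorem inr₀_d₀ : inr₀ g ≫ (cone g).d₀ =
    F.d₀ ≫ T.Φ.functor.map (inr₁ g) :=
  biprod.inr_desc _ _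
@[simp] theorem inr₀_d₀_assoc {Z : A} (k : _ ⟶ Z) : inr₀ g ≫ (cone g).d₀ ≫ k =
    (F.d₀ ≫ T.Φ.functor.map (inr₁ g)) ≫ k := by
  rw [← inr₀_d₀, Category.assoc]
@[simp] theorem d₁_fst₀ : (cone g).d₁ ≫ fst₀ g =
    -(fst₁ g ≫ E.d₀) := by
  apply ext_from₁ <;> simp
@[simp] theorem d₁_fst₀_assoc {Z : A} (k : _ ⟶ Z) : (cone g).d₁ ≫ fst₀ g ≫ k =
    (-(fst₁ g ≫ E.d₀)) ≫ k := by
  rw [← d₁_fst₀, Category.assoc]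
@[simp] theorem d₁_snd₀ : (cone g).d₁ ≫ snd₀ g =
    fst₁ g ≫ g.f₀ + snd₁ g ≫ F.d₁ := by
  apply ext_from₁ <;> simp
@[simp] theorem d₁_snd₀_assoc {Z : A} (k : _ ⟶ Z) : (cone g).d₁ ≫ snd₀ g ≫ k =
    (fst₁ g ≫ g.f₀ + snd₁ g ≫ F.d₁) ≫ k := by
  rw [← d₁_snd₀, Category.assoc]
@[simp] theorem d₀_fst₁ : (cone g).d₀ ≫ T.Φ.functor.map (fst₁ g) =
    -(fst₀ g ≫ T.Φ.functor.map E.d₁) := by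
  apply ext_from₀ <;> simp [← Functor.map_comp]
@[simp] theorem d₀_fst₁_assoc {Z : A} (k : _ ⟶ Z) : (cone g).d₀ ≫ T.Φ.functor.map (fst₁ g) ≫ k =
    (-(fst₀ g ≫ T.Φ.functor.map E.d₁)) ≫ k := by
  rw [← d₀_fst₁, Category.assoc]
@[simp] theorem d₀_snd₁ : (cone g).d₀ ≫ T.Φ.functor.map (snd₁ g) =
    fst₀ g ≫ T.Φ.functor.map g.f₁ + snd₀ g ≫ F.d₀ := by
  apply ext_from₀ <;> simp [← Functor.map_comp]
@[simp] theorem d₀_snd₁_assoc {Z : A} (k : _ ⟶ Z) : (cone g).d₀ ≫ T.Φ.functor.map (snd₁ g) ≫ k =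
    (fst₀ g ≫ T.Φ.functor.map g.f₁ + snd₀ g ≫ F.d₀) ≫ k := by
  rw [← d₀_snd₁, Category.assoc]
@[simp] theorem map_inl₁_d₁ : T.Φ.functor.map (inl₁ g) ≫ T.Φ.functor.map (cone g).d₁ =
    -(T.Φ.functor.map E.d₀ ≫ T.Φ.functor.map (inl₀ g)) +
      T.Φ.functor.map g.f₀ ≫ T.Φ.functor.map (inr₀ g) :=
  by rw [← Functor.map_comp, inl₁_d₁]; simp
@[simp] theorem map_inl₁_d₁_assoc {Z : A} (k : _ ⟶ Z) : T.Φ.functor.map (inl₁ g) ≫ T.Φ.functor.map (cone g).d₁ ≫ k =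
    (-(T.Φ.functor.map E.d₀ ≫ T.Φ.functor.map (inl₀ g)) +
      T.Φ.functor.map g.f₀ ≫ T.Φ.functor.map (inr₀ g)) ≫ k := by
  rw [← map_inl₁_d₁, Category.assoc]
@[simp] theorem map_inr₁_d₁ : T.Φ.functor.map (inr₁ g) ≫ T.Φ.functor.map (cone g).d₁ =
    T.Φ.functor.map F.d₁ ≫ T.Φ.functor.map (inr₀ g) :=
  by rw [← Functor.map_comp, inr₁_d₁]; simp
@[simp] theorem map_inr₁_d₁_assoc {Z : A} (k : _ ⟶ Z) : T.Φ.functor.map (inr₁ g) ≫ T.Φ.functor.map (cone g).d₁ ≫ k =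
    (T.Φ.functor.map F.d₁ ≫ T.Φ.functor.map (inr₀ g)) ≫ k := by
  rw [← map_inr₁_d₁, Category.assoc]
@[simp] theorem map_d₁_fst₀ : T.Φ.functor.map (cone g).d₁ ≫ T.Φ.functor.map (fst₀ g) =
    -(T.Φ.functor.map (fst₁ g) ≫ T.Φ.functor.map E.d₀) :=
  by rw [← Functor.map_comp, d₁_fst₀]; simp
@[simp] theorem map_d₁_fst₀_assoc {Z : A} (k : _ ⟶ Z) : T.Φ.functor.map (cone g).d₁ ≫ T.Φ.functor.map (fst₀ g) ≫ k =
    (-(T.Φ.functor.map (fst₁ g) ≫ T.Φ.functor.map E.d₀)) ≫ k := by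
  rw [← map_d₁_fst₀, Category.assoc]
@[simp] theorem map_d₁_snd₀ : T.Φ.functor.map (cone g).d₁ ≫ T.Φ.functor.map (snd₀ g) =
    T.Φ.functor.map (fst₁ g) ≫ T.Φ.functor.map g.f₀ +
      T.Φ.functor.map (snd₁ g) ≫ T.Φ.functor.map F.d₁ :=
  by rw [← Functor.map_comp, d₁_snd₀]; simp
@[simp] theorem map_d₁_snd₀_assoc {Z : A} (k : _ ⟶ Z) : T.Φ.functor.map (cone g).d₁ ≫ T.Φ.functor.map (snd₀ g) ≫ k =
    (T.Φ.functor.map (fst₁ g) ≫ T.Φ.functor.map g.f₀ +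
      T.Φ.functor.map (snd₁ g) ≫ T.Φ.functor.map F.d₁) ≫ k := by
  rw [← map_d₁_snd₀, Category.assoc]

/-- The inclusion of the target into the cone. -/
@[simps]
def inr : F ⟶ cone g where
  f₁ := inr₁ g
  f₀ := inr₀ g
  comm₁ := by simp
  comm₀ := by simp

/-- The projection from the cone to the shift of the source. -/
@[simps]
def fst : cone g ⟶ (shift T).obj E where
  f₁ := fst₁ g
  f₀ := fst₀ g
  comm₁ := by simp
  comm₀ := by simp

variable {g} in
/-- A morphism from the cone is given by a morphism from the target and a homotopy. -/
@[simps]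
def desc {Z : Factorization T} (u : F ⟶ Z) (s : T.Φ.functor.obj E.X₁ ⟶ Z.X₀)
    (t : E.X₀ ⟶ Z.X₁) (h : IsNullBy (g ≫ u) s t) : cone g ⟶ Z where
  f₁ := fst₁ g ≫ t + snd₁ g ≫ u.f₁
  f₀ := fst₀ g ≫ s + snd₀ g ≫ u.f₀
  comm₁ := by
    have := h.eq₀
    dsimp at this
    apply ext_from₁ <;> simp [u.comm₁, this]
  comm₀ := by
    have := h.eq₁
    dsimp at this
    rw [Functor.map_comp] at this
    apply ext_from₀ <;> simp [u.comm₀, this]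

theorem inr_desc {Z : Factorization T} (u : F ⟶ Z) (s : T.Φ.functor.obj E.X₁ ⟶ Z.X₀)
    (t : E.X₀ ⟶ Z.X₁) (h : IsNullBy (g ≫ u) s t) : inr g ≫ desc u s t h = u := by
  ext <;> simp

end cone

/-- Functoriality of the cone. -/
@[simps]
def coneMap {E F E' F' : Factorization T} {g : E ⟶ F} {g' : E' ⟶ F'} (a : E ⟶ E') (b : F ⟶ F')
    (h : g ≫ b = a ≫ g') : cone g ⟶ cone g' where
  f₁ := cone.fst₁ g ≫ a.f₀ ≫ cone.inl₁ g' + cone.snd₁ g ≫ b.f₁ ≫ cone.inr₁ g'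
  f₀ := cone.fst₀ g ≫ T.Φ.functor.map a.f₁ ≫ cone.inl₀ g' + cone.snd₀ g ≫ b.f₀ ≫ cone.inr₀ g'
  comm₁ := by
    have := congrArg Hom.f₀ h
    dsimp at this
    apply cone.ext_from₁ <;> simp [a.comm₀_assoc, b.comm₁_assoc, reassoc_of% this]
  comm₀ := by
    have := congrArg (fun k => T.Φ.functor.map (Hom.f₁ k)) h
    simp only [Functor.map_comp, comp_f₁] at this
    apply cone.ext_from₀
    · simp [reassoc_of% this, a.map_comm₁_assoc]
    · simp [b.comm₀_assoc]

/-- Isomorphic morphisms have isomorphic cones. -/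
def coneMapIso {E F E' F' : Factorization T} {g : E ⟶ F} {g' : E' ⟶ F'} (a : E ≅ E') (b : F ≅ F')
    (h : g ≫ b.hom = a.hom ≫ g') : cone g ≅ cone g' where
  hom := coneMap a.hom b.hom h
  inv := coneMap a.inv b.inv (by rw [Iso.comp_inv_eq, Category.assoc, h, Iso.inv_hom_id_assoc])
  hom_inv_id := by
    ext
    · apply cone.ext_from₁ <;> simp [← comp_f₁_assoc, ← comp_f₀_assoc]
    · apply cone.ext_from₀ <;> simp [← comp_f₀_assoc, ← Functor.map_comp_assoc, ← comp_f₁]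
  inv_hom_id := by
    ext
    · apply cone.ext_from₁ <;> simp [← comp_f₁_assoc, ← comp_f₀_assoc]
    · apply cone.ext_from₀ <;> simp [← comp_f₀_assoc, ← Functor.map_comp_assoc, ← comp_f₁]

end Factorization

end

section

namespace Factorization

/-! ### Orthogonality and cones -/

/-- If all morphisms from the cone of `g` to `J[1]` are null-homotopic, then each morphism to `J`
extends along `g` up to homotopy. -/
theorem exists_desc_of_null {E F J : Factorization T} (g : E ⟶ F)
    (H : ∀ v : cone g ⟶ (shift T).obj J, Null v) (f : E ⟶ J) : ∃ u : F ⟶ J, Null (g ≫ u - f) := by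
  -- A null-homotopy of `cone g ⟶ E[1] ⟶ J[1]`, restricted to the summand `F`, is the extension `u`;
  -- restricted to the summand `E[1]`, it is the homotopy between `g ≫ u` and `f`.
  obtain ⟨s', t, h⟩ := (H (cone.fst g ≫ (shift T).map f)).exists_isNullBy
  obtain ⟨s, rfl⟩ := T.Φ.functor.map_surjective s'
  change (cone g).X₁ ⟶ J.X₁ at s
  change (cone g).X₀ ⟶ J.X₀ at t
  have e₁ : cone.fst₁ g ≫ f.f₀ = (cone g).d₁ ≫ t - s ≫ J.d₁ := by
    apply T.Φ.functor.map_injective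
    refine h.eq₁.trans ?_
    dsimp
    simp [sub_eq_add_neg]
  have e₀ : cone.fst₀ g ≫ T.Φ.functor.map f.f₁ =
      (cone g).d₀ ≫ T.Φ.functor.map s - t ≫ J.d₀ := by
    refine h.eq₀.trans ?_
    dsimp
    simp [sub_eq_add_neg, add_comm]
  have e₁l := congrArg (fun k => cone.inl₁ g ≫ k) e₁
  have e₁r := congrArg (fun k => cone.inr₁ g ≫ k) e₁
  have e₀l := congrArg (fun k => cone.inl₀ g ≫ k) e₀
  have e₀r := congrArg (fun k => cone.inr₀ g ≫ k) e₀
  simp only [cone.inl_fst₁_assoc, cone.inr_fst₁_assoc, cone.inl_fst₀_assoc, cone.inr_fst₀_assoc,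
    Preadditive.comp_sub, cone.inl₁_d₁_assoc, cone.inr₁_d₁_assoc, cone.inl₀_d₀_assoc,
    cone.inr₀_d₀_assoc, Preadditive.add_comp, Preadditive.neg_comp, Category.assoc,
    ← Functor.map_comp] at e₁l e₁r e₀l e₀r
  let u : F ⟶ J :=
    { f₁ := cone.inr₁ g ≫ s
      f₀ := cone.inr₀ g ≫ t
      comm₁ := by rw [Category.assoc]; exact (sub_eq_zero.1 e₁r.symm).symm
      comm₀ := by rw [Category.assoc]; exact (sub_eq_zero.1 e₀r.symm).symm }
  refine ⟨u, IsNullBy.null (s := cone.inl₀ g ≫ t) (t := cone.inl₁ g ≫ s) ⟨?_, ?_⟩⟩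
  · simp only [sub_f₁, comp_f₁, Functor.map_sub, u, e₀l, Functor.map_comp, Category.assoc]
    abel
  · simp only [sub_f₀, comp_f₀, u, e₁l, Category.assoc]
    abel

/-- If all morphisms from the cone of `g` to `J` are null-homotopic, then a morphism to `J` which
vanishes on `E` up to homotopy is null-homotopic. -/
theorem null_of_null_comp {E F J : Factorization T} (g : E ⟶ F)
    (H : ∀ v : cone g ⟶ J, Null v) (u : F ⟶ J) (h : Null (g ≫ u)) : Null u := by
  obtain ⟨s, t, h⟩ := h.exists_isNullBy
  -- A null-homotopy of `g ≫ u` is exactly what extends `u` over the cone.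
  rw [← cone.inr_desc g u s t h]
  exact (H _).comp_left _

/-- If all morphisms from `P` to the cone of `g` are null-homotopic, then each morphism from `P`
lifts along `g` up to homotopy. -/
theorem exists_lift_of_null {E F P : Factorization T} (g : E ⟶ F)
    (H : ∀ v : P ⟶ cone g, Null v) (f : P ⟶ F) : ∃ u : P ⟶ E, Null (u ≫ g - f) := by
  -- Projecting this homotopy to the summand `E[1]` gives the lift `u`; projecting it to `F` gives,
  -- up to sign, the homotopy between `u ≫ g` and `f`.
  obtain ⟨s, t, h⟩ := (H (f ≫ cone.inr g)).exists_isNullBy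
  obtain ⟨a, ha⟩ := T.Φ.functor.map_surjective (s ≫ cone.fst₀ g)
  have e₁ := h.eq₁
  have e₀ := h.eq₀
  have e₁l := congrArg (fun k => k ≫ T.Φ.functor.map (cone.fst₁ g)) e₁
  have e₁r := congrArg (fun k => k ≫ T.Φ.functor.map (cone.snd₁ g)) e₁
  have e₀l := congrArg (fun k => k ≫ cone.fst₀ g) e₀
  have e₀r := congrArg (fun k => k ≫ cone.snd₀ g) e₀
  simp at e₁l e₁r e₀l e₀r
  rw [← reassoc_of% ha] at e₁l e₁r
  rw [← ha] at e₀l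
  let u : P ⟶ E :=
    { f₁ := a
      f₀ := t ≫ cone.fst₁ g
      comm₁ := by
        apply T.Φ.functor.map_injective
        rw [← sub_eq_zero, ← neg_eq_zero, e₁l]
        simp [sub_eq_add_neg]
      comm₀ := by
        rw [Category.assoc, ← sub_eq_zero, ← neg_eq_zero, e₀l]
        abel }
  refine ⟨u, IsNullBy.null (s := -(s ≫ cone.snd₀ g)) (t := -(t ≫ cone.snd₁ g)) ⟨?_, ?_⟩⟩
  · simp only [sub_f₁, comp_f₁, Functor.map_sub, u, e₁r, Functor.map_neg,
      Functor.map_comp, Category.assoc, Preadditive.comp_neg, Preadditive.neg_comp]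
    abel
  · simp only [sub_f₀, comp_f₀, u, e₀r, Category.assoc, Preadditive.comp_neg, Preadditive.neg_comp]
    abel

/-- If all morphisms from `P[1]` to the cone of `g` are null-homotopic, then a morphism from `P`
which vanishes in `F` up to homotopy is null-homotopic. -/
theorem null_of_comp_null {E F P : Factorization T} (g : E ⟶ F)
    (H : ∀ v : (shift T).obj P ⟶ cone g, Null v) (u : P ⟶ E) (h : Null (u ≫ g)) : Null u := by
  obtain ⟨s, t, h⟩ := h.exists_isNullBy
  have h₁ := h.eq₁
  have h₀ := h.eq₀
  dsimp at h₁ h₀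
  rw [Functor.map_comp] at h₁
  -- The homotopy for `u ≫ g` lifts `u[1]` to the cone: `u[1]` goes to the summand `E[1]`, and minus
  -- the homotopy is its component in `F`.
  let v : (shift T).obj P ⟶ cone g :=
    { f₁ := u.f₀ ≫ cone.inl₁ g - t ≫ cone.inr₁ g
      f₀ := T.Φ.functor.map u.f₁ ≫ cone.inl₀ g - s ≫ cone.inr₀ g
      comm₁ := by
        simp [reassoc_of% h₀, u.comm₀_assoc]
        abel
      comm₀ := by
        simp [reassoc_of% h₁, u.map_comm₁_assoc]
        abel }
  rw [← null_shift_iff]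
  have : (shift T).map u = v ≫ cone.fst g := by
    ext <;> simp [v]
  rw [this]
  exact (H v).comp_right _

/-- A morphism from the cone of `g` is null-homotopic if its restriction to `F` is and all morphisms
from `E[1]` are. -/
theorem null_of_cone {E F J : Factorization T} {g : E ⟶ F} (v : cone g ⟶ J)
    (hF : Null (cone.inr g ≫ v)) (hE : ∀ u : (shift T).obj E ⟶ J, Null u) : Null v := by
  obtain ⟨s, t, h⟩ := hF.exists_isNullBy
  have h₁ := h.eq₁
  have h₀ := h.eq₀
  simp only [comp_f₁, comp_f₀, cone.inr_f₁, cone.inr_f₀] at h₁ h₀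
  rw [Functor.map_comp] at h₁
  -- The restriction of `v` to `E[1]` is not a morphism; subtracting `g` followed by the homotopy on
  -- `F` makes it one, and `v` is then homotopic to `cone.fst g ≫ v'`.
  let v' : (shift T).obj E ⟶ J :=
    { f₁ := cone.inl₁ g ≫ v.f₁ - g.f₀ ≫ t
      f₀ := cone.inl₀ g ≫ v.f₀ - T.Φ.functor.map g.f₁ ≫ s
      comm₁ := by
        simp [v.comm₁, h₀, g.comm₀_assoc]
        abel
      comm₀ := by
        simp [v.comm₀, h₁, g.map_comm₁_assoc]
        abel }
  have : Null (v - cone.fst g ≫ v') := by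
    refine IsNullBy.null (s := T.Φ.functor.map (cone.snd₁ g) ≫ s) (t := cone.snd₀ g ≫ t) ⟨?_, ?_⟩
    · apply cone.map_ext_from₁ <;> simp [v', h₁]
    · apply cone.ext_from₀ <;> simp [v', h₀]
  rw [← sub_add_cancel v (cone.fst g ≫ v')]
  exact this.add ((hE v').comp_left _)

/-- A morphism to the cone of `g` is null-homotopic if its projection to `E[1]` is and all morphisms
to `F` are. -/
theorem null_to_cone {E F P : Factorization T} {g : E ⟶ F} (v : P ⟶ cone g)
    (hE : Null (v ≫ cone.fst g)) (hF : ∀ u : P ⟶ F, Null u) : Null v := by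
  obtain ⟨s', t, h⟩ := hE.exists_isNullBy
  obtain ⟨s, rfl⟩ := T.Φ.functor.map_surjective s'
  change P.X₁ ⟶ E.X₁ at s
  change P.X₀ ⟶ E.X₀ at t
  have h₁ : v.f₁ ≫ cone.fst₁ g = P.d₁ ≫ t - s ≫ E.d₁ := by
    apply T.Φ.functor.map_injective
    refine h.eq₁.trans ?_
    dsimp
    simp [sub_eq_add_neg]
  have h₀ : v.f₀ ≫ cone.fst₀ g = P.d₀ ≫ T.Φ.functor.map s - t ≫ E.d₀ := by
    refine h.eq₀.trans ?_
    dsimp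
    simp [sub_eq_add_neg, add_comm]
  have c₁ := congrArg (fun k => k ≫ cone.snd₀ g) v.comm₁
  have c₀ := congrArg (fun k => k ≫ T.Φ.functor.map (cone.snd₁ g)) v.comm₀
  simp [reassoc_of% h₁, reassoc_of% h₀] at c₁ c₀
  -- The component of `v` in `F`, corrected by the homotopy on `E[1]` followed by `g`, becomes a
  -- morphism, and `v` is homotopic to `v' ≫ cone.inr g`.
  let v' : P ⟶ F :=
    { f₁ := v.f₁ ≫ cone.snd₁ g - s ≫ g.f₁
      f₀ := v.f₀ ≫ cone.snd₀ g - t ≫ g.f₀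
      comm₁ := by
        simp [← c₁, g.comm₁]
        abel
      comm₀ := by
        simp [← c₀, g.comm₀]
        abel }
  have : Null (v - v' ≫ cone.inr g) := by
    refine IsNullBy.null (s := T.Φ.functor.map s ≫ cone.inl₀ g) (t := t ≫ cone.inl₁ g) ⟨?_, ?_⟩
    · have h₁' := congrArg T.Φ.functor.map h₁
      simp only [Functor.map_comp, Functor.map_sub] at h₁'
      apply cone.map_ext_to₁ <;> simp [v', h₁', sub_eq_add_neg]
    · apply cone.ext_to₀ <;> simp [v', h₀, add_comm, sub_eq_add_neg]
  rw [← sub_add_cancel v (v' ≫ cone.inr g)]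
  exact this.add ((hF v').comp_right _)

/-! ### The octahedron -/

section

variable {X Y Z : Factorization T} (f : X ⟶ Y) (g : Y ⟶ Z)

/-- The connecting morphism from the cone of `g` to the shift of the cone of `f`. -/
abbrev coneConnecting : cone g ⟶ (shift T).obj (cone f) := cone.fst g ≫ (shift T).map (cone.inr f)

set_option maxHeartbeats 800000 in
/-- The shift of the cone of a composition is a direct summand of the cone of the connecting
morphism. -/
def coneCompRetract : Retract ((shift T).obj (cone (f ≫ g))) (cone (coneConnecting f g)) where
  -- A strict retraction is enough: thick subcategories are closed under retracts, so the other
  -- composite of the octahedral equivalence, an identity only up to homotopy, never has to be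
  -- examined.
  i :=
    { f₁ := cone.fst₀ (f ≫ g) ≫ T.Φ.functor.map f.f₁ ≫ cone.inl₀ g ≫ cone.inl₁ (coneConnecting f g) +
        cone.snd₀ (f ≫ g) ≫ cone.inr₀ g ≫ cone.inl₁ (coneConnecting f g) +
        cone.fst₀ (f ≫ g) ≫ cone.inl₀ f ≫ cone.inr₁ (coneConnecting f g)
      f₀ := (T.Φ.functor.map (cone.fst₁ (f ≫ g)) ≫ T.Φ.functor.map f.f₀ ≫
          T.Φ.functor.map (cone.inl₁ g) + T.Φ.functor.map (cone.snd₁ (f ≫ g)) ≫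
          T.Φ.functor.map (cone.inr₁ g)) ≫ cone.inl₀ (coneConnecting f g) +
        T.Φ.functor.map (cone.fst₁ (f ≫ g)) ≫ T.Φ.functor.map (cone.inl₁ f) ≫
          cone.inr₀ (coneConnecting f g)
      comm₁ := by
        apply cone.ext_from₀ (f ≫ g)
        · simp [f.map_comm₁_assoc]
          abel
        · simp
      comm₀ := by
        have := congrArg T.Φ.functor.map f.comm₀
        simp only [Functor.map_comp] at this
        apply cone.map_ext_from₁ (f ≫ g)
        · simp [reassoc_of% this]
          abel
        · simp }
  r :=
    { f₁ := cone.fst₁ (coneConnecting f g) ≫ cone.snd₀ g ≫ cone.inr₀ (f ≫ g) +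
        cone.snd₁ (coneConnecting f g) ≫ (cone.fst₀ f ≫ cone.inl₀ (f ≫ g) +
          cone.snd₀ f ≫ g.f₀ ≫ cone.inr₀ (f ≫ g))
      f₀ := cone.fst₀ (coneConnecting f g) ≫ T.Φ.functor.map (cone.snd₁ g) ≫
          T.Φ.functor.map (cone.inr₁ (f ≫ g)) +
        cone.snd₀ (coneConnecting f g) ≫ (T.Φ.functor.map (cone.fst₁ f) ≫
          T.Φ.functor.map (cone.inl₁ (f ≫ g)) + T.Φ.functor.map (cone.snd₁ f) ≫
          T.Φ.functor.map g.f₁ ≫ T.Φ.functor.map (cone.inr₁ (f ≫ g)))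
      comm₁ := by
        apply cone.ext_from₁
        · apply cone.ext_from₀ g <;> simp
        · apply cone.ext_from₀ f
          · simp
            exact add_comm _ _
          · simp [g.comm₀_assoc]
      comm₀ := by
        apply cone.ext_from₀
        · apply cone.map_ext_from₁ g <;> simp
        · apply cone.map_ext_from₁ f
          · simp
            exact add_comm _ _
          · simp [g.map_comm₁_assoc] }
  retract := by
    ext
    · apply cone.ext_from₀ (f ≫ g) <;> simp
    · apply cone.map_ext_from₁ (f ≫ g) <;> simp

end

end Factorization

end

/-! ### Total cones of sequences of three factorizations -/

section

namespace Factorization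

/-- The morphism `X[1] ⟶ cone h` given by `f : X ⟶ Y` with `f ≫ h = 0`. -/
@[simps]
def shiftToCone {X Y Z : Factorization T} (f : X ⟶ Y) (h : Y ⟶ Z) (w : f ≫ h = 0) :
    (shift T).obj X ⟶ cone h where
  f₁ := f.f₀ ≫ cone.inl₁ h
  f₀ := T.Φ.functor.map f.f₁ ≫ cone.inl₀ h
  comm₁ := by
    have := congrArg Hom.f₀ w
    rw [comp_f₀] at this
    simp [reassoc_of% this, f.comm₀_assoc]
  comm₀ := by
    have := congrArg (fun k => T.Φ.functor.map (Hom.f₁ k)) w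
    simp only [comp_f₁, Functor.map_comp, zero_f₁, Functor.map_zero] at this
    simp [reassoc_of% this, f.map_comm₁_assoc]

/-- The morphism `cone f ⟶ Z` given by `h : Y ⟶ Z` with `f ≫ h = 0`. -/
abbrev coneTo {X Y Z : Factorization T} (f : X ⟶ Y) (h : Y ⟶ Z) (w : f ≫ h = 0) : cone f ⟶ Z :=
  cone.desc h 0 0 ⟨by simp [w], by simp [w]⟩

/-- The two total cones of `X ⟶ Y ⟶ Z` are isomorphic. -/
def coneConeTo {X Y Z : Factorization T} (f : X ⟶ Y) (h : Y ⟶ Z) (w : f ≫ h = 0) :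
    cone (coneTo f h w) ≅ cone (shiftToCone f h w) where
  hom :=
    -- Both sides have the summands `X[2]`, `Y[1]`, `Z`. On the left the component `f` sits in the
    -- shifted cone of `f` and is negated; the sign on `X[2]` compensates.
    { f₁ := cone.fst₁ _ ≫ (-(cone.fst₀ f ≫ cone.inl₁ (shiftToCone f h w)) +
        cone.snd₀ f ≫ cone.inl₁ h ≫ cone.inr₁ _) + cone.snd₁ _ ≫ cone.inr₁ h ≫ cone.inr₁ _
      f₀ := cone.fst₀ _ ≫ (-(T.Φ.functor.map (cone.fst₁ f) ≫ cone.inl₀ (shiftToCone f h w)) +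
        T.Φ.functor.map (cone.snd₁ f) ≫ cone.inl₀ h ≫ cone.inr₀ _) +
        cone.snd₀ _ ≫ cone.inr₀ h ≫ cone.inr₀ _
      comm₁ := by
        apply cone.ext_from₁
        · apply cone.ext_from₀ f <;> simp
          abel
        · simp
      comm₀ := by
        apply cone.ext_from₀
        · apply cone.map_ext_from₁ f <;> simp
          abel
        · simp }
  inv :=
    { f₁ := -(cone.fst₁ (shiftToCone f h w) ≫ cone.inl₀ f ≫ cone.inl₁ _) +
        cone.snd₁ (shiftToCone f h w) ≫ (cone.fst₁ h ≫ cone.inr₀ f ≫ cone.inl₁ _ +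
          cone.snd₁ h ≫ cone.inr₁ _)
      f₀ := -(cone.fst₀ (shiftToCone f h w) ≫ T.Φ.functor.map (cone.inl₁ f) ≫ cone.inl₀ _) +
        cone.snd₀ (shiftToCone f h w) ≫
          (cone.fst₀ h ≫ T.Φ.functor.map (cone.inr₁ f) ≫ cone.inl₀ _ + cone.snd₀ h ≫ cone.inr₀ _)
      comm₁ := by
        apply cone.ext_from₁
        · simp
        · apply cone.ext_from₁ h <;> simp
      comm₀ := by
        apply cone.ext_from₀
        · simp
        · apply cone.ext_from₀ h <;> simp }
  hom_inv_id := by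
    ext
    · apply cone.ext_from₁
      · apply cone.ext_from₀ f <;> simp
      · simp
    · apply cone.ext_from₀
      · apply cone.map_ext_from₁ f <;> simp
      · simp
  inv_hom_id := by
    ext
    · apply cone.ext_from₁
      · simp
      · apply cone.ext_from₁ h <;> simp
    · apply cone.ext_from₀
      · simp
      · apply cone.ext_from₀ h <;> simp

/-- Cones commute with shifts. -/
def shiftCone {X Y : Factorization T} (f : X ⟶ Y) :
    (shift T).obj (cone f) ≅ cone ((shift T).map f) where
  hom :=
    { f₁ := -(cone.fst₀ f ≫ cone.inl₁ ((shift T).map f)) + cone.snd₀ f ≫ cone.inr₁ ((shift T).map f)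
      f₀ := -(T.Φ.functor.map (cone.fst₁ f) ≫ cone.inl₀ ((shift T).map f)) +
        T.Φ.functor.map (cone.snd₁ f) ≫ cone.inr₀ ((shift T).map f)
      comm₁ := by
        apply cone.ext_from₀ f <;> simp
        abel
      comm₀ := by
        apply cone.map_ext_from₁ f <;> simp
        abel }
  inv :=
    { f₁ := -(cone.fst₁ ((shift T).map f) ≫ cone.inl₀ f) + cone.snd₁ ((shift T).map f) ≫ cone.inr₀ f
      f₀ := -(cone.fst₀ ((shift T).map f) ≫ T.Φ.functor.map (cone.inl₁ f)) +
        cone.snd₀ ((shift T).map f) ≫ T.Φ.functor.map (cone.inr₁ f)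
      comm₁ := by
        apply cone.ext_from₁ <;> simp
      comm₀ := by
        apply cone.ext_from₀ <;> simp }
  hom_inv_id := by
    ext
    · apply cone.ext_from₀ f <;> simp
    · apply cone.map_ext_from₁ f <;> simp
  inv_hom_id := by
    ext
    · apply cone.ext_from₁ <;> simp
    · apply cone.ext_from₀ <;> simp

end Factorization

/-! ### Thick subcategories -/

namespace IsThick

variable {N : ObjectProperty (K T)} (hN : IsThick N)
include hN

theorem of_retract {E F : Factorization T} (r : Retract E F) (hF : N ((K.of T).obj F)) :
    N ((K.of T).obj E) :=
  have := hN.retract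
  N.prop_of_retract (r.map (K.of T)) hF

theorem of_iso {E F : Factorization T} (e : E ≅ F) (hE : N ((K.of T).obj E)) :
    N ((K.of T).obj F) :=
  hN.of_retract ⟨e.inv, e.hom, e.inv_hom_id⟩ hE

/-- The octahedral axiom within `N`: the connecting map goes from `cone g` to `(cone f)[1]`, both in
`N`, and the shifted cone of the composite is a retract of its cone. -/
theorem cone_comp {X Y Z : Factorization T} (f : X ⟶ Y) (g : Y ⟶ Z)
    (hf : N ((K.of T).obj (Factorization.cone f))) (hg : N ((K.of T).obj (Factorization.cone g))) :
    N ((K.of T).obj (Factorization.cone (f ≫ g))) :=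
  (hN.shift_iff _).1 (hN.of_retract (coneCompRetract f g)
    (hN.cone _ hg ((hN.shift_iff _).2 hf)))

theorem cone_shift_iff {X Y : Factorization T} (f : X ⟶ Y) :
    N ((K.of T).obj (Factorization.cone ((Factorization.shift T).map f))) ↔
      N ((K.of T).obj (Factorization.cone f)) := by
  rw [← hN.shift_iff (Factorization.cone f)]
  exact ⟨hN.of_iso (shiftCone f).symm, hN.of_iso (shiftCone f)⟩

theorem cone_shiftToCone {X Y Z : Factorization T} (f : X ⟶ Y) (h : Y ⟶ Z) (w : f ≫ h = 0) :
    N ((K.of T).obj (Factorization.cone (shiftToCone f h w))) ↔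
      N ((K.of T).obj (Factorization.cone (coneTo f h w))) :=
  ⟨hN.of_iso (coneConeTo f h w).symm, hN.of_iso (coneConeTo f h w)⟩

end IsThick

/-! ### The acyclic factorizations -/

/-- The smallest class is an intersection of thick classes, and every clause of thickness passes to
intersections. The same argument serves the co-acyclic and contra-acyclic classes. -/
theorem absAcyclic_isThick : IsThick (absAcyclic T) where
  shift_iff E := ⟨fun h N hN hN' => (hN.shift_iff E).1 (h N hN hN'),
    fun h N hN hN' => (hN.shift_iff E).2 (h N hN hN')⟩
  cone f hE hF N hN hN' := hN.cone f (hE N hN hN') (hF N hN hN')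
  retract := ⟨fun r h N hN hN' => have := hN.retract; N.prop_of_retract r (h N hN hN')⟩

theorem absAcyclic_tot : ContainsExactTotalizations (absAcyclic T) :=
  fun X _ hX _ _ hN' => hN' X hX

theorem coAcyclic_isThick : IsThick (coAcyclic.{w} T) where
  shift_iff E := ⟨fun h N hN hN' hN'' => (hN.shift_iff E).1 (h N hN hN' hN''),
    fun h N hN hN' hN'' => (hN.shift_iff E).2 (h N hN hN' hN'')⟩
  cone f hE hF N hN hN' hN'' := hN.cone f (hE N hN hN' hN'') (hF N hN hN' hN'')
  retract := ⟨fun r h N hN hN' hN'' =>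
    have := hN.retract; N.prop_of_retract r (h N hN hN' hN'')⟩

theorem coAcyclic_tot : ContainsExactTotalizations (coAcyclic.{w} T) :=
  fun X _ hX _ _ hN' _ => hN' X hX

theorem coAcyclic_closed (J : Type w) :
    (coAcyclic.{w} T).IsClosedUnderColimitsOfShape (Discrete J) where
  colimitsOfShape_le := by
    rintro X ⟨p⟩ N hN hN' hN''
    exact (hN'' J).colimitsOfShape_le _ ⟨{ p with
      prop_diag_obj := fun j => p.prop_diag_obj j N hN hN' hN'' }⟩

theorem ctrAcyclic_isThick : IsThick (ctrAcyclic.{w} T) where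
  shift_iff E := ⟨fun h N hN hN' hN'' => (hN.shift_iff E).1 (h N hN hN' hN''),
    fun h N hN hN' hN'' => (hN.shift_iff E).2 (h N hN hN' hN'')⟩
  cone f hE hF N hN hN' hN'' := hN.cone f (hE N hN hN' hN'') (hF N hN hN' hN'')
  retract := ⟨fun r h N hN hN' hN'' =>
    have := hN.retract; N.prop_of_retract r (h N hN hN' hN'')⟩

theorem ctrAcyclic_tot : ContainsExactTotalizations (ctrAcyclic.{w} T) :=
  fun X _ hX _ _ hN' _ => hN' X hX

theorem ctrAcyclic_closed (J : Type w) :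
    (ctrAcyclic.{w} T).IsClosedUnderLimitsOfShape (Discrete J) where
  limitsOfShape_le := by
    rintro X ⟨p⟩ N hN hN' hN''
    exact (hN'' J).limitsOfShape_le _ ⟨{ p with
      prop_diag_obj := fun j => p.prop_diag_obj j N hN hN' hN'' }⟩

end

section

namespace Factorization

/-! ### Binary biproducts of factorizations -/

/-- The componentwise biproduct. -/
@[simps]
def biprodCone (E F : Factorization T) : BinaryBicone E F where
  pt :=
    { X₁ := E.X₁ ⊞ F.X₁
      X₀ := E.X₀ ⊞ F.X₀
      d₁ := biprod.map E.d₁ F.d₁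
      d₀ := biprod.fst ≫ E.d₀ ≫ T.Φ.functor.map biprod.inl +
        biprod.snd ≫ F.d₀ ≫ T.Φ.functor.map biprod.inr
      d₁_d₀ := by
        have h₁ := T.w_nat (biprod.inl : E.X₁ ⟶ E.X₁ ⊞ F.X₁)
        have h₂ := T.w_nat (biprod.inr : F.X₁ ⟶ E.X₁ ⊞ F.X₁)
        apply biprod.hom_ext' <;> simp [h₁, h₂]
      d₀_d₁ := by
        have h₁ := T.w_nat (biprod.inl : E.X₀ ⟶ E.X₀ ⊞ F.X₀)
        have h₂ := T.w_nat (biprod.inr : F.X₀ ⟶ E.X₀ ⊞ F.X₀)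
        have h₃ := congrArg T.Φ.functor.map (biprod.inl_map E.d₁ F.d₁)
        have h₄ := congrArg T.Φ.functor.map (biprod.inr_map E.d₁ F.d₁)
        simp only [Functor.map_comp] at h₃ h₄
        apply biprod.hom_ext' <;> simp [h₁, h₂, h₃, h₄] }
  fst := { f₁ := biprod.fst, f₀ := biprod.fst, comm₁ := by simp, comm₀ := by
            simp [← Functor.map_comp] }
  snd := { f₁ := biprod.snd, f₀ := biprod.snd, comm₁ := by simp, comm₀ := by
            simp [← Functor.map_comp] }
  inl := { f₁ := biprod.inl, f₀ := biprod.inl, comm₁ := by simp, comm₀ := by simp }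
  inr := { f₁ := biprod.inr, f₀ := biprod.inr, comm₁ := by simp, comm₀ := by simp }
  inl_fst := by ext <;> simp
  inl_snd := by ext <;> simp
  inr_fst := by ext <;> simp
  inr_snd := by ext <;> simp

instance : HasBinaryBiproducts (Factorization T) where
  has_binary_biproduct E F := HasBinaryBiproduct.mk
    ⟨biprodCone E F, isBinaryBilimitOfTotal _ (by ext <;> simp <;> exact biprod.total)⟩

open scoped ZeroObject in
instance : HasZeroObject (Factorization T) where
  zero := ⟨{ X₁ := 0, X₀ := 0, d₁ := 0, d₀ := 0
             d₁_d₀ := (isZero_zero A).eq_of_src _ _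
             d₀_d₁ := (isZero_zero A).eq_of_src _ _ },
    isZero (isZero_zero A) (isZero_zero A)⟩

/-! ### Totalizations of mapping cones -/

section

/-- A morphism `E ⟶ E'` induces `(E[n])^{-1} ⟶ (E'[m])^0` if `n = m + 1`. -/
def down₁ (m n : ℤ) (h : m + 1 = n) {E E' : Factorization T} (a : E ⟶ E') :
    ((shiftZ T n).obj E).X₁ ⟶ ((shiftZ T m).obj E').X₀ :=
  ((shiftZ T n).map a).f₁ ≫ ((link T m n h).c₀ E').inv

/-- A morphism `E ⟶ E'` induces `(E[n])^0 ⟶ Φ (E'[m])^{-1}` if `n = m + 1`. -/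
def down₀ (m n : ℤ) (h : m + 1 = n) {E E' : Factorization T} (a : E ⟶ E') :
    ((shiftZ T n).obj E).X₀ ⟶ T.Φ.functor.obj ((shiftZ T m).obj E').X₁ :=
  ((shiftZ T n).map a).f₀ ≫ ((link T m n h).c₁ E').hom

/-- A morphism `E ⟶ E'` induces `(E[m])^0 ⟶ (E'[n])^{-1}` if `n = m + 1`. -/
def up₁ (m n : ℤ) (h : m + 1 = n) {E E' : Factorization T} (a : E ⟶ E') :
    ((shiftZ T m).obj E).X₀ ⟶ ((shiftZ T n).obj E').X₁ :=
  ((link T m n h).c₀ E).hom ≫ ((shiftZ T n).map a).f₁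

/-- A morphism `E ⟶ E'` induces `Φ (E[m])^{-1} ⟶ (E'[n])^0` if `n = m + 1`. -/
def up₀ (m n : ℤ) (h : m + 1 = n) {E E' : Factorization T} (a : E ⟶ E') :
    T.Φ.functor.obj ((shiftZ T m).obj E).X₁ ⟶ ((shiftZ T n).obj E').X₀ :=
  ((link T m n h).c₁ E).inv ≫ ((shiftZ T n).map a).f₀

variable (m n : ℤ) (h : m + 1 = n) {E E' E'' : Factorization T} (a a' : E ⟶ E') (b : E' ⟶ E'')

/-- Rules for maps that change the shift by one. They compose with ordinary morphisms on either
side, `up` followed by `down` (or conversely) is an ordinary shifted morphism, and `down`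
anticommutes with structure maps because shifting negates them. Identities for totalizations are
then checked summandwise without unfolding `shiftZ`. -/
theorem map_down₁ : ((shiftZ T n).map a).f₁ ≫ down₁ m n h b = down₁ m n h (a ≫ b) := by
  simp [down₁]

theorem map_down₀ : ((shiftZ T n).map a).f₀ ≫ down₀ m n h b = down₀ m n h (a ≫ b) := by
  simp [down₀]

theorem down₁_map : down₁ m n h a ≫ ((shiftZ T m).map b).f₀ = down₁ m n h (a ≫ b) := by
  simp [down₁, Link.nat₀']

theorem down₀_map : down₀ m n h a ≫ T.Φ.functor.map ((shiftZ T m).map b).f₁ =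
    down₀ m n h (a ≫ b) := by
  simp [down₀, ← Link.nat₁]

theorem d₁_down₀ : ((shiftZ T n).obj E).d₁ ≫ down₀ m n h a =
    -(down₁ m n h a ≫ ((shiftZ T m).obj E').d₀) := by
  simp only [down₀, down₁, Category.assoc]
  rw [← Hom.comm₁_assoc, Link.d₁_eq]
  simp

theorem d₀_down₁ : ((shiftZ T n).obj E).d₀ ≫ T.Φ.functor.map (down₁ m n h a) =
    -(down₀ m n h a ≫ T.Φ.functor.map ((shiftZ T m).obj E').d₁) := by
  simp only [down₀, down₁, Category.assoc, Functor.map_comp]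
  rw [← Hom.comm₀_assoc, Link.d₀_eq]
  simp

theorem down₁_add : down₁ m n h (a + a') = down₁ m n h a + down₁ m n h a' := by
  simp [down₁, Functor.map_add]

theorem down₀_add : down₀ m n h (a + a') = down₀ m n h a + down₀ m n h a' := by
  simp [down₀, Functor.map_add]

theorem down₁_neg : down₁ m n h (-a) = -down₁ m n h a := by
  simp [down₁, Functor.map_neg]

theorem down₀_neg : down₀ m n h (-a) = -down₀ m n h a := by
  simp [down₀, Functor.map_neg]

theorem down₁_zero : down₁ m n h (0 : E ⟶ E') = 0 := by
  simp [down₁]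

theorem down₀_zero : down₀ m n h (0 : E ⟶ E') = 0 := by
  simp [down₀]

theorem up₁_map : up₁ m n h a ≫ ((shiftZ T n).map b).f₁ = up₁ m n h (a ≫ b) := by
  simp [up₁]

theorem up₀_map : up₀ m n h a ≫ ((shiftZ T n).map b).f₀ = up₀ m n h (a ≫ b) := by
  simp [up₀]

theorem up₁_down₁ : up₁ m n h a ≫ down₁ m n h b = ((shiftZ T m).map (a ≫ b)).f₀ := by
  simp only [up₁, down₁, Functor.map_comp, comp_f₀, Category.assoc]
  rw [← Link.nat₀', ← Link.nat₀'_assoc]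
  simp

theorem up₀_down₀ : up₀ m n h a ≫ down₀ m n h b =
    T.Φ.functor.map ((shiftZ T m).map (a ≫ b)).f₁ := by
  simp only [up₀, down₀, Functor.map_comp, comp_f₁, Category.assoc]
  rw [Link.nat₁, Link.nat₁_assoc]
  simp

theorem down₁_up₁ : down₁ m n h a ≫ up₁ m n h b = ((shiftZ T n).map (a ≫ b)).f₁ := by
  simp [up₁, down₁]

theorem down₀_up₀ : down₀ m n h a ≫ up₀ m n h b = ((shiftZ T n).map (a ≫ b)).f₀ := by
  simp [up₀, down₀]

end

section

variable {J : Type*} {X : J → A} [HasCoproduct X]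

/-- Morphisms from the image under `Φ` of a coproduct. -/
def mapSigmaDesc {Z : A} (k : ∀ j, T.Φ.functor.obj (X j) ⟶ Z) : T.Φ.functor.obj (∐ X) ⟶ Z :=
  T.Φ.functor.map (Sigma.desc fun j => T.Φ.unit.app (X j) ≫ T.Φ.inverse.map (k j)) ≫
    T.Φ.counit.app Z

theorem map_ι_mapSigmaDesc {Z : A} (k : ∀ j, T.Φ.functor.obj (X j) ⟶ Z) (j : J) :
    T.Φ.functor.map (Sigma.ι X j) ≫ mapSigmaDesc k = k j := by
  simp [mapSigmaDesc, ← Functor.map_comp_assoc]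

/-- `Φ` is a left adjoint, so a map out of `Φ` of a coproduct is determined by its transpose, a map
out of the coproduct. -/
theorem mapSigma_hom_ext {Z : A} {a b : T.Φ.functor.obj (∐ X) ⟶ Z}
    (h : ∀ j, T.Φ.functor.map (Sigma.ι X j) ≫ a = T.Φ.functor.map (Sigma.ι X j) ≫ b) : a = b := by
  apply (T.Φ.toAdjunction.homEquiv _ _).injective
  refine Limits.Sigma.hom_ext _ _ fun j => ?_
  rw [← Adjunction.homEquiv_naturality_left, h, Adjunction.homEquiv_naturality_left]

end

end Factorization

end

/-! ### The totalization of a mapping cone is the cone of the totalization -/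

section

namespace Factorization

open CochainComplex

section

variable {F G : CochainComplex (Factorization T) ℤ} (f : F ⟶ G)

instance [IsBdd F] [IsBdd G] : IsBdd (mappingCone f) where
  bounded := by
    obtain ⟨a, b, h⟩ := IsBdd.bounded (X := F)
    obtain ⟨a', b', h'⟩ := IsBdd.bounded (X := G)
    -- Degree `i` of the mapping cone involves `F` in degree `i + 1`, hence `a - 1`; `max b b'` is a
    -- sufficient upper bound.
    refine ⟨min (a - 1) a', max b b', fun i hi => ?_⟩
    rw [IsZero.iff_id_eq_zero, ← mappingCone.id_X f i (i + 1) rfl,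
      (h (i + 1) (by omega)).eq_of_tgt ((mappingCone.fst f).1.v i (i + 1) rfl) 0,
      (h' i (by omega)).eq_of_tgt ((mappingCone.snd f).v i i (add_zero i)) 0]
    simp

variable [IsBdd F] [IsBdd G]

/-- The degree `-1` part of the comparison of the totalization of a mapping cone and the cone of
the totalization. -/
def totCone₁ : tot₁ (mappingCone f) ⟶ (cone (totMap f)).X₁ :=
  Limits.Sigma.desc fun n =>
    down₁ (n - 1) n (by omega) ((mappingCone.fst f).1.v (-n) (-(n - 1)) (by omega)) ≫
      ι₀ F (n - 1) ≫ cone.inl₁ (totMap f) +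
    ((shiftZ T n).map ((mappingCone.snd f).v (-n) (-n) (by omega))).f₁ ≫ ι₁ G n ≫
      cone.inr₁ (totMap f)

/-- The relation `m + 1 = n` replaces `n - 1`, so that the formula applies to the index pair `(n -
1, n)` as well as to `(m, m + 1)` without transport between equal degrees. -/
theorem ι₁_totCone₁ (m n : ℤ) (h : m + 1 = n) : ι₁ (mappingCone f) n ≫ totCone₁ f =
    down₁ m n h ((mappingCone.fst f).1.v (-n) (-m) (by omega)) ≫
      ι₀ F m ≫ cone.inl₁ (totMap f) +
    ((shiftZ T n).map ((mappingCone.snd f).v (-n) (-n) (by omega))).f₁ ≫ ι₁ G n ≫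
      cone.inr₁ (totMap f) := by
  obtain rfl : m = n - 1 := by omega
  simp [totCone₁]

/-- The degree `0` part of the comparison. -/
def totCone₀ : tot₀ (mappingCone f) ⟶ (cone (totMap f)).X₀ :=
  Limits.Sigma.desc fun n =>
    down₀ (n - 1) n (by omega) ((mappingCone.fst f).1.v (-n) (-(n - 1)) (by omega)) ≫
      T.Φ.functor.map (ι₁ F (n - 1)) ≫ cone.inl₀ (totMap f) +
    ((shiftZ T n).map ((mappingCone.snd f).v (-n) (-n) (by omega))).f₀ ≫ ι₀ G n ≫
      cone.inr₀ (totMap f)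

theorem ι₀_totCone₀ (m n : ℤ) (h : m + 1 = n) : ι₀ (mappingCone f) n ≫ totCone₀ f =
    down₀ m n h ((mappingCone.fst f).1.v (-n) (-m) (by omega)) ≫
      T.Φ.functor.map (ι₁ F m) ≫ cone.inl₀ (totMap f) +
    ((shiftZ T n).map ((mappingCone.snd f).v (-n) (-n) (by omega))).f₀ ≫ ι₀ G n ≫
      cone.inr₀ (totMap f) := by
  obtain rfl : m = n - 1 := by omega
  simp [totCone₀]

/-- The degree `-1` part of the inverse comparison. -/
def coneTot₁ : (cone (totMap f)).X₁ ⟶ tot₁ (mappingCone f) :=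
  cone.fst₁ (totMap f) ≫ (Limits.Sigma.desc fun m =>
      up₁ m (m + 1) rfl ((mappingCone.inl f).v (-m) (-(m + 1)) (by omega)) ≫
        ι₁ (mappingCone f) (m + 1)) +
    cone.snd₁ (totMap f) ≫ (totMap (mappingCone.inr f)).f₁

theorem ι₀_inl₁_coneTot₁ (m n : ℤ) (h : m + 1 = n) :
    ι₀ F m ≫ cone.inl₁ (totMap f) ≫ coneTot₁ f =
      up₁ m n h ((mappingCone.inl f).v (-m) (-n) (by omega)) ≫ ι₁ (mappingCone f) n := by
  subst h
  simp [coneTot₁]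

theorem ι₁_inr₁_coneTot₁ (n : ℤ) :
    ι₁ G n ≫ cone.inr₁ (totMap f) ≫ coneTot₁ f =
      ((shiftZ T n).map ((mappingCone.inr f).f (-n))).f₁ ≫ ι₁ (mappingCone f) n := by
  simp only [coneTot₁, Preadditive.comp_add, cone.inr_fst₁_assoc, cone.inr_snd₁_assoc, ι₁_totMap,
    zero_add]

/-- The degree `0` part of the inverse comparison. -/
def coneTot₀ : (cone (totMap f)).X₀ ⟶ tot₀ (mappingCone f) :=
  cone.fst₀ (totMap f) ≫ (mapSigmaDesc fun m =>
      up₀ m (m + 1) rfl ((mappingCone.inl f).v (-m) (-(m + 1)) (by omega)) ≫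
        ι₀ (mappingCone f) (m + 1)) +
    cone.snd₀ (totMap f) ≫ (totMap (mappingCone.inr f)).f₀

theorem map_ι₁_inl₀_coneTot₀ (m n : ℤ) (h : m + 1 = n) :
    T.Φ.functor.map (ι₁ F m) ≫ cone.inl₀ (totMap f) ≫ coneTot₀ f =
      up₀ m n h ((mappingCone.inl f).v (-m) (-n) (by omega)) ≫ ι₀ (mappingCone f) n := by
  subst h
  simp only [coneTot₀, Preadditive.comp_add, cone.inl_fst₀_assoc, cone.inl_snd₀_assoc,
    add_zero]
  exact map_ι_mapSigmaDesc _ m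

theorem ι₀_inr₀_coneTot₀ (n : ℤ) :
    ι₀ G n ≫ cone.inr₀ (totMap f) ≫ coneTot₀ f =
      ((shiftZ T n).map ((mappingCone.inr f).f (-n))).f₀ ≫ ι₀ (mappingCone f) n := by
  simp only [coneTot₀, Preadditive.comp_add, cone.inr_fst₀_assoc, cone.inr_snd₀_assoc, ι₀_totMap,
    zero_add]

/-- On each summand this is the decomposition `fst ≫ inl + snd ≫ inr = 𝟙` of the mapping cone,
carried through the shift. -/
theorem totCone₁_coneTot₁ : totCone₁ f ≫ coneTot₁ f = 𝟙 _ := by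
  refine Limits.Sigma.hom_ext _ _ fun n => ?_
  have := congrArg (fun k => ((shiftZ T n).map k).f₁)
    (mappingCone.id_X f (-n) (-(n - 1)) (by omega))
  rw [reassoc_of% (ι₁_totCone₁ f (n - 1) n (by omega))]
  rw [Preadditive.add_comp, Category.assoc, Category.assoc, Category.assoc, Category.assoc,
    ι₀_inl₁_coneTot₁ f (n - 1) n (by omega), ι₁_inr₁_coneTot₁, ← Category.assoc, down₁_up₁,
    ← comp_f₁_assoc, ← Functor.map_comp, ← Preadditive.add_comp, ← add_f₁, ← Functor.map_add, this]
  simp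

theorem totCone₀_coneTot₀ : totCone₀ f ≫ coneTot₀ f = 𝟙 _ := by
  refine Limits.Sigma.hom_ext _ _ fun n => ?_
  have := congrArg (fun k => ((shiftZ T n).map k).f₀)
    (mappingCone.id_X f (-n) (-(n - 1)) (by omega))
  rw [reassoc_of% (ι₀_totCone₀ f (n - 1) n (by omega))]
  rw [Preadditive.add_comp, Category.assoc, Category.assoc, Category.assoc, Category.assoc,
    map_ι₁_inl₀_coneTot₀ f (n - 1) n (by omega), ι₀_inr₀_coneTot₀, ← Category.assoc, down₀_up₀,
    ← comp_f₀_assoc, ← Functor.map_comp, ← Preadditive.add_comp, ← add_f₀, ← Functor.map_add, this]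
  simp

theorem coneTot₁_totCone₁ : coneTot₁ f ≫ totCone₁ f = 𝟙 _ := by
  apply cone.ext_from₁
  · refine Limits.Sigma.hom_ext _ _ fun m => ?_
    rw [reassoc_of% (ι₀_inl₁_coneTot₁ f m (m + 1) rfl), ι₁_totCone₁ f m (m + 1) rfl,
      Preadditive.comp_add, ← Category.assoc, up₁_down₁, up₁, Category.assoc, ← comp_f₁_assoc,
      ← Functor.map_comp]
    simp
  · refine Limits.Sigma.hom_ext _ _ fun n => ?_
    rw [reassoc_of% (ι₁_inr₁_coneTot₁ f n), ι₁_totCone₁ f (n - 1) n (by omega),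
      Preadditive.comp_add, ← Category.assoc, map_down₁, ← comp_f₁_assoc, ← Functor.map_comp]
    simp [down₁_zero]

theorem coneTot₀_totCone₀ : coneTot₀ f ≫ totCone₀ f = 𝟙 _ := by
  apply cone.ext_from₀
  · refine mapSigma_hom_ext fun m => ?_
    rw [reassoc_of% (map_ι₁_inl₀_coneTot₀ f m (m + 1) rfl), ι₀_totCone₀ f m (m + 1) rfl,
      Preadditive.comp_add, ← Category.assoc, up₀_down₀, up₀, Category.assoc, ← comp_f₀_assoc,
      ← Functor.map_comp]
    simp
  · refine Limits.Sigma.hom_ext _ _ fun n => ?_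
    rw [reassoc_of% (ι₀_inr₀_coneTot₀ f n), ι₀_totCone₀ f (n - 1) n (by omega),
      Preadditive.comp_add, ← Category.assoc, map_down₀, ← comp_f₀_assoc, ← Functor.map_comp]
    simp [down₀_zero]

theorem g₁_eq (X : CochainComplex (Factorization T) ℤ) (n : ℤ) :
    g₁ X n = down₁ (n - 1) n (by omega) (X.d (-n) (-(n - 1))) := rfl

theorem g₀_eq (X : CochainComplex (Factorization T) ℤ) (n : ℤ) :
    g₀ X n = down₀ (n - 1) n (by omega) (X.d (-n) (-(n - 1))) := rfl

theorem down₁_down₀ (l m n : ℤ) (h : l + 1 = m) (h' : m + 1 = n) {E E' E'' : Factorization T}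
    (a : E ⟶ E') (b : E' ⟶ E'') :
    down₁ m n h' a ≫ down₀ l m h b = down₁ m n h' (a ≫ b) ≫ down₀ l m h (𝟙 _) := by
  rw [← down₁_map m n h' a b, Category.assoc, map_down₀, Category.comp_id]

theorem down₀_down₁ (l m n : ℤ) (h : l + 1 = m) (h' : m + 1 = n) {E E' E'' : Factorization T}
    (a : E ⟶ E') (b : E' ⟶ E'') :
    down₀ m n h' a ≫ T.Φ.functor.map (down₁ l m h b) =
      down₀ m n h' (a ≫ b) ≫ T.Φ.functor.map (down₁ l m h (𝟙 _)) := by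
  rw [← down₀_map m n h' a b, Category.assoc, ← Functor.map_comp, map_down₁, Category.comp_id]

set_option maxHeartbeats 1000000 in
/-- The comparison of the totalization of a mapping cone with the cone of the totalization. -/
@[simps]
def totCone : tot (mappingCone f) ⟶ cone (totMap f) where
  f₁ := totCone₁ f
  f₀ := totCone₀ f
  comm₁ := by
    refine Limits.Sigma.hom_ext _ _ fun n => ?_
    have h₁ := mappingCone.d_fst_v f (-n) (-(n - 1)) (-(n - 1 - 1)) (by omega) (by omega)
    have h₂ := mappingCone.d_snd_v f (-n) (-(n - 1)) (by omega)
    -- Four kinds of terms are compared: `e₁` and `e₂` treat the structure maps of the shifted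
    -- summands, `e₃` the part `-d_F` of the mapping cone differential and `e₄` its part `f + d_G`.
    -- The signs in `e₁` and `e₃` match the sign of `E[1]` in the cone of a morphism of
    -- factorizations.
    have e₁ := d₁_down₀ (n - 1) n (by omega) ((mappingCone.fst f).1.v (-n) (-(n - 1)) (by omega))
    have e₂ := ((shiftZ T n).map ((mappingCone.snd f).v (-n) (-n) (by omega))).comm₁
    have e₃ : g₁ (mappingCone f) n ≫ down₀ (n - 1 - 1) (n - 1) (by omega)
        ((mappingCone.fst f).1.v (-(n - 1)) (-(n - 1 - 1)) (by omega)) =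
        -(down₁ (n - 1) n (by omega) ((mappingCone.fst f).1.v (-n) (-(n - 1)) (by omega)) ≫
          g₀ F (n - 1)) := by
      rw [g₁_eq, g₀_eq, down₁_down₀, h₁, down₁_neg, Preadditive.neg_comp, ← down₁_down₀]
    have e₄ : g₁ (mappingCone f) n ≫ ((shiftZ T (n - 1)).map
        ((mappingCone.snd f).v (-(n - 1)) (-(n - 1)) (by omega))).f₀ =
        down₁ (n - 1) n (by omega) ((mappingCone.fst f).1.v (-n) (-(n - 1)) (by omega)) ≫
          ((shiftZ T (n - 1)).map (f.f (-(n - 1)))).f₀ +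
        ((shiftZ T n).map ((mappingCone.snd f).v (-n) (-n) (by omega))).f₁ ≫ g₁ G n := by
      rw [g₁_eq, g₁_eq, down₁_map, down₁_map, map_down₁, h₂, down₁_add]
    rw [reassoc_of% (ι₁_totCone₁ f (n - 1) n (by omega)), ι₁_totd₁_assoc, Preadditive.add_comp,
      Preadditive.add_comp, Category.assoc, Category.assoc, Category.assoc, Category.assoc,
      Category.assoc, Category.assoc, ι₀_totCone₀ f (n - 1) n (by omega),
      ι₀_totCone₀ f (n - 1 - 1) (n - 1) (by omega), cone.inl₁_d₁, cone.inr₁_d₁,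
      Preadditive.comp_add _ _ _ (ι₀ F (n - 1)), Preadditive.comp_neg, ι₀_totMap_assoc]
    -- The structure map of `tot G` is `totd₁ G` by definition; displaying it makes the summandwise
    -- formula applicable.
    change _ + _ ≫ ι₁ G n ≫ totd₁ G ≫ _ = _
    change _ ≫ (-(ι₀ F (n - 1) ≫ totd₀ F ≫ _) + _) + _ = _
    rw [ι₁_totd₁_assoc, ι₀_totd₀_assoc]
    simp only [Preadditive.comp_add, Preadditive.add_comp, Preadditive.comp_neg, Category.assoc,
      reassoc_of% e₁, ← reassoc_of% e₂, reassoc_of% e₃, reassoc_of% e₄, Preadditive.neg_comp]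
    abel
  comm₀ := by
    refine Limits.Sigma.hom_ext _ _ fun n => ?_
    have h₁ := mappingCone.d_fst_v f (-n) (-(n - 1)) (-(n - 1 - 1)) (by omega) (by omega)
    have h₂ := mappingCone.d_snd_v f (-n) (-(n - 1)) (by omega)
    have e₁ := d₀_down₁ (n - 1) n (by omega) ((mappingCone.fst f).1.v (-n) (-(n - 1)) (by omega))
    have e₂ := ((shiftZ T n).map ((mappingCone.snd f).v (-n) (-n) (by omega))).comm₀
    have e₃ : g₀ (mappingCone f) n ≫ T.Φ.functor.map (down₁ (n - 1 - 1) (n - 1) (by omega)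
        ((mappingCone.fst f).1.v (-(n - 1)) (-(n - 1 - 1)) (by omega))) =
        -(down₀ (n - 1) n (by omega) ((mappingCone.fst f).1.v (-n) (-(n - 1)) (by omega)) ≫
          T.Φ.functor.map (g₁ F (n - 1))) := by
      rw [g₀_eq, g₁_eq, down₀_down₁, h₁, down₀_neg, Preadditive.neg_comp, ← down₀_down₁]
    have e₄ : g₀ (mappingCone f) n ≫ T.Φ.functor.map ((shiftZ T (n - 1)).map
        ((mappingCone.snd f).v (-(n - 1)) (-(n - 1)) (by omega))).f₁ =
        down₀ (n - 1) n (by omega) ((mappingCone.fst f).1.v (-n) (-(n - 1)) (by omega)) ≫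
          T.Φ.functor.map ((shiftZ T (n - 1)).map (f.f (-(n - 1)))).f₁ +
        ((shiftZ T n).map ((mappingCone.snd f).v (-n) (-n) (by omega))).f₀ ≫ g₀ G n := by
      rw [g₀_eq, g₀_eq, down₀_map, down₀_map, map_down₀, h₂, down₀_add]
    have e₅ := congrArg T.Φ.functor.map (ι₁_totd₁ F (n - 1))
    have e₆ := congrArg T.Φ.functor.map (ι₁_totMap f (n - 1))
    simp only [Functor.map_comp, Functor.map_add] at e₅ e₆
    rw [reassoc_of% (ι₀_totCone₀ f (n - 1) n (by omega)), ι₀_totd₀_assoc, Preadditive.add_comp,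
      Preadditive.add_comp, Category.assoc, Category.assoc, Category.assoc, Category.assoc,
      Category.assoc, Category.assoc, ← Functor.map_comp, ← Functor.map_comp,
      ι₁_totCone₁ f (n - 1) n (by omega),
      ι₁_totCone₁ f (n - 1 - 1) (n - 1) (by omega), cone.inl₀_d₀, cone.inr₀_d₀,
      Preadditive.comp_add _ _ _ (T.Φ.functor.map (ι₁ F (n - 1))), Preadditive.comp_neg, reassoc_of% e₆]
    change _ + _ ≫ ι₀ G n ≫ totd₀ G ≫ _ = _
    change _ ≫ (-(T.Φ.functor.map (ι₁ F (n - 1)) ≫ T.Φ.functor.map (totd₁ F) ≫ _) + _) + _ = _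
    rw [ι₀_totd₀_assoc, reassoc_of% e₅]
    simp only [Preadditive.comp_add, Preadditive.add_comp, Preadditive.comp_neg, Category.assoc,
      Functor.map_add, Functor.map_comp,
      reassoc_of% e₁, ← reassoc_of% e₂, reassoc_of% e₃, reassoc_of% e₄, Preadditive.neg_comp]
    abel

/-- The totalization of a mapping cone is the cone of the totalization. -/
def totConeIso : tot (mappingCone f) ≅ cone (totMap f) :=
  isoMk (totCone f) ⟨totCone₁ f, coneTot₁ f, totCone₁_coneTot₁ f, coneTot₁_totCone₁ f⟩
    ⟨totCone₀ f, coneTot₀ f, totCone₀_coneTot₀ f, coneTot₀_totCone₀ f⟩ rfl rfl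

end

end Factorization

end

/-! ### Exact mapping cones and short exact sequences of factorizations -/

section

/-- Read off from the distinguished triangle of `f` in the homotopy category, whose
quasi-isomorphisms are the maps with acyclic third vertex. -/
theorem acyclic_mappingCone {F G : CochainComplex A ℤ} (f : F ⟶ G) [hf : QuasiIso f] :
    (CochainComplex.mappingCone f).Acyclic := by
  rw [← HomotopyCategory.quotient_obj_mem_subcategoryAcyclic_iff_acyclic]
  have := (HomotopyCategory.quotient_map_mem_quasiIso_iff f).2 hf
  rw [HomotopyCategory.quasiIso_eq_trW_subcategoryAcyclic] at this
  exact ((HomotopyCategory.subcategoryAcyclic A).trW_iff_of_distinguished _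
    (HomotopyCategory.mappingCone_triangleh_distinguished f)).1 this

theorem acyclic_of_iso {F G : CochainComplex A ℤ} (e : F ≅ G) (h : F.Acyclic) : G.Acyclic :=
  fun i => HomologicalComplex.ExactAt.of_iso (h i) e

theorem isIso_sigmaι {J : Type*} (X : J → A) [HasCoproduct X] (j : J)
    (h : ∀ i, i ≠ j → IsZero (X i)) : IsIso (Limits.Sigma.ι X j) := by
  classical
  refine ⟨Limits.Sigma.desc fun i => if hi : i = j then eqToHom (by rw [hi]) else 0, by simp, ?_⟩
  refine Limits.Sigma.hom_ext _ _ fun i => ?_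
  by_cases hi : i = j
  · subst hi
    simp
  · exact (h i hi).eq_of_src _ _

namespace Factorization

open CochainComplex

/-- Exactness is tested on components, and the additive functors `ev₁` and `ev₀` commute with
mapping cones. -/
theorem isExact_mappingCone {F G : CochainComplex (Factorization T) ℤ} (f : F ⟶ G)
    (h₁ : QuasiIso (((ev₁ T).mapHomologicalComplex (.up ℤ)).map f))
    (h₀ : QuasiIso (((ev₀ T).mapHomologicalComplex (.up ℤ)).map f)) : IsExact (mappingCone f) where
  acyclic₁ := acyclic_of_iso (mappingCone.mapHomologicalComplexIso f (ev₁ T)).symm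
    (acyclic_mappingCone _)
  acyclic₀ := acyclic_of_iso (mappingCone.mapHomologicalComplexIso f (ev₀ T)).symm
    (acyclic_mappingCone _)

/-- A factorization as a complex concentrated in degree `0`. -/
abbrev single (E : Factorization T) : CochainComplex (Factorization T) ℤ :=
  (HomologicalComplex.single (Factorization T) (.up ℤ) 0).obj E

/-- Functoriality of `single`. -/
abbrev singleMap {E F : Factorization T} (f : E ⟶ F) : single E ⟶ single F :=
  (HomologicalComplex.single (Factorization T) (.up ℤ) 0).map f

instance (E : Factorization T) : IsBdd (single E) where
  bounded := ⟨0, 0, fun _ _ => HomologicalComplex.isZero_single_obj_X _ _ _ _ (by omega)⟩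

/-- The totalization of a complex concentrated in degree `0`. -/
@[simps]
def toTotSingle (E : Factorization T) : (shiftZ T 0).obj E ⟶ tot (single E) where
  -- The summand of index `n` comes from degree `-n`, so index `0` involves degree `-0`, which this
  -- isomorphism identifies with `0`.
  f₁ := ((shiftZ T 0).map (HomologicalComplex.singleObjXIsoOfEq (.up ℤ) 0 E (-0) rfl).inv).f₁ ≫
    ι₁ (single E) 0
  f₀ := ((shiftZ T 0).map (HomologicalComplex.singleObjXIsoOfEq (.up ℤ) 0 E (-0) rfl).inv).f₀ ≫
    ι₀ (single E) 0
  comm₁ := by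
    rw [Category.assoc]
    refine (congrArg _ (ι₁_totd₁ (single E) 0)).trans ?_
    simp only [g₁_eq, HomologicalComplex.single_obj_d, down₁_zero, zero_comp, add_zero]
    rw [Hom.comm₁_assoc]
  comm₀ := by
    rw [Category.assoc]
    refine (congrArg _ (ι₀_totd₀ (single E) 0)).trans ?_
    simp only [g₀_eq, HomologicalComplex.single_obj_d, down₀_zero, zero_comp, add_zero]
    rw [Hom.comm₀_assoc, Functor.map_comp]

theorem isZero_shiftZ_single (E : Factorization T) (n : ℤ) (hn : n ≠ 0) :
    IsZero ((shiftZ T n).obj ((single E).X (-n))) :=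
  (shiftZ T n).map_isZero (HomologicalComplex.isZero_single_obj_X _ _ _ _ (by omega))

theorem isIso_ι₁_single (E : Factorization T) : IsIso (ι₁ (single E) 0) :=
  isIso_sigmaι _ _ fun n hn => (ev₁ T).map_isZero (isZero_shiftZ_single E n hn)

theorem isIso_ι₀_single (E : Factorization T) : IsIso (ι₀ (single E) 0) :=
  isIso_sigmaι _ _ fun n hn => (ev₀ T).map_isZero (isZero_shiftZ_single E n hn)

/-- The totalization of a complex concentrated in degree `0`. -/
def totSingleIso (E : Factorization T) : (shiftZ T 0).obj E ≅ tot (single E) :=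
  isoMk (toTotSingle E)
    ((shiftZ T 0 ⋙ ev₁ T).mapIso (HomologicalComplex.singleObjXIsoOfEq (.up ℤ) 0 E (-0) rfl).symm ≪≫
      @asIso _ _ _ _ (ι₁ (single E) 0) (isIso_ι₁_single E))
    ((shiftZ T 0 ⋙ ev₀ T).mapIso (HomologicalComplex.singleObjXIsoOfEq (.up ℤ) 0 E (-0) rfl).symm ≪≫
      @asIso _ _ _ _ (ι₀ (single E) 0) (isIso_ι₀_single E)) rfl rfl

theorem toTotSingle_naturality {E F : Factorization T} (f : E ⟶ F) :
    (shiftZ T 0).map f ≫ toTotSingle F = toTotSingle E ≫ totMap (singleMap f) := by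
  have h : f ≫ (HomologicalComplex.singleObjXIsoOfEq (.up ℤ) 0 F (-0) rfl).inv =
    (HomologicalComplex.singleObjXIsoOfEq (.up ℤ) 0 E (-0) rfl).inv ≫ (singleMap f).f (-0) := by
    rw [← cancel_epi (HomologicalComplex.singleObjXIsoOfEq (.up ℤ) 0 E (-0) rfl).hom]
    simp only [Iso.hom_inv_id_assoc]
    exact (HomologicalComplex.single_map_f_self (c := .up ℤ) 0 f).symm
  ext
  · have h₁ := congrArg (fun k => ((shiftZ T 0).map k).f₁) h
    simp only [Functor.map_comp, comp_f₁] at h₁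
    simp only [comp_f₁, toTotSingle_f₁, Category.assoc]
    rw [ι₁_totMap, ← reassoc_of% h₁]
  · have h₁ := congrArg (fun k => ((shiftZ T 0).map k).f₀) h
    simp only [Functor.map_comp, comp_f₀] at h₁
    simp only [comp_f₀, toTotSingle_f₀, Category.assoc]
    rw [ι₀_totMap, ← reassoc_of% h₁]

section

variable {X Y Z : Factorization T} (f : X ⟶ Y) (h : Y ⟶ Z) (w : f ≫ h = 0)

/-- The morphism from the mapping cone of `X ⟶ Y` to `Z`. -/
abbrev singleDesc : mappingCone (singleMap f) ⟶ single Z :=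
  mappingCone.desc (singleMap f) 0 (singleMap h) (by simp [← Functor.map_comp, w])

/-- The degreewise identity needed in `quasiIso_map_singleDesc`: of the two terms decomposing the
mapping cone, the projection to the target kills the one through `inl` and keeps the one through
`inr`. -/
theorem comp_add_comp_of_eq {U V V' W W' : A} (a : U ⟶ V) (b : V ⟶ V') (c : U ⟶ W) (d : W ⟶ V')
    (e : V' ⟶ W) (k : W ⟶ W') (hbe : b ≫ e = 0) (hde : d ≫ e = 𝟙 W) :
    (a ≫ b + c ≫ d) ≫ e ≫ k = c ≫ k := by
  rw [Preadditive.add_comp, Category.assoc, Category.assoc, reassoc_of% hbe, reassoc_of% hde,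
    zero_comp, comp_zero, zero_add]

/-- For a short exact sequence of complexes the mapping cone of the first map is quasi-isomorphic to
the third term. Here the complexes sit in degree `0`, and `H`, later a component functor, commutes
with both `single` and mapping cones. -/
theorem quasiIso_map_singleDesc (H : Factorization T ⥤ A) [H.Additive]
    (hS : (ShortComplex.mk (H.map f) (H.map h) (by rw [← H.map_comp, w, H.map_zero])).ShortExact) :
    QuasiIso ((H.mapHomologicalComplex (.up ℤ)).map (singleDesc f h w)) := by
  let S : ShortComplex (CochainComplex A ℤ) :=
    .mk ((H.mapHomologicalComplex (.up ℤ)).map (singleMap f))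
      ((H.mapHomologicalComplex (.up ℤ)).map (singleMap h))
      (by rw [← Functor.map_comp, ← Functor.map_comp, w, Functor.map_zero, Functor.map_zero])
  have hS' : S.ShortExact := by
    have := hS.map_of_exact (HomologicalComplex.single A (.up ℤ) 0)
    let e := HomologicalComplex.singleMapHomologicalComplex H (.up ℤ) 0
    exact ShortComplex.shortExact_of_iso (ShortComplex.isoMk (e.symm.app X) (e.symm.app Y)
      (e.symm.app Z) (e.inv.naturality f).symm (e.inv.naturality h).symm) this
  have := mappingCone.quasiIso_descShortComplex hS'
  have e : (H.mapHomologicalComplex (.up ℤ)).map (singleDesc f h w) =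
      (mappingCone.mapHomologicalComplexIso _ _).hom ≫ mappingCone.descShortComplex S := by
    ext n
    simp [mappingCone.mapHomologicalComplexIso, mappingCone.descShortComplex,
      mappingCone.mapHomologicalComplexXIso, mappingCone.mapHomologicalComplexXIso'_hom,
      mappingCone.desc_f _ _ _ _ n (n + 1) rfl, S]
    exact (comp_add_comp_of_eq _ _ _ _ _ _ (mappingCone.inl_v_snd_v
      ((H.mapHomologicalComplex (.up ℤ)).map (singleMap f)) _ _ _)
      (mappingCone.inr_f_snd_v ((H.mapHomologicalComplex (.up ℤ)).map (singleMap f)) _)).symm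
  rw [e]
  infer_instance

include w in
theorem shiftZ_map_comp_eq_zero (n : ℤ) : (shiftZ T n).map f ≫ (shiftZ T n).map h = 0 := by
  rw [← Functor.map_comp, w, Functor.map_zero]

/-- Identifies `coneTo` with the totalization of `singleDesc`, so that the cone of `coneTo` is
compared with the totalization of an exact mapping cone. -/
theorem coneTo_comp_toTotSingle :
    coneTo _ _ (shiftZ_map_comp_eq_zero f h w 0) ≫ toTotSingle Z =
      coneMap (toTotSingle X) (toTotSingle Y) (toTotSingle_naturality f) ≫
        (totConeIso (singleMap f)).inv ≫ totMap (singleDesc f h w) := by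
  have H₁ := congrArg Hom.f₁ (toTotSingle_naturality h)
  have H₀ := congrArg Hom.f₀ (toTotSingle_naturality h)
  simp only [comp_f₁, comp_f₀] at H₁ H₀
  ext
  · change _ = (coneMap (toTotSingle X) (toTotSingle Y) (toTotSingle_naturality f)).f₁ ≫ coneTot₁ (singleMap f) ≫ _
    have h₁ : cone.inr₁ (totMap (singleMap f)) ≫ coneTot₁ (singleMap f) =
        (totMap (mappingCone.inr (singleMap f))).f₁ := by
      simp only [coneTot₁, Preadditive.comp_add, cone.inr_fst₁_assoc, cone.inr_snd₁_assoc, zero_add]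
    have h₂ : (totMap (mappingCone.inr (singleMap f))).f₁ ≫ (totMap (singleDesc f h w)).f₁ =
        (totMap (singleMap h)).f₁ := by
      rw [← comp_f₁, ← totMap_comp, mappingCone.inr_desc]
    apply cone.ext_from₁
    · simp only [comp_f₁, cone.desc_f₁, coneMap_f₁, Preadditive.comp_add, Preadditive.add_comp,
        Category.assoc, cone.inl_fst₁_assoc, cone.inl_snd₁_assoc, zero_comp, add_zero]
      rw [toTotSingle_f₀, Category.assoc, reassoc_of% (ι₀_inl₁_coneTot₁ (singleMap f) 0 1 rfl), ι₁_totMap,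
        ← Category.assoc (up₁ _ _ _ _), up₁_map, mappingCone.inl_v_desc_f]
      simp [up₁]
    · simp only [comp_f₁, cone.desc_f₁, coneMap_f₁, Preadditive.comp_add, Preadditive.add_comp,
        Category.assoc, cone.inr_fst₁_assoc, cone.inr_snd₁_assoc, zero_comp, zero_add,
        reassoc_of% h₁, h₂, H₁]
  · change _ = (coneMap (toTotSingle X) (toTotSingle Y) (toTotSingle_naturality f)).f₀ ≫ coneTot₀ (singleMap f) ≫ _
    have h₁ : cone.inr₀ (totMap (singleMap f)) ≫ coneTot₀ (singleMap f) =
        (totMap (mappingCone.inr (singleMap f))).f₀ := by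
      simp only [coneTot₀, Preadditive.comp_add, cone.inr_fst₀_assoc, cone.inr_snd₀_assoc, zero_add]
    have h₂ : (totMap (mappingCone.inr (singleMap f))).f₀ ≫ (totMap (singleDesc f h w)).f₀ =
        (totMap (singleMap h)).f₀ := by
      rw [← comp_f₀, ← totMap_comp, mappingCone.inr_desc]
    apply cone.ext_from₀
    · simp only [comp_f₀, cone.desc_f₀, coneMap_f₀, Preadditive.comp_add, Preadditive.add_comp,
        Category.assoc, cone.inl_fst₀_assoc, cone.inl_snd₀_assoc, zero_comp, add_zero]
      rw [toTotSingle_f₁, Functor.map_comp, Category.assoc,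
        reassoc_of% (map_ι₁_inl₀_coneTot₀ (singleMap f) 0 1 rfl), ι₀_totMap,
        ← Category.assoc (up₀ _ _ _ _), up₀_map, mappingCone.inl_v_desc_f]
      simp [up₀]
    · simp only [comp_f₀, cone.desc_f₀, coneMap_f₀, Preadditive.comp_add, Preadditive.add_comp,
        Category.assoc, cone.inr_fst₀_assoc, cone.inr_snd₀_assoc, zero_comp, zero_add,
        reassoc_of% h₁, h₂, H₀]

end

end Factorization

open CochainComplex

namespace IsThick

variable {N : ObjectProperty (K T)} (hN : IsThick N) (hN' : ContainsExactTotalizations N)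
include hN hN'

/-- The mapping cone of a componentwise quasi-isomorphism is exact, and its totalization is the cone
of the totalized map. This is how acyclicity of cones is obtained from exact totalizations. -/
theorem cone_totMap {F G : CochainComplex (Factorization T) ℤ} [IsBdd F] [IsBdd G] (f : F ⟶ G)
    (h₁ : QuasiIso (((ev₁ T).mapHomologicalComplex (.up ℤ)).map f))
    (h₀ : QuasiIso (((ev₀ T).mapHomologicalComplex (.up ℤ)).map f)) :
    N ((K.of T).obj (Factorization.cone (totMap f))) :=
  hN.of_iso (totConeIso f) (hN' _ (isExact_mappingCone f h₁ h₀))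

/-- For a componentwise exact sequence `0 ⟶ X ⟶ Y ⟶ Z ⟶ 0`, the cone of `cone (X ⟶ Y) ⟶ Z` is
in `N`. -/
theorem cone_coneTo {X Y Z : Factorization T} (f : X ⟶ Y) (h : Y ⟶ Z) (w : f ≫ h = 0)
    (h₁ : (ShortComplex.mk f.f₁ h.f₁ (congrArg Hom.f₁ w)).ShortExact)
    (h₀ : (ShortComplex.mk f.f₀ h.f₀ (congrArg Hom.f₀ w)).ShortExact) :
    N ((K.of T).obj (Factorization.cone (coneTo f h w))) := by
  -- `shiftZ T 0` is the identity functor by definition, so the cone built from the maps shifted by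
  -- `[0]` is the one in the goal.
  refine hN.of_iso (coneMapIso (g := coneTo _ _ (shiftZ_map_comp_eq_zero f h w 0))
    (coneMapIso (totSingleIso X) (totSingleIso Y) (toTotSingle_naturality f) ≪≫
      (totConeIso (singleMap f)).symm) (totSingleIso Z) ?_).symm
    (hN.cone_totMap hN' (singleDesc f h w)
      (quasiIso_map_singleDesc f h w (ev₁ T) h₁) (quasiIso_map_singleDesc f h w (ev₀ T) h₀))
  exact (coneTo_comp_toTotSingle f h w).trans (Category.assoc _ _ _).symm

end IsThick

end

section

namespace Factorization

/-! ### Null-homotopic morphisms from homotopies -/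

/-- The morphism which is homotopic to zero by `s` and `t`. -/
def boundary {E F : Factorization T} (s : T.Φ.functor.obj E.X₁ ⟶ F.X₀) (t : E.X₀ ⟶ F.X₁) : E ⟶ F where
  f₁ := T.Φ.functor.preimage (T.Φ.functor.map E.d₁ ≫ T.Φ.functor.map t + s ≫ F.d₀)
  f₀ := t ≫ F.d₁ + E.d₀ ≫ s
  comm₁ := by
    apply T.Φ.functor.map_injective
    -- Naturality of `w` at `s` involves `w` at `Φ E₁`; the condition `w_{Φ X} = Φ (w_X)` turns it
    -- into `Φ (d₁ ≫ d₀)`, which is what makes the boundary commute with the structure maps.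
    have h := T.w_nat s
    rw [T.w_map, ← E.d₁_d₀, Functor.map_comp, Category.assoc] at h
    simp only [Functor.map_comp, Functor.map_preimage, Functor.map_add, Preadditive.comp_add,
      Preadditive.add_comp, Category.assoc, d₀_d₁, h]
  comm₀ := by
    simp only [Functor.map_preimage, Preadditive.comp_add, Preadditive.add_comp, Category.assoc,
      d₁_d₀, d₀_d₁_assoc, T.w_nat]

theorem boundary_isNullBy {E F : Factorization T} (s : T.Φ.functor.obj E.X₁ ⟶ F.X₀)
    (t : E.X₀ ⟶ F.X₁) : IsNullBy (boundary s t) s t where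
  eq₁ := by simp [boundary]
  eq₀ := rfl

/-! ### Projections from the totalization -/

section

open Classical in
/-- The projection from a coproduct to a summand. -/
def sigmaπ {J : Type*} (X : J → A) [HasCoproduct X] (j : J) : ∐ X ⟶ X j :=
  Limits.Sigma.desc fun i => if hi : i = j then eqToHom (by rw [hi]) else 0

theorem sigmaι_π {J : Type*} (X : J → A) [HasCoproduct X] (j : J) :
    Limits.Sigma.ι X j ≫ sigmaπ X j = 𝟙 _ := by
  simp [sigmaπ]

theorem sigmaι_π_of_ne {J : Type*} (X : J → A) [HasCoproduct X] {i j : J} (h : i ≠ j) :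
    Limits.Sigma.ι X i ≫ sigmaπ X j = 0 := by
  simp [sigmaπ, h]

/-- A coproduct with finitely many nonzero terms is a finite biproduct: the identity is the sum of
the `π ≫ ι` over those terms, so the projections are jointly monic. -/
theorem sigma_hom_ext' {J : Type*} (X : J → A) [HasCoproduct X] (hX : {i | ¬ IsZero (X i)}.Finite)
    {Z : A} (f g : Z ⟶ ∐ X) (h : ∀ j, f ≫ sigmaπ X j = g ≫ sigmaπ X j) : f = g := by
  have : ∑ j ∈ hX.toFinset, sigmaπ X j ≫ Limits.Sigma.ι X j = 𝟙 (∐ X) := by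
    refine Limits.Sigma.hom_ext _ _ fun i => ?_
    by_cases hi : IsZero (X i)
    · exact hi.eq_of_src _ _
    · rw [Preadditive.comp_sum, Finset.sum_eq_single i, ← Category.assoc, sigmaι_π]
      · simp
      · intro j _ hj
        rw [← Category.assoc, sigmaι_π_of_ne X hj.symm, zero_comp]
      · intro h
        simp [hi] at h
  rw [← Category.comp_id f, ← Category.comp_id g, ← this, Preadditive.comp_sum,
    Preadditive.comp_sum]
  exact Finset.sum_congr rfl fun j _ => by rw [reassoc_of% h j]

end

section

variable (X : CochainComplex (Factorization T) ℤ) [IsBdd X]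

/-- The projection to a summand of the totalization in degree `-1`. -/
def π₁ (n : ℤ) : tot₁ X ⟶ ((shiftZ T n).obj (X.X (-n))).X₁ :=
  sigmaπ (fun n : ℤ => ((shiftZ T n).obj (X.X (-n))).X₁) n

/-- The projection to a summand of the totalization in degree `0`. -/
def π₀ (n : ℤ) : tot₀ X ⟶ ((shiftZ T n).obj (X.X (-n))).X₀ :=
  sigmaπ (fun n : ℤ => ((shiftZ T n).obj (X.X (-n))).X₀) n

theorem ι₁_π₁ (n : ℤ) : ι₁ X n ≫ π₁ X n = 𝟙 _ := sigmaι_π _ n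
theorem ι₀_π₀ (n : ℤ) : ι₀ X n ≫ π₀ X n = 𝟙 _ := sigmaι_π _ n
theorem ι₁_π₁_of_ne {m n : ℤ} (h : m ≠ n) : ι₁ X m ≫ π₁ X n = 0 := sigmaι_π_of_ne _ h
theorem ι₀_π₀_of_ne {m n : ℤ} (h : m ≠ n) : ι₀ X m ≫ π₀ X n = 0 := sigmaι_π_of_ne _ h

theorem ι₁_totd₁' (m n : ℤ) (h : m + 1 = n) : ι₁ X n ≫ totd₁ X =
    ((shiftZ T n).obj (X.X (-n))).d₁ ≫ ι₀ X n + down₁ m n h (X.d (-n) (-m)) ≫ ι₀ X m := by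
  obtain rfl : m = n - 1 := by omega
  exact ι₁_totd₁ X n

theorem ι₀_totd₀' (m n : ℤ) (h : m + 1 = n) : ι₀ X n ≫ totd₀ X =
    ((shiftZ T n).obj (X.X (-n))).d₀ ≫ T.Φ.functor.map (ι₁ X n) +
      down₀ m n h (X.d (-n) (-m)) ≫ T.Φ.functor.map (ι₁ X m) := by
  obtain rfl : m = n - 1 := by omega
  exact ι₀_totd₀ X n

/-- The structure map seen from the target: summand `m` receives the structure map of summand `m`
and the differential of the complex from summand `n = m + 1`. -/
theorem totd₁_π₀ (m n : ℤ) (h : m + 1 = n) : totd₁ X ≫ π₀ X m =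
    π₁ X m ≫ ((shiftZ T m).obj (X.X (-m))).d₁ + π₁ X n ≫ down₁ m n h (X.d (-n) (-m)) := by
  refine Limits.Sigma.hom_ext _ _ fun k => ?_
  have := ι₁_totd₁' X (k - 1) k (by omega)
  change ι₁ X k ≫ _ = ι₁ X k ≫ _
  rw [reassoc_of% this, Preadditive.add_comp, Preadditive.comp_add, Category.assoc, Category.assoc]
  by_cases hk : k = m
  · subst hk
    rw [ι₀_π₀, reassoc_of% (ι₁_π₁ X k), ← Category.assoc (ι₁ X k),
      ι₁_π₁_of_ne X (show k ≠ n by omega), ι₀_π₀_of_ne X (show k - 1 ≠ k by omega)]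
    simp
  · rw [ι₀_π₀_of_ne X hk, ← Category.assoc (ι₁ X k), ι₁_π₁_of_ne X hk, comp_zero, zero_add,
      zero_comp, zero_add]
    by_cases hk' : k = n
    · subst hk'
      obtain rfl : m = k - 1 := by omega
      rw [ι₀_π₀, reassoc_of% (ι₁_π₁ X k), Category.comp_id]
    · rw [ι₀_π₀_of_ne X (show k - 1 ≠ m by omega), ← Category.assoc (ι₁ X k),
        ι₁_π₁_of_ne X hk', zero_comp, comp_zero]

theorem totd₀_π₁ (m n : ℤ) (h : m + 1 = n) : totd₀ X ≫ T.Φ.functor.map (π₁ X m) =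
    π₀ X m ≫ ((shiftZ T m).obj (X.X (-m))).d₀ + π₀ X n ≫ down₀ m n h (X.d (-n) (-m)) := by
  refine Limits.Sigma.hom_ext _ _ fun k => ?_
  have := ι₀_totd₀' X (k - 1) k (by omega)
  change ι₀ X k ≫ _ = ι₀ X k ≫ _
  rw [reassoc_of% this, Preadditive.add_comp, Preadditive.comp_add, Category.assoc, Category.assoc,
    ← Functor.map_comp, ← Functor.map_comp]
  by_cases hk : k = m
  · subst hk
    rw [ι₁_π₁, reassoc_of% (ι₀_π₀ X k), ← Category.assoc (ι₀ X k),
      ι₀_π₀_of_ne X (show k ≠ n by omega), ι₁_π₁_of_ne X (show k - 1 ≠ k by omega)]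
    simp
  · rw [ι₁_π₁_of_ne X hk, ← Category.assoc (ι₀ X k), ι₀_π₀_of_ne X hk, Functor.map_zero, comp_zero,
      zero_add, zero_comp, zero_add]
    by_cases hk' : k = n
    · subst hk'
      obtain rfl : m = k - 1 := by omega
      rw [ι₁_π₁, reassoc_of% (ι₀_π₀ X k), CategoryTheory.Functor.map_id, Category.comp_id]
    · rw [ι₁_π₁_of_ne X (show k - 1 ≠ m by omega), ← Category.assoc (ι₀ X k),
        ι₀_π₀_of_ne X hk', zero_comp, Functor.map_zero, comp_zero]

end

/-! ### Exactness -/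

/-- A shift exchanges the two components and applies `Φ` or its inverse to one of them, which is
exact. Because of the exchange, both components are carried through the induction together. -/
theorem exact_shiftZ (S : ShortComplex (Factorization T)) (h₁ : (S.map (ev₁ T)).Exact)
    (h₀ : (S.map (ev₀ T)).Exact) (n : ℤ) :
    (S.map (shiftZ T n ⋙ ev₁ T)).Exact ∧ (S.map (shiftZ T n ⋙ ev₀ T)).Exact := by
  have i₁ : ∀ k, (shiftNat T k).Additive := shiftNat_additive
  have i₂ : ∀ k, (unshiftNat T k).Additive := unshiftNat_additive
  have e₁ : ∀ k, (S.map (shiftNat T k ⋙ ev₁ T)).Exact ∧ (S.map (shiftNat T k ⋙ ev₀ T)).Exact := by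
    intro k
    induction k with
    | zero => exact ⟨h₁, h₀⟩
    | succ k ih => exact ⟨ih.2, ih.1.map T.Φ.functor⟩
  have e₂ : ∀ k, (S.map (unshiftNat T k ⋙ ev₁ T)).Exact ∧
      (S.map (unshiftNat T k ⋙ ev₀ T)).Exact := by
    intro k
    induction k with
    | zero => exact ⟨h₁, h₀⟩
    | succ k ih => exact ⟨ih.2.map T.Φ.inverse, ih.1⟩
  cases n with
  | ofNat k => exact e₁ k
  | negSucc k => exact e₂ (k + 1)

/-- The nonzero summands have indices in `[N, N + k)`; a natural number as length allows induction
on the number of summands. -/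
theorem IsBdd.exists_isZero_shiftZ (X : CochainComplex (Factorization T) ℤ) [IsBdd X] :
    ∃ (N : ℤ) (k : ℕ), (∀ n, n < N → IsZero ((shiftZ T n).obj (X.X (-n)))) ∧
      ∀ n, N + k ≤ n → IsZero ((shiftZ T n).obj (X.X (-n))) := by
  obtain ⟨a, b, h⟩ := IsBdd.bounded (X := X)
  exact ⟨-b, (b - a + 1).toNat, fun n hn => (shiftZ T n).map_isZero (h _ (by omega)),
    fun n hn => (shiftZ T n).map_isZero (h _ (by omega))⟩

end Factorization

theorem IsExact.exact_shiftZ {X : CochainComplex (Factorization T) ℤ} (hX : IsExact X)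
    (n i j k : ℤ) (hij : i + 1 = j) (hjk : j + 1 = k) :
    ((X.sc' i j k).map (shiftZ T n ⋙ ev₁ T)).Exact ∧
      ((X.sc' i j k).map (shiftZ T n ⋙ ev₀ T)).Exact := by
  apply Factorization.exact_shiftZ
  · exact (HomologicalComplex.exactAt_iff' _ i j k (by simp; omega) (by simp [hjk])).1
      (hX.acyclic₁ j)
  · exact (HomologicalComplex.exactAt_iff' _ i j k (by simp; omega) (by simp [hjk])).1
      (hX.acyclic₀ j)

/-! ### Orthogonality to totalizations of exact complexes -/

section

variable {X : CochainComplex (Factorization T) ℤ}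

/-- A morphism which vanishes on the image of the differential extends along the differential. -/
theorem IsExact.exists_down₀ (hX : IsExact X) (l m n : ℤ) (h : l + 1 = m) (h' : m + 1 = n)
    {J : A} [Injective J] (b : ((shiftZ T m).obj (X.X (-m))).X₀ ⟶ J)
    (hb : down₁ m n h' (X.d (-n) (-m)) ≫ b = 0) :
    ∃ s : T.Φ.functor.obj ((shiftZ T l).obj (X.X (-l))).X₁ ⟶ J,
      down₀ l m h (X.d (-m) (-l)) ≫ s = b := by
  have e := (hX.exact_shiftZ m (-n) (-m) (-l) (by omega) (by omega)).2
  -- Cancelling the `Link` isomorphism leaves the statement that `b` vanishes on the image of the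
  -- differential inside the single shift `[m]`, where exactness applies.
  rw [down₁, ← Link.nat₀', Category.assoc, Preadditive.IsIso.comp_left_eq_zero] at hb
  obtain ⟨u, hu⟩ : ∃ u : ((shiftZ T m).obj (X.X (-l))).X₀ ⟶ J,
    ((shiftZ T m).map (X.d (-m) (-l))).f₀ ≫ u = b := ⟨_, e.comp_descToInjective b hb⟩
  exact ⟨((link T l m h).c₁ _).inv ≫ u, by
    rw [down₀, Category.assoc, Iso.hom_inv_id_assoc, hu]⟩

/-- A morphism which vanishes on the image of the differential extends along the differential. -/
theorem IsExact.exists_down₁ (hX : IsExact X) (l m n : ℤ) (h : l + 1 = m) (h' : m + 1 = n)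
    {J : A} [Injective J] (a : ((shiftZ T m).obj (X.X (-m))).X₁ ⟶ J)
    (ha : down₀ m n h' (X.d (-n) (-m)) ≫ T.Φ.functor.map a = 0) :
    ∃ t : ((shiftZ T l).obj (X.X (-l))).X₀ ⟶ J, down₁ l m h (X.d (-m) (-l)) ≫ t = a := by
  have e := (hX.exact_shiftZ m (-n) (-m) (-l) (by omega) (by omega)).1
  rw [down₀, Link.nat₁, Category.assoc, Preadditive.IsIso.comp_left_eq_zero, ← Functor.map_comp,
    Functor.map_eq_zero_iff] at ha
  obtain ⟨u, hu⟩ : ∃ u : ((shiftZ T m).obj (X.X (-l))).X₁ ⟶ J,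
    ((shiftZ T m).map (X.d (-m) (-l))).f₁ ≫ u = a := ⟨_, e.comp_descToInjective a ha⟩
  exact ⟨((link T l m h).c₀ _).hom ≫ u, by
    rw [down₁, Category.assoc, Iso.inv_hom_id_assoc, hu]⟩

/-- A morphism to the kernel of the differential lifts along the differential. -/
theorem IsExact.exists_lift_down₀ (hX : IsExact X) (l m n : ℤ) (h : l + 1 = m) (h' : m + 1 = n)
    {P : A} [Projective P] (a : P ⟶ ((shiftZ T m).obj (X.X (-m))).X₁)
    (ha : a ≫ down₁ l m h (X.d (-m) (-l)) = 0) :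
    ∃ s : T.Φ.functor.obj P ⟶ ((shiftZ T n).obj (X.X (-n))).X₀,
      s ≫ down₀ m n h' (X.d (-n) (-m)) = T.Φ.functor.map a := by
  have e := (hX.exact_shiftZ m (-n) (-m) (-l) (by omega) (by omega)).1
  rw [down₁, ← Category.assoc, Preadditive.IsIso.comp_right_eq_zero] at ha
  obtain ⟨u, hu⟩ : ∃ u : P ⟶ ((shiftZ T m).obj (X.X (-n))).X₁,
    u ≫ ((shiftZ T m).map (X.d (-n) (-m))).f₁ = a := ⟨_, e.liftFromProjective_comp a ha⟩
  exact ⟨T.Φ.functor.map u ≫ ((link T m n h').c₁ _).inv, by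
    rw [down₀, Link.nat₁, Category.assoc, Iso.inv_hom_id_assoc, ← Functor.map_comp, hu]⟩

/-- A morphism to the kernel of the differential lifts along the differential. -/
theorem IsExact.exists_lift_down₁ (hX : IsExact X) (l m n : ℤ) (h : l + 1 = m) (h' : m + 1 = n)
    {P : A} [Projective P] (b : P ⟶ ((shiftZ T m).obj (X.X (-m))).X₀)
    (hb : b ≫ down₀ l m h (X.d (-m) (-l)) = 0) :
    ∃ t : P ⟶ ((shiftZ T n).obj (X.X (-n))).X₁, t ≫ down₁ m n h' (X.d (-n) (-m)) = b := by
  have e := (hX.exact_shiftZ m (-n) (-m) (-l) (by omega) (by omega)).2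
  rw [down₀, ← Category.assoc, Preadditive.IsIso.comp_right_eq_zero] at hb
  obtain ⟨u, hu⟩ : ∃ u : P ⟶ ((shiftZ T m).obj (X.X (-n))).X₀,
    u ≫ ((shiftZ T m).map (X.d (-n) (-m))).f₀ = b := ⟨_, e.liftFromProjective_comp b hb⟩
  exact ⟨u ≫ ((link T m n h').c₀ _).hom, by
    rw [down₁, ← Link.nat₀', Category.assoc, Iso.hom_inv_id_assoc, hu]⟩

theorem tot_hom_ext [IsBdd X] {F : Factorization T} {f g : tot X ⟶ F}
    (h₁ : ∀ n, ι₁ X n ≫ f.f₁ = ι₁ X n ≫ g.f₁) (h₀ : ∀ n, ι₀ X n ≫ f.f₀ = ι₀ X n ≫ g.f₀) : f = g :=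
  hom_ext (Limits.Sigma.hom_ext _ _ h₁) (Limits.Sigma.hom_ext _ _ h₀)

theorem tot_hom_ext' [IsBdd X] {F : Factorization T} {f g : F ⟶ tot X}
    (h₁ : ∀ n, f.f₁ ≫ π₁ X n = g.f₁ ≫ π₁ X n) (h₀ : ∀ n, f.f₀ ≫ π₀ X n = g.f₀ ≫ π₀ X n) :
    f = g := by
  obtain ⟨N, k, h, h'⟩ := IsBdd.exists_isZero_shiftZ X
  have : {i | ¬ IsZero ((shiftZ T i).obj (X.X (-i)))}.Finite := by
    refine (Set.finite_Ico N (N + k)).subset fun i hi => ?_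
    by_contra hi'
    rw [Set.mem_Ico, not_and_or, not_le, not_lt] at hi'
    exact hi (hi'.elim (h i) (h' i))
  exact hom_ext
    (sigma_hom_ext' (fun n : ℤ => ((shiftZ T n).obj (X.X (-n))).X₁) (this.subset fun i hi hi' => hi ((ev₁ T).map_isZero hi')) _ _ h₁)
    (sigma_hom_ext' (fun n : ℤ => ((shiftZ T n).obj (X.X (-n))).X₀) (this.subset fun i hi hi' => hi ((ev₀ T).map_isZero hi')) _ _ h₀)

/-- Morphisms from the totalization of a bounded exact complex to a factorization with injective
components are null-homotopic. -/
theorem null_of_tot [IsBdd X] (hX : IsExact X) {J : Factorization T} (hJ₁ : Injective J.X₁)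
    (hJ₀ : Injective J.X₀) (f : tot X ⟶ J) : Null f := by
  obtain ⟨N, k, h, h'⟩ := IsBdd.exists_isZero_shiftZ X
  -- Induction on the number of summands on which `f` may be nonzero: a null-homotopic morphism is
  -- subtracted so that `f` vanishes on the top one as well.
  have key : ∀ (k : ℕ) (f : tot X ⟶ J), (∀ n, N + k ≤ n → ι₁ X n ≫ f.f₁ = 0 ∧ ι₀ X n ≫ f.f₀ = 0) →
      Null f := by
    intro k
    induction k with
    | zero =>
      intro f hf
      have : f = 0 := by
        apply tot_hom_ext
        · intro n
          by_cases hn : n < N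
          · exact ((ev₁ T).map_isZero (h n hn)).eq_of_src _ _
          · rw [(hf n (by simp; omega)).1]; simp
        · intro n
          by_cases hn : n < N
          · exact ((ev₀ T).map_isZero (h n hn)).eq_of_src _ _
          · rw [(hf n (by simp; omega)).2]; simp
      rw [this]
      exact null_zero _ _
    | succ k ih =>
      intro f hf
      -- `m = N + k` is the highest index where `f` may be nonzero.
      obtain ⟨m, rfl⟩ : ∃ m, N = m - k := ⟨N + k, by omega⟩
      obtain ⟨z₁, z₀⟩ := hf (m + 1) (by push_cast; omega)
      -- As `f` vanishes on summand `m + 1`, its compatibility with the structure maps there says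
      -- that `f` on summand `m` kills the image of the differential of `X`.
      have c₁ := congrArg (fun g => ι₁ X (m + 1) ≫ g) f.comm₁
      have c₀ := congrArg (fun g => ι₀ X (m + 1) ≫ g) f.comm₀
      dsimp only at c₁ c₀
      rw [reassoc_of% z₁, zero_comp] at c₁
      rw [reassoc_of% z₀, zero_comp] at c₀
      rw [reassoc_of% (ι₁_totd₁' X m (m + 1) rfl), Preadditive.add_comp, Category.assoc, z₀,
        comp_zero, zero_add, Category.assoc] at c₁
      rw [reassoc_of% (ι₀_totd₀' X m (m + 1) rfl), Preadditive.add_comp, Category.assoc,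
        ← Functor.map_comp, z₁, Functor.map_zero, comp_zero, zero_add, Category.assoc,
        ← Functor.map_comp] at c₀
      -- By exactness and injectivity of the components of `J`, the restriction of `f` to summand
      -- `m` extends along the differential to summand `m - 1`; this extension is the homotopy.
      obtain ⟨s, hs⟩ := hX.exists_down₀ (m - 1) m (m + 1) (by omega) rfl _ c₁.symm
      obtain ⟨t, ht⟩ := hX.exists_down₁ (m - 1) m (m + 1) (by omega) rfl _ c₀.symm
      obtain ⟨g, hb⟩ : ∃ g : tot X ⟶ J, IsNullBy g (T.Φ.functor.map (π₁ X (m - 1)) ≫ s)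
        (π₀ X (m - 1) ≫ t) := ⟨_, boundary_isNullBy _ _⟩
      rw [← sub_add_cancel f g]
      refine (ih _ fun n hn => ?_).add hb.null
      -- On the relevant indices `n ≥ m`, the boundary `g` agrees with `f` at `m` and vanishes
      -- above. It may alter `f` at `m - 1`, which the induction allows.
      have b₁ : ι₁ X n ≫ g.f₁ = ι₁ X n ≫ π₁ X m ≫ ι₁ X m ≫ f.f₁ := by
        apply T.Φ.functor.map_injective
        rw [Functor.map_comp, hb.eq₁, ← Functor.map_comp, ← Category.assoc (totd₁ X),
          totd₁_π₀ X (m - 1) m (by omega), ← ht, Preadditive.comp_add, ← Functor.map_comp,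
          Category.assoc, ← Functor.map_comp_assoc, ι₁_π₁_of_ne X (by omega)]
        simp only [Preadditive.add_comp, Preadditive.comp_add, Category.assoc,
          reassoc_of% (ι₁_π₁_of_ne X (show n ≠ m - 1 by omega))]
        simp
      have b₀ : ι₀ X n ≫ g.f₀ = ι₀ X n ≫ π₀ X m ≫ ι₀ X m ≫ f.f₀ := by
        rw [hb.eq₀, ← Category.assoc (totd₀ X), totd₀_π₁ X (m - 1) m (by omega), ← hs,
          Preadditive.comp_add]
        simp only [Preadditive.add_comp, Preadditive.comp_add, Category.assoc,
          reassoc_of% (ι₀_π₀_of_ne X (show n ≠ m - 1 by omega))]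
        simp
      rw [sub_f₁, sub_f₀, Preadditive.comp_sub, Preadditive.comp_sub, b₁, b₀]
      by_cases hnm : n = m
      · subst hnm
        rw [reassoc_of% (ι₁_π₁ X n), reassoc_of% (ι₀_π₀ X n), sub_self, sub_self]
        exact ⟨rfl, rfl⟩
      · obtain ⟨y₁, y₀⟩ := hf n (by push_cast; omega)
        rw [reassoc_of% (ι₁_π₁_of_ne X hnm), reassoc_of% (ι₀_π₀_of_ne X hnm), y₁, y₀]
        simp
  exact key k f fun n hn => ⟨((ev₁ T).map_isZero (h' n hn)).eq_of_src _ _,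
    ((ev₀ T).map_isZero (h' n hn)).eq_of_src _ _⟩

/-- Morphisms from a factorization with projective components to the totalization of a bounded
exact complex are null-homotopic. -/
theorem null_to_tot [IsBdd X] (hX : IsExact X) {P : Factorization T} (hP₁ : Projective P.X₁)
    (hP₀ : Projective P.X₀) (f : P ⟶ tot X) : Null f := by
  obtain ⟨N, k, h, h'⟩ := IsBdd.exists_isZero_shiftZ X
  -- The dual induction clears components from the lowest index upwards; `k'` counts the indices
  -- below `N + k` that remain.
  have key : ∀ (k' k : ℕ) (f : P ⟶ tot X), (∀ n, N + k ≤ n → IsZero ((shiftZ T n).obj (X.X (-n)))) →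
      (∀ n, n < N + k - k' → f.f₁ ≫ π₁ X n = 0 ∧ f.f₀ ≫ π₀ X n = 0) → Null f := by
    intro k' k
    induction k' with
    | zero =>
      intro f h' hf
      have : f = 0 := by
        apply tot_hom_ext'
        · intro n
          by_cases hn : N + k ≤ n
          · exact ((ev₁ T).map_isZero (h' n hn)).eq_of_tgt _ _
          · rw [(hf n (by simp; omega)).1]; simp
        · intro n
          by_cases hn : N + k ≤ n
          · exact ((ev₀ T).map_isZero (h' n hn)).eq_of_tgt _ _
          · rw [(hf n (by simp; omega)).2]; simp
      rw [this]
      exact null_zero _ _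
    | succ k' ih =>
      intro f h' hf
      -- `m` is the lowest index not yet cleared. Since `f` has no component at `m - 1`, its
      -- component at `m` lies in the kernel of the differential and lifts to index `m + 1`, the
      -- components of `P` being projective.
      obtain ⟨m, hm⟩ : ∃ m, m = N + k - k' - 1 := ⟨_, rfl⟩
      obtain ⟨z₁, z₀⟩ := hf (m - 1) (by push_cast; omega)
      have c₁ := congrArg (fun g => g ≫ π₀ X (m - 1)) f.comm₁
      have c₀ := congrArg (fun g => g ≫ T.Φ.functor.map (π₁ X (m - 1))) f.comm₀
      dsimp only at c₁ c₀
      rw [Category.assoc, Category.assoc, z₀, comp_zero, totd₁_π₀ X (m - 1) m (by omega),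
        Preadditive.comp_add, reassoc_of% z₁, zero_comp, zero_add, ← Category.assoc] at c₁
      rw [Category.assoc, Category.assoc, ← Functor.map_comp, z₁, Functor.map_zero, comp_zero,
        totd₀_π₁ X (m - 1) m (by omega),
        Preadditive.comp_add, reassoc_of% z₀, zero_comp, zero_add, ← Category.assoc] at c₀
      obtain ⟨s, hs⟩ := hX.exists_lift_down₀ (m - 1) m (m + 1) (by omega) rfl _ c₁
      obtain ⟨t, ht⟩ := hX.exists_lift_down₁ (m - 1) m (m + 1) (by omega) rfl _ c₀
      obtain ⟨g, hb⟩ : ∃ g : P ⟶ tot X, IsNullBy g (s ≫ ι₀ X (m + 1))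
        (t ≫ ι₁ X (m + 1)) := ⟨_, boundary_isNullBy _ _⟩
      rw [← sub_add_cancel f g]
      refine (ih _ h' fun n hn => ?_).add hb.null
      have b₁ : g.f₁ ≫ π₁ X n = f.f₁ ≫ π₁ X m ≫ ι₁ X m ≫ π₁ X n := by
        have h₃ : T.Φ.functor.map (ι₁ X (m + 1)) ≫ T.Φ.functor.map (π₁ X n) = 0 := by
          rw [← Functor.map_comp, ι₁_π₁_of_ne X (show m + 1 ≠ n by omega), Functor.map_zero]
        have h₄ : ι₀ X (m + 1) ≫ (tot X).d₀ ≫ T.Φ.functor.map (π₁ X n) =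
            down₀ m (m + 1) rfl (X.d (-(m + 1)) (-m)) ≫ T.Φ.functor.map (ι₁ X m ≫ π₁ X n) := by
          rw [reassoc_of% (ι₀_totd₀' X m (m + 1) rfl), Preadditive.add_comp, Category.assoc,
            Category.assoc, h₃, comp_zero, zero_add, Functor.map_comp]
        apply T.Φ.functor.map_injective
        rw [Functor.map_comp, hb.eq₁, Preadditive.add_comp, Category.assoc, Category.assoc,
          Category.assoc, h₄, Functor.map_comp, Category.assoc, h₃, reassoc_of% hs]
        simp
      have b₀ : g.f₀ ≫ π₀ X n = f.f₀ ≫ π₀ X m ≫ ι₀ X m ≫ π₀ X n := by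
        rw [hb.eq₀, Preadditive.add_comp, Category.assoc, Category.assoc, Category.assoc,
          Category.assoc, reassoc_of% (ι₁_totd₁' X m (m + 1) rfl),
          ι₀_π₀_of_ne X (show m + 1 ≠ n by omega),
          Preadditive.add_comp, Category.assoc, Category.assoc,
          ι₀_π₀_of_ne X (show m + 1 ≠ n by omega), Preadditive.comp_add, reassoc_of% ht]
        simp
      rw [sub_f₁, sub_f₀, Preadditive.sub_comp, Preadditive.sub_comp, b₁, b₀]
      by_cases hnm : m = n
      · subst hnm
        rw [ι₁_π₁ X m, ι₀_π₀ X m, Category.comp_id, Category.comp_id, sub_self, sub_self]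
        exact ⟨rfl, rfl⟩
      · obtain ⟨y₁, y₀⟩ := hf n (by push_cast; omega)
        rw [ι₁_π₁_of_ne X hnm, ι₀_π₀_of_ne X hnm, y₁, y₀]
        simp
  exact key k k f h' fun n hn => ⟨((ev₁ T).map_isZero (h n (by omega))).eq_of_tgt _ _,
    ((ev₀ T).map_isZero (h n (by omega))).eq_of_tgt _ _⟩

end

end

section

/-! ### Orthogonality -/

section

variable (A) in
/-- The factorizations without homotopically nontrivial maps to those with injective components. -/
def leftOrthInjective (T : FactTriple A) : ObjectProperty (K T) := fun E =>
  ∀ J : Factorization T, Injective J.X₁ → Injective J.X₀ → ∀ f : E.as ⟶ J, Null f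

variable (A) in
/-- The factorizations without homotopically nontrivial maps from those with projective components. -/
def rightOrthProjective (T : FactTriple A) : ObjectProperty (K T) := fun E =>
  ∀ P : Factorization T, Projective P.X₁ → Projective P.X₀ → ∀ f : P ⟶ E.as, Null f

theorem injective_Φ {X : A} (h : Injective X) : Injective (T.Φ.functor.obj X) :=
  (T.Φ.map_injective_iff X).2 h

theorem injective_Φ_inv {X : A} (h : Injective X) : Injective (T.Φ.inverse.obj X) :=
  (T.Φ.symm.map_injective_iff X).2 h

theorem projective_Φ {X : A} (h : Projective X) : Projective (T.Φ.functor.obj X) :=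
  (T.Φ.map_projective_iff X).2 h

theorem projective_Φ_inv {X : A} (h : Projective X) : Projective (T.Φ.inverse.obj X) :=
  (T.Φ.symm.map_projective_iff X).2 h

theorem leftOrthInjective_iff {E : Factorization T} :
    leftOrthInjective A T ((K.of T).obj E) ↔
      ∀ J : Factorization T, Injective J.X₁ → Injective J.X₀ → ∀ f : E ⟶ J, Null f := Iff.rfl

theorem rightOrthProjective_iff {E : Factorization T} :
    rightOrthProjective A T ((K.of T).obj E) ↔
      ∀ P : Factorization T, Projective P.X₁ → Projective P.X₀ → ∀ f : P ⟶ E, Null f := Iff.rfl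

/-- Up to the isomorphism `J[-1][1] ≅ J`, each morphism `E[1] ⟶ J` is the shift of a morphism `E ⟶
J[-1]`, and both shifts preserve injectivity of components. -/
theorem leftOrthInjective_shift_iff (E : Factorization T) :
    leftOrthInjective A T ((K.of T).obj ((shift T).obj E)) ↔
      leftOrthInjective A T ((K.of T).obj E) := by
  simp only [leftOrthInjective_iff]
  refine ⟨fun h J h₁ h₀ f => (null_shift_iff f).1 (h _ h₀ (injective_Φ h₁) _), fun h J h₁ h₀ f => ?_⟩
  have h' := h ((unshift T).obj J) (injective_Φ_inv h₀) h₁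
    ((unshiftShift E).inv ≫ (unshift T).map f)
  rw [← null_shift_iff] at h'
  have : f = (shift T).map ((unshiftShift E).inv ≫ (unshift T).map f) ≫ (shiftUnshift J).hom := by
    ext
    · simp [unshiftShift, shiftUnshift]
    · simp [unshiftShift, shiftUnshift]
  rw [this]
  exact h'.comp_right _

theorem rightOrthProjective_shift_iff (E : Factorization T) :
    rightOrthProjective A T ((K.of T).obj ((shift T).obj E)) ↔
      rightOrthProjective A T ((K.of T).obj E) := by
  simp only [rightOrthProjective_iff]
  refine ⟨fun h J h₁ h₀ f => (null_shift_iff f).1 (h _ h₀ (projective_Φ h₁) _),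
    fun h P h₁ h₀ f => ?_⟩
  have h' := h ((unshift T).obj P) (projective_Φ_inv h₀) h₁
    ((unshift T).map f ≫ (unshiftShift E).hom)
  rw [← null_shift_iff] at h'
  have : f = (shiftUnshift P).inv ≫ (shift T).map ((unshift T).map f ≫ (unshiftShift E).hom) := by
    ext
    · simp [unshiftShift, shiftUnshift]
    · simp [unshiftShift, shiftUnshift]
  rw [this]
  exact h'.comp_left _

theorem leftOrthInjective_isThick : IsThick (leftOrthInjective A T) where
  shift_iff := leftOrthInjective_shift_iff
  cone f hE hF J h₁ h₀ v := null_of_cone v (hF J h₁ h₀ _)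
    ((leftOrthInjective_shift_iff _).2 hE J h₁ h₀)
  retract := ⟨fun {E F} r h J h₁ h₀ f => by
    obtain ⟨i, hi⟩ := K.map_surjective (E := E.as) (F := F.as) r.i
    obtain ⟨p, hp⟩ := K.map_surjective (E := F.as) (F := E.as) r.r
    -- The retraction holds only in the homotopy category. Its representatives compose to the
    -- identity up to a null-homotopic defect, which stays null-homotopic after composing with `f`.
    have : Null (i ≫ p - 𝟙 _) := by
      rw [← K.map_eq_iff, Functor.map_comp, hi, hp]
      exact r.retract
    have h' := ((h J h₁ h₀ (p ≫ f)).comp_left i).sub (this.comp_right f)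
    simpa using h'⟩

theorem rightOrthProjective_isThick : IsThick (rightOrthProjective A T) where
  shift_iff := rightOrthProjective_shift_iff
  cone f hE hF J h₁ h₀ v := null_to_cone v
    ((rightOrthProjective_shift_iff _).2 hE J h₁ h₀ _) (hF J h₁ h₀)
  retract := ⟨fun {E F} r h J h₁ h₀ f => by
    obtain ⟨i, hi⟩ := K.map_surjective (E := E.as) (F := F.as) r.i
    obtain ⟨p, hp⟩ := K.map_surjective (E := F.as) (F := E.as) r.r
    have : Null (i ≫ p - 𝟙 _) := by
      rw [← K.map_eq_iff, Functor.map_comp, hi, hp]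
      exact r.retract
    have h' := ((h J h₁ h₀ (f ≫ i)).comp_right p).sub (this.comp_left f)
    simpa using h'⟩

theorem leftOrthInjective_tot : ContainsExactTotalizations (leftOrthInjective A T) :=
  fun _ _ hX _ h₁ h₀ f => null_of_tot hX h₁ h₀ f

theorem rightOrthProjective_tot : ContainsExactTotalizations (rightOrthProjective A T) :=
  fun _ _ hX _ h₁ h₀ f => null_to_tot hX h₁ h₀ f

theorem K.null_iff_map_eq {E F : Factorization T} (f : E ⟶ F) :
    Null f ↔ (K.of T).map f = (K.of T).map 0 := by
  rw [K.map_eq_iff, sub_zero]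

/-- A morphism out of a coproduct in the homotopy category is determined by its restrictions, and
these are all zero. -/
theorem leftOrthInjective_closed (J : Type w) :
    (leftOrthInjective A T).IsClosedUnderColimitsOfShape (Discrete J) where
  colimitsOfShape_le := by
    rintro X ⟨p⟩ I h₁ h₀ f
    rw [K.null_iff_map_eq]
    refine p.isColimit.hom_ext fun j => ?_
    obtain ⟨a, ha⟩ := K.map_surjective (E := (p.diag.obj j).as) (F := X.as) (p.ι.app j)
    have := (K.map_eq_iff _ _).2 ((sub_zero (a ≫ f)).symm ▸ p.prop_diag_obj j I h₁ h₀ (a ≫ f))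
    change p.ι.app j ≫ _ = p.ι.app j ≫ _
    rw [← ha]
    erw [← Functor.map_comp, ← Functor.map_comp, comp_zero]
    exact this

theorem rightOrthProjective_closed (J : Type w) :
    (rightOrthProjective A T).IsClosedUnderLimitsOfShape (Discrete J) where
  limitsOfShape_le := by
    rintro X ⟨p⟩ I h₁ h₀ f
    rw [K.null_iff_map_eq]
    refine p.isLimit.hom_ext fun j => ?_
    obtain ⟨a, ha⟩ := K.map_surjective (E := X.as) (F := (p.diag.obj j).as) (p.π.app j)
    have := (K.map_eq_iff _ _).2 ((sub_zero (f ≫ a)).symm ▸ p.prop_diag_obj j I h₁ h₀ (f ≫ a))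
    change _ ≫ p.π.app j = _ ≫ p.π.app j
    rw [← ha]
    erw [← Functor.map_comp, ← Functor.map_comp, zero_comp]
    exact this

/-- Minimality: the orthogonal class satisfies every condition imposed on the classes whose
intersection is the acyclic one. -/
theorem absAcyclic_le_leftOrthInjective : absAcyclic T ≤ leftOrthInjective A T :=
  fun _ h => h _ leftOrthInjective_isThick leftOrthInjective_tot

theorem absAcyclic_le_rightOrthProjective : absAcyclic T ≤ rightOrthProjective A T :=
  fun _ h => h _ rightOrthProjective_isThick rightOrthProjective_tot

theorem coAcyclic_le_leftOrthInjective : coAcyclic.{w} T ≤ leftOrthInjective A T :=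
  fun _ h => h _ leftOrthInjective_isThick leftOrthInjective_tot leftOrthInjective_closed

theorem ctrAcyclic_le_rightOrthProjective : ctrAcyclic.{w} T ≤ rightOrthProjective A T :=
  fun _ h => h _ rightOrthProjective_isThick rightOrthProjective_tot rightOrthProjective_closed

/-- Factorizations with injective components are local. -/
theorem bijective_precomp_of_injectiveComponents {N : ObjectProperty (K T)}
    (hN' : N ≤ leftOrthInjective A T) {J : K T} (hJ : injectiveComponents T J) {X Y : K T}
    (f : X ⟶ Y) (hf : quasiIso N f) : Function.Bijective (fun g : Y ⟶ J => f ≫ g) := by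
  obtain ⟨J⟩ := J
  obtain ⟨X⟩ := X
  obtain ⟨Y⟩ := Y
  obtain ⟨f, rfl, hf⟩ := hf
  constructor
  · intro a b hab
    obtain ⟨a, rfl⟩ := K.map_surjective a
    obtain ⟨b, rfl⟩ := K.map_surjective b
    rw [K.map_eq_iff]
    have h : (K.of T).map (f ≫ a) = (K.of T).map (f ≫ b) := by
      rw [Functor.map_comp, Functor.map_comp]; exact hab
    rw [K.map_eq_iff, ← Preadditive.comp_sub] at h
    exact null_of_null_comp f (hN' _ hf J hJ.1 hJ.2) _ h
  · intro a
    obtain ⟨a, rfl⟩ := K.map_surjective a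
    -- Surjectivity needs orthogonality against `J[1]`, whose components `J₀` and `Φ J₁` are again
    -- injective.
    obtain ⟨u, hu⟩ := exists_desc_of_null f (hN' _ hf _ hJ.2 (injective_Φ hJ.1)) a
    refine ⟨(K.of T).map u, ?_⟩
    exact ((K.of T).map_comp _ _).symm.trans ((K.map_eq_iff _ _).2 hu)

/-- Factorizations with projective components are colocal. -/
theorem bijective_postcomp_of_projectiveComponents {N : ObjectProperty (K T)}
    (hN' : N ≤ rightOrthProjective A T) {P : K T} (hP : projectiveComponents T P) {X Y : K T}
    (f : X ⟶ Y) (hf : quasiIso N f) : Function.Bijective (fun g : P ⟶ X => g ≫ f) := by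
  obtain ⟨P⟩ := P
  obtain ⟨X⟩ := X
  obtain ⟨Y⟩ := Y
  obtain ⟨f, rfl, hf⟩ := hf
  constructor
  · intro a b hab
    obtain ⟨a, rfl⟩ := K.map_surjective a
    obtain ⟨b, rfl⟩ := K.map_surjective b
    rw [K.map_eq_iff]
    have h : (K.of T).map (a ≫ f) = (K.of T).map (b ≫ f) := by
      rw [Functor.map_comp, Functor.map_comp]; exact hab
    rw [K.map_eq_iff, ← Preadditive.sub_comp] at h
    exact null_of_comp_null f (hN' _ hf _ hP.2 (projective_Φ hP.1)) _ h
  · intro a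
    obtain ⟨a, rfl⟩ := K.map_surjective a
    obtain ⟨u, hu⟩ := exists_lift_of_null f (hN' _ hf _ hP.1 hP.2) a
    refine ⟨(K.of T).map u, ?_⟩
    exact ((K.of T).map_comp _ _).symm.trans ((K.map_eq_iff _ _).2 hu)

end

end

section

/-! ### Localization at morphisms with enough local objects -/

section

universe u v

variable {C : Type u} [Category.{v} C] {W : MorphismProperty C} {P : ObjectProperty C}

/-- If each object has a morphism in `W` to an object with property `P`, and objects with
property `P` are local, then these objects form the localization. -/
theorem exists_localization_rightAdjoint (hP : P ≤ W.isLocal)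
    (hW : ∀ X, ∃ (J : C) (f : X ⟶ J), P J ∧ W f) :
    (P.ι ⋙ W.Q).IsEquivalence ∧ ∃ (G : W.Localization ⥤ C) (adj : W.Q ⊣ G),
      ∀ J, P J → IsIso (adj.unit.app J) := by
  -- The chosen resolutions `ρ X : X ⟶ r X` form a reflection onto the objects with property `P`,
  -- since precomposition with `ρ X` is bijective on maps to local objects.
  choose r ρ hr hρ using hW
  let e : ∀ (X : C) (Y : P.FullSubcategory), ((⟨r X, hr X⟩ : P.FullSubcategory) ⟶ Y) ≃
      (X ⟶ P.ι.obj Y) := fun X Y =>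
    P.fullyFaithfulι.homEquiv.trans (Equiv.ofBijective _ (hP _ Y.property (ρ X) (hρ X)))
  have he : ∀ X Y Y' g h, e X Y' (h ≫ g) = e X Y h ≫ P.ι.map g := by
    intro X Y Y' g h
    exact (Category.assoc _ _ _).symm
  let adj := Adjunction.adjunctionOfEquivLeft e he
  have hu : ∀ X, adj.unit.app X = ρ X := fun X => by
    simp only [adj, Adjunction.adjunctionOfEquivLeft, Adjunction.mkOfHomEquiv_unit_app]
    exact Category.comp_id (ρ X)
  have hinv : W.IsInvertedBy (Adjunction.leftAdjointOfEquiv e he) := by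
    intro X Y f hf
    have h : ∀ Z : P.FullSubcategory, Function.Bijective
        (fun g => (Adjunction.leftAdjointOfEquiv e he).map f ≫ g : (_ ⟶ Z) → (_ ⟶ Z)) := by
      intro Z
      have : (fun g => (Adjunction.leftAdjointOfEquiv e he).map f ≫ g : (_ ⟶ Z) → (_ ⟶ Z)) =
          (adj.homEquiv X Z).symm ∘ (fun g => f ≫ g) ∘ (adj.homEquiv Y Z) := by
        ext1 g
        have := adj.homEquiv_naturality_left_symm f (adj.homEquiv Y Z g)
        rw [Equiv.symm_apply_apply] at this
        exact this.symm
      rw [this]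
      exact (Equiv.bijective _).comp ((hP _ Z.property f hf).comp (Equiv.bijective _))
    exact isIso_iff_coyoneda_map_bijective _ |>.2 h
  -- A left adjoint that inverts `W` and has its unit in `W`, with fully faithful right adjoint, is
  -- a localization at `W`.
  have hloc : (Adjunction.leftAdjointOfEquiv e he).IsLocalization W :=
    adj.isLocalization_leftAdjoint W hinv (fun X => by rw [hu]; exact hρ X)
  -- Uniqueness of localizations identifies the local objects with `W.Localization` and turns the
  -- reflection into an adjunction for `W.Q`.
  let E := Localization.uniq (Adjunction.leftAdjointOfEquiv e he) W.Q W
  let i : Adjunction.leftAdjointOfEquiv e he ⋙ E.functor ≅ W.Q :=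
    Localization.compUniqFunctor (Adjunction.leftAdjointOfEquiv e he) W.Q W
  let adj' := (adj.comp E.toAdjunction).ofNatIsoLeft i
  refine ⟨?_, E.inverse ⋙ P.ι, adj', fun J hJ => ?_⟩
  · have j : E.functor ≅ P.ι ⋙ W.Q :=
      (Functor.leftUnitor _).symm ≪≫ Functor.isoWhiskerRight (asIso adj.counit).symm _ ≪≫
        Functor.associator _ _ _ ≪≫ Functor.isoWhiskerLeft _ i
    exact Functor.isEquivalence_of_iso j
  -- A local object is isomorphic to a value of the fully faithful right adjoint, where the unit is
  -- invertible.
  · exact adj'.isIso_unit_app_of_iso (P.ι.mapIso (E.unitIso.app ⟨J, hJ⟩))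

/-- If each object has a morphism in `W` from an object with property `P`, and objects with
property `P` are colocal, then these objects form the localization. -/
theorem exists_localization_leftAdjoint (hP : P ≤ W.isColocal)
    (hW : ∀ X, ∃ (J : C) (f : J ⟶ X), P J ∧ W f) :
    (P.ι ⋙ W.Q).IsEquivalence ∧ ∃ (G : W.Localization ⥤ C) (adj : G ⊣ W.Q),
      ∀ J, P J → IsIso (adj.counit.app J) := by
  choose r ρ hr hρ using hW
  let e : ∀ (Y : P.FullSubcategory) (X : C), (P.ι.obj Y ⟶ X) ≃
      (Y ⟶ (⟨r X, hr X⟩ : P.FullSubcategory)) := fun Y X =>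
    (P.fullyFaithfulι.homEquiv.trans
      (Equiv.ofBijective _ (hP _ Y.property (ρ X) (hρ X)))).symm
  have he' : ∀ (X' X : P.FullSubcategory) Y (f : X' ⟶ X) g,
      (e X' Y).symm (f ≫ g) = P.ι.map f ≫ (e X Y).symm g := by
    intro X Y Y' g h
    exact Category.assoc _ _ _
  -- Naturality is evident for the inverse bijection, which is composition with `ρ`; the required
  -- form follows by injectivity.
  have he : ∀ X' X Y f g, e X' Y (P.ι.map f ≫ g) = f ≫ e X Y g := by
    intro X' X Y f g
    rw [← (e X' Y).symm.injective.eq_iff, he', Equiv.symm_apply_apply, Equiv.symm_apply_apply]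
  let adj := Adjunction.adjunctionOfEquivRight e he
  have hu : ∀ X, adj.counit.app X = ρ X := fun X => by
    simp only [adj, Adjunction.adjunctionOfEquivRight, Adjunction.mkOfHomEquiv_counit_app]
    exact Category.id_comp (ρ X)
  have hinv : W.IsInvertedBy (Adjunction.rightAdjointOfEquiv e he) := by
    intro X Y f hf
    have h : ∀ Z : P.FullSubcategory, Function.Bijective
        (fun g => g ≫ (Adjunction.rightAdjointOfEquiv e he).map f : (Z ⟶ _) → (Z ⟶ _)) := by
      intro Z
      have : (fun g => g ≫ (Adjunction.rightAdjointOfEquiv e he).map f : (Z ⟶ _) → (Z ⟶ _)) =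
          (adj.homEquiv Z Y) ∘ (fun g => g ≫ f) ∘ (adj.homEquiv Z X).symm := by
        ext1 g
        have := adj.homEquiv_naturality_right ((adj.homEquiv Z X).symm g) f
        rw [Equiv.apply_symm_apply] at this
        exact this.symm
      rw [this]
      exact (Equiv.bijective _).comp ((hP _ Z.property f hf).comp (Equiv.bijective _))
    exact isIso_iff_yoneda_map_bijective _ |>.2 h
  have hloc : (Adjunction.rightAdjointOfEquiv e he).IsLocalization W :=
    adj.isLocalization_rightAdjoint W hinv (fun X => by rw [hu]; exact hρ X)
  let E := Localization.uniq (Adjunction.rightAdjointOfEquiv e he) W.Q W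
  let i : Adjunction.rightAdjointOfEquiv e he ⋙ E.functor ≅ W.Q :=
    Localization.compUniqFunctor (Adjunction.rightAdjointOfEquiv e he) W.Q W
  let adj' := (E.symm.toAdjunction.comp adj).ofNatIsoRight i
  refine ⟨?_, E.inverse ⋙ P.ι, adj', fun J hJ => ?_⟩
  · have j : E.functor ≅ P.ι ⋙ W.Q :=
      (Functor.leftUnitor _).symm ≪≫ Functor.isoWhiskerRight (asIso adj.unit) _ ≪≫
        Functor.associator _ _ _ ≪≫ Functor.isoWhiskerLeft _ i
    exact Functor.isEquivalence_of_iso j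
  · exact adj'.isIso_counit_app_of_iso (P.ι.mapIso (E.unitIso.app ⟨J, hJ⟩))

universe u' v' u'' v''

variable {D : Type u'} [Category.{v'} D] {H : Type u''} [Category.{v''} H] {L : C ⥤ D}
  {G : D ⥤ C}

/-- The extension of `β : F ⟶ L ⋙ E` for a left adjoint `L`. -/
@[simps]
def leftExtensionDesc (adj : L ⊣ G) {F : C ⥤ H} {E : D ⥤ H} (β : F ⟶ L ⋙ E) : G ⋙ F ⟶ E where
  app X := β.app (G.obj X) ≫ E.map (adj.counit.app X)
  naturality X Y f := by
    have h := β.naturality (G.map f)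
    dsimp at h ⊢
    rw [reassoc_of% h, Category.assoc, ← Functor.map_comp, ← Functor.map_comp]
    simp

/-- Naturality of `β` at the unit moves the unit behind `L`, where the triangle identity cancels it
against the counit. -/
theorem leftExtensionDesc_fac (adj : L ⊣ G) {F : C ⥤ H} {E : D ⥤ H} (β : F ⟶ L ⋙ E) (X : C) :
    F.map (adj.unit.app X) ≫ (leftExtensionDesc adj β).app (L.obj X) = β.app X := by
  have h := β.naturality (adj.unit.app X)
  dsimp at h ⊢
  rw [leftExtensionDesc_app, reassoc_of% h, ← Functor.map_comp]
  simp

/-- Naturality at the counit recovers a transformation out of `G ⋙ F` from its values on the objects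
`L (G X)`. -/
theorem leftExtensionDesc_uniq (adj : L ⊣ G) {F : C ⥤ H} {E : D ⥤ H} (β : F ⟶ L ⋙ E)
    (m : G ⋙ F ⟶ E) (hm : ∀ X, F.map (adj.unit.app X) ≫ m.app (L.obj X) = β.app X) :
    m = leftExtensionDesc adj β := by
  ext X
  have h := m.naturality (adj.counit.app X)
  dsimp at h ⊢
  rw [leftExtensionDesc_app, ← hm, Category.assoc, ← h, ← Functor.map_comp_assoc]
  simp

/-- Left Kan extensions along a left adjoint. -/
theorem isLeftKanExtension_of_adjunction (adj : L ⊣ G) (F : C ⥤ H) :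
    (G ⋙ F).IsLeftKanExtension
      ((Functor.leftUnitor F).inv ≫ Functor.whiskerRight adj.unit F ≫
        (Functor.associator L G F).hom) := by
  refine ⟨⟨Limits.IsInitial.ofUniqueHom (fun Y => ?_) (fun Y m => ?_)⟩⟩
  · refine StructuredArrow.homMk (leftExtensionDesc adj Y.hom) ?_
    ext X
    change (𝟙 _ ≫ F.map (adj.unit.app X) ≫ 𝟙 _) ≫ (leftExtensionDesc adj Y.hom).app (L.obj X) = _
    rw [Category.id_comp, Category.comp_id]
    exact leftExtensionDesc_fac adj Y.hom X
  · refine StructuredArrow.ext _ _ (leftExtensionDesc_uniq adj Y.hom m.right fun X => ?_)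
    have h : (𝟙 _ ≫ F.map (adj.unit.app X) ≫ 𝟙 _) ≫ m.right.app (L.obj X) = Y.hom.app X :=
      NatTrans.congr_app (StructuredArrow.w m) X
    rw [Category.id_comp, Category.comp_id] at h
    exact h

/-- The lift of `β : L ⋙ E ⟶ F` for a right adjoint `L`. -/
@[simps]
def rightExtensionLift (adj : G ⊣ L) {F : C ⥤ H} {E : D ⥤ H} (β : L ⋙ E ⟶ F) : E ⟶ G ⋙ F where
  app X := E.map (adj.unit.app X) ≫ β.app (G.obj X)
  naturality X Y f := by
    have h := β.naturality (G.map f)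
    dsimp at h ⊢
    rw [Category.assoc, ← h, ← Functor.map_comp_assoc, ← Functor.map_comp_assoc]
    simp

theorem rightExtensionLift_fac (adj : G ⊣ L) {F : C ⥤ H} {E : D ⥤ H} (β : L ⋙ E ⟶ F) (X : C) :
    (rightExtensionLift adj β).app (L.obj X) ≫ F.map (adj.counit.app X) = β.app X := by
  have h := β.naturality (adj.counit.app X)
  dsimp at h ⊢
  rw [rightExtensionLift_app, Category.assoc, ← h, ← Functor.map_comp_assoc]
  simp

theorem rightExtensionLift_uniq (adj : G ⊣ L) {F : C ⥤ H} {E : D ⥤ H} (β : L ⋙ E ⟶ F)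
    (m : E ⟶ G ⋙ F) (hm : ∀ X, m.app (L.obj X) ≫ F.map (adj.counit.app X) = β.app X) :
    m = rightExtensionLift adj β := by
  ext X
  have h := m.naturality (adj.unit.app X)
  dsimp at h ⊢
  rw [rightExtensionLift_app, ← hm, reassoc_of% h, ← Functor.map_comp]
  simp

/-- Right Kan extensions along a right adjoint. -/
theorem isRightKanExtension_of_adjunction (adj : G ⊣ L) (F : C ⥤ H) :
    (G ⋙ F).IsRightKanExtension
      ((Functor.associator L G F).inv ≫ Functor.whiskerRight adj.counit F ≫
        (Functor.leftUnitor F).hom) := by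
  refine ⟨⟨Limits.IsTerminal.ofUniqueHom (fun Y => ?_) (fun Y m => ?_)⟩⟩
  · refine CostructuredArrow.homMk (rightExtensionLift adj Y.hom) ?_
    ext X
    change (rightExtensionLift adj Y.hom).app (L.obj X) ≫ 𝟙 _ ≫ F.map (adj.counit.app X) ≫ 𝟙 _ = _
    rw [Category.id_comp, Category.comp_id]
    exact rightExtensionLift_fac adj Y.hom X
  · refine CostructuredArrow.ext _ _ (rightExtensionLift_uniq adj Y.hom m.left fun X => ?_)
    exact (congrArg (fun k => m.left.app (L.obj X) ≫ k)
      ((Category.id_comp _).trans (Category.comp_id _)).symm).trans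
      (NatTrans.congr_app (CostructuredArrow.w m) X)

end

/-! ### Derived factored functors and the invertibility criterion -/

section

variable {B : Type u₂} [Category.{v₂} B] [Abelian B] {U : FactTriple B}
  {θ γ : FactoredFunctor T U} {N : ObjectProperty (K T)} {N' : ObjectProperty (K U)}

/-- The derived functor is `G ⋙ θ.toD N'`, for `G` right adjoint to the quotient functor. Its
structure map is `θ.toD N'` applied to the adjunction unit, so it is invertible wherever the latter
is. -/
theorem exists_rightDerived (θ : FactoredFunctor T U)
    {G : VerdierQuotient N ⥤ K T} (adj : toVerdier N ⊣ G)
    (hG : ∀ J, injectiveComponents T J → IsIso (adj.unit.app J)) :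
    ∃ R : RightDerived θ N N', R.ComputedByInjectives := by
  refine ⟨⟨_, _, ⟨isLeftKanExtension_of_adjunction adj (θ.toD N')⟩⟩, fun J hJ => ?_⟩
  have := hG J hJ
  simp only [NatTrans.comp_app]
  have : IsIso ((Functor.whiskerRight adj.unit (θ.toD N')).app J) :=
    inferInstanceAs (IsIso ((θ.toD N').map (adj.unit.app J)))
  infer_instance

/-- Derived functors are unique up to an isomorphism compatible with the structure maps, so the
property does not depend on the choice made. -/
theorem computedByInjectives_of_exists (h : ∃ R : RightDerived θ N N', R.ComputedByInjectives)
    (S : RightDerived θ N N') : S.ComputedByInjectives := by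
  obtain ⟨R, hR⟩ := h
  intro J hJ
  have := R.isDerived
  have := S.isDerived
  have := hR J hJ
  let i := Functor.rightDerivedUnique R.functor S.functor R.unit S.unit (quasiIso N)
  have : R.unit.app J ≫ i.hom.app _ = S.unit.app J := by
    simp [i, toVerdier]
  rw [← this]
  infer_instance

theorem exists_leftDerived (θ : FactoredFunctor T U)
    {G : VerdierQuotient N ⥤ K T} (adj : G ⊣ toVerdier N)
    (hG : ∀ J, projectiveComponents T J → IsIso (adj.counit.app J)) :
    ∃ R : LeftDerived θ N N', R.ComputedByProjectives := by
  refine ⟨⟨_, _, ⟨isRightKanExtension_of_adjunction adj (θ.toD N')⟩⟩, fun J hJ => ?_⟩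
  have := hG J hJ
  simp only [NatTrans.comp_app]
  have : IsIso ((Functor.whiskerRight adj.counit (θ.toD N')).app J) :=
    inferInstanceAs (IsIso ((θ.toD N').map (adj.counit.app J)))
  infer_instance

theorem computedByProjectives_of_exists (h : ∃ R : LeftDerived θ N N', R.ComputedByProjectives)
    (S : LeftDerived θ N N') : S.ComputedByProjectives := by
  obtain ⟨R, hR⟩ := h
  intro J hJ
  have := R.isDerived
  have := S.isDerived
  have := hR J hJ
  let i := Functor.leftDerivedUnique R.functor S.functor S.counit R.counit (quasiIso N)
  have : i.hom.app _ ≫ R.counit.app J = S.counit.app J := by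
    simp [i, toVerdier]
  rw [← this]
  infer_instance

/-- A criterion for `Rη^f` to be an isomorphism. -/
theorem inducesRightIso_of_resolutions (η : FactoredNatTrans θ γ)
    (hloc : injectiveComponents T ≤ (quasiIso N).isLocal)
    (hres : ∀ X, ∃ (J : K T) (f : X ⟶ J), injectiveComponents T J ∧ quasiIso N f)
    (hη : ∀ J, injectiveComponents T J → IsIso ((η.toD N').app J)) : InducesRightIso η N N' := by
  obtain ⟨heq, G, adj, hG⟩ := exists_localization_rightAdjoint hloc hres
  have hθ := exists_rightDerived (N' := N') θ adj hG
  have hγ := exists_rightDerived (N' := N') γ adj hG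
  refine ⟨heq, ⟨hθ.choose⟩, ⟨hγ.choose⟩, fun R S => ⟨computedByInjectives_of_exists hθ R,
    computedByInjectives_of_exists hγ S, ?_⟩⟩
  have h : ∀ J, injectiveComponents T J →
      IsIso ((RightDerived.map η R S).app ((toVerdier N).obj J)) := by
    intro J hJ
    have := R.isDerived
    have h₁ := computedByInjectives_of_exists hθ R J hJ
    have h₂ := computedByInjectives_of_exists hγ S J hJ
    have h₃ := hη J hJ
    -- In the square relating `η^f` and `Rη^f` at `J`, the two structure maps and `η^f` are
    -- invertible, hence so is `Rη^f`.
    have := Functor.rightDerivedNatTrans_app R.functor S.functor R.unit S.unit (quasiIso N)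
      (η.toD N') J
    refine IsIso.of_isIso_fac_left (f := R.unit.app J) (h := (η.toD N').app J ≫ S.unit.app J) this
  -- Each object of the quotient is isomorphic to the image of a factorization, hence to the image
  -- of one with injective components.
  refine NatTrans.isIso_iff_isIso_app _ |>.2 fun Y => ?_
  obtain ⟨J, f, hJ, hf⟩ := hres (((toVerdier N).objPreimage Y))
  have : IsIso ((toVerdier N).map f) := Localization.inverts (toVerdier N) (quasiIso N) f hf
  let i := ((toVerdier N).objObjPreimageIso Y).symm ≪≫ asIso ((toVerdier N).map f)
  have := h J hJ
  exact (NatTrans.isIso_app_iff_of_iso _ i).2 this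

/-- A criterion for `Lη^f` to be an isomorphism. -/
theorem inducesLeftIso_of_resolutions (η : FactoredNatTrans θ γ)
    (hloc : projectiveComponents T ≤ (quasiIso N).isColocal)
    (hres : ∀ X, ∃ (J : K T) (f : J ⟶ X), projectiveComponents T J ∧ quasiIso N f)
    (hη : ∀ J, projectiveComponents T J → IsIso ((η.toD N').app J)) : InducesLeftIso η N N' := by
  obtain ⟨heq, G, adj, hG⟩ := exists_localization_leftAdjoint hloc hres
  have hθ := exists_leftDerived (N' := N') θ adj hG
  have hγ := exists_leftDerived (N' := N') γ adj hG
  refine ⟨heq, ⟨hθ.choose⟩, ⟨hγ.choose⟩, fun R S => ⟨computedByProjectives_of_exists hθ R,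
    computedByProjectives_of_exists hγ S, ?_⟩⟩
  have h : ∀ J, projectiveComponents T J →
      IsIso ((LeftDerived.map η R S).app ((toVerdier N).obj J)) := by
    intro J hJ
    have := S.isDerived
    have h₁ := computedByProjectives_of_exists hθ R J hJ
    have h₂ := computedByProjectives_of_exists hγ S J hJ
    have h₃ := hη J hJ
    have := Functor.leftDerivedNatTrans_app R.functor S.functor R.counit S.counit (quasiIso N)
      (η.toD N') J
    have : IsIso ((LeftDerived.map η R S).app ((toVerdier N).obj J) ≫ S.counit.app J) := by
      erw [this]
      infer_instance
    exact IsIso.of_isIso_comp_right _ (S.counit.app J)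
  refine NatTrans.isIso_iff_isIso_app _ |>.2 fun Y => ?_
  obtain ⟨J, f, hJ, hf⟩ := hres (((toVerdier N).objPreimage Y))
  have : IsIso ((toVerdier N).map f) := Localization.inverts (toVerdier N) (quasiIso N) f hf
  let i := asIso ((toVerdier N).map f) ≪≫ (toVerdier N).objObjPreimageIso Y
  have := h J hJ
  exact (NatTrans.isIso_app_iff_of_iso _ i).1 this

end

end

section

/-! ### The ordinary derived functors on injective and projective objects -/

section

variable (L : HomologicalComplex₂ A (.up ℤ) (.up ℤ)) [L.HasTotal (.up ℤ)]

/-- Among the pairs `(i₁, i₂)` with sum `j`, only `(0, j)` contributes a nonzero summand. -/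
theorem isIso_ιTotal_zero (h : ∀ i, i ≠ 0 → IsZero (L.X i)) (j : ℤ) :
    IsIso (L.ιTotal (.up ℤ) 0 j j (zero_add j)) := by
  have : HasCoproduct (GradedObject.mapObjFun L.toGradedObject
    (ComplexShape.π (.up ℤ) (.up ℤ) (.up ℤ)) j) := inferInstanceAs (HasCoproduct _)
  refine isIso_sigmaι (GradedObject.mapObjFun L.toGradedObject
    (ComplexShape.π (.up ℤ) (.up ℤ) (.up ℤ)) j) ⟨(0, j), zero_add j⟩ ?_
  rintro ⟨⟨i₁, i₂⟩, hi⟩ hne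
  refine (HomologicalComplex.eval A (.up ℤ) i₂).map_isZero (h i₁ ?_)
  rintro rfl
  refine hne (Subtype.ext (Prod.ext rfl ?_))
  exact (zero_add i₂).symm.trans hi

/-- The inclusion of the column in degree `0`, if the next column vanishes. -/
@[simps]
def columnToTotal (h : ∀ i, i ≠ 0 → IsZero (L.X i)) : L.X 0 ⟶ L.total (.up ℤ) where
  f j := L.ιTotal (.up ℤ) 0 j j (zero_add j)
  comm' i j hij := by
    have h₀ : L.d 0 1 = 0 := (h 1 (by norm_num)).eq_of_tgt _ _
    simp only [HomologicalComplex₂.total_d, Preadditive.comp_add, HomologicalComplex₂.ι_D₁,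
      HomologicalComplex₂.ι_D₂]
    rw [L.d₁_eq' (.up ℤ) (show (ComplexShape.up ℤ).Rel 0 1 from rfl), h₀,
      L.d₂_eq (.up ℤ) 0 hij j (zero_add j)]
    simp

instance (h : ∀ i, i ≠ 0 → IsZero (L.X i)) : IsIso (columnToTotal L h) := by
  have : ∀ j, IsIso ((columnToTotal L h).f j) := isIso_ιTotal_zero L h
  exact HomologicalComplex.Hom.isIso_of_components _

variable {L}

/-- A morphism of bicomplexes which are concentrated in a single column is a quasi-isomorphism if
it is one on total complexes. -/
theorem quasiIso_column {L' : HomologicalComplex₂ A (.up ℤ) (.up ℤ)} [L'.HasTotal (.up ℤ)]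
    (h : ∀ i, i ≠ 0 → IsZero (L.X i)) (h' : ∀ i, i ≠ 0 → IsZero (L'.X i)) (f : L ⟶ L')
    (hf : QuasiIso (HomologicalComplex₂.total.map f (.up ℤ))) : QuasiIso (f.f 0) := by
  refine quasiIso_of_arrow_mk_iso (HomologicalComplex₂.total.map f (.up ℤ)) _
    (Arrow.isoMk (asIso (columnToTotal L h)) (asIso (columnToTotal L' h')) ?_).symm
  ext j
  simp

end

section

variable {B : Type u₂} [Category.{v₂} B] [Abelian B] {U : FactTriple B}
  {θ γ : FactoredFunctor T U} (η : FactoredNatTrans θ γ)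

/-- Applied to a complex in degree `0`, the functors to complexes give bicomplexes with a single
column, and the total complex is that column. -/
theorem quasiIso_app_of_isTotalQuasiIso {X : A} {I : CochainComplex A ℤ}
    (e : I.X 0 ≅ X) (hI : ∀ i, i ≠ 0 → IsZero (I.X i)) (h : η.IsTotalQuasiIso I) :
    QuasiIso (η.app.app X) := by
  obtain ⟨_, _, h⟩ := h
  have : QuasiIso (η.app.app (I.X 0)) := quasiIso_column (fun i hi => θ.F.map_isZero (hI i hi))
    (fun i hi => γ.F.map_isZero (hI i hi)) _ h
  refine quasiIso_of_arrow_mk_iso (η.app.app (I.X 0)) _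
    (Arrow.isoMk (θ.F.mapIso e) (γ.F.mapIso e) ?_)
  simp

/-- An injective object is its own resolution, of length zero, so the assumption on derived functors
becomes one on `η` itself. -/
theorem quasiIso_app_of_injective (h : η.InducesOrdinaryRightIsoFinite) {X : A} (hX : Injective X) :
    QuasiIso (η.app.app X) := by
  refine quasiIso_app_of_isTotalQuasiIso η
    ((InjectiveResolution.self X).cochainComplexXIso 0 0 rfl) (fun i hi => ?_)
    (h X (InjectiveResolution.self X) ⟨0, fun m hm =>
      HomologicalComplex.isZero_single_obj_X _ _ _ _ hm.ne'⟩)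
  by_cases hi' : 0 ≤ i
  · obtain ⟨k, rfl⟩ := Int.eq_ofNat_of_zero_le hi'
    exact (HomologicalComplex.isZero_single_obj_X _ _ _ _ (by simpa using hi)).of_iso
      ((InjectiveResolution.self X).cochainComplexXIso k k rfl)
  · exact CochainComplex.isZero_of_isStrictlyGE _ 0 _ (by lia)

theorem quasiIso_app_of_projective (h : η.InducesOrdinaryLeftIsoFinite) {X : A}
    (hX : Projective X) : QuasiIso (η.app.app X) := by
  refine quasiIso_app_of_isTotalQuasiIso η
    ((ProjectiveResolution.self X).cochainComplexXIso 0 0 rfl) (fun i hi => ?_)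
    (h X (ProjectiveResolution.self X) ⟨0, fun m hm =>
      HomologicalComplex.isZero_single_obj_X _ _ _ _ hm.ne'⟩)
  by_cases hi' : i ≤ 0
  · obtain ⟨k, rfl⟩ := Int.exists_eq_neg_ofNat hi'
    exact (HomologicalComplex.isZero_single_obj_X _ _ _ _ (by simpa using hi)).of_iso
      ((ProjectiveResolution.self X).cochainComplexXIso (-k) k rfl)
  · exact CochainComplex.isZero_of_isStrictlyLE _ 0 _ (by lia)

/-- At `J`, the map `η^f` is the totalization of a componentwise quasi-isomorphism `θ(J) ⟶ γ(J)`, so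
its cone lies in `N'` and the quotient functor inverts it. -/
theorem isIso_toD_app {N' : ObjectProperty (K U)} (hN : IsThick N')
    (hN' : ContainsExactTotalizations N') (J : K T) (h₁ : QuasiIso (η.app.app J.as.X₁))
    (h₀ : QuasiIso (η.app.app J.as.X₀)) : IsIso ((η.toD N').app J) :=
  Localization.inverts (toVerdier N') (quasiIso N') _
    ⟨totMap (η.complexMap J.as), rfl, hN.cone_totMap hN' _ h₁ h₀⟩

end

end

section

namespace Factorization

/-! ### Null-homotopic identities and cones -/

theorem null_id_cone_id (E : Factorization T) : Null (𝟙 (cone (𝟙 E))) := by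
  refine IsNullBy.null (s := T.Φ.functor.map (cone.snd₁ (𝟙 E)) ≫ cone.inl₀ (𝟙 E))
    (t := cone.snd₀ (𝟙 E) ≫ cone.inl₁ (𝟙 E)) ⟨?_, ?_⟩
  · apply cone.map_ext_from₁ <;> simp
  · apply cone.ext_from₀ <;> simp

/-- The cone of a morphism from zero. -/
def coneOfIsZeroSrc {E F : Factorization T} (hE : IsZero E) (g : E ⟶ F) : F ≅ cone g :=
  isoMk (cone.inr g)
    ⟨cone.inr₁ g, cone.snd₁ g, by simp, by
      have h : cone.inl₁ g = 0 := ((ev₀ T).map_isZero hE).eq_of_src _ _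
      rw [← cone.total₁, h, comp_zero, zero_add]⟩
    ⟨cone.inr₀ g, cone.snd₀ g, by simp, by
      have h : cone.inl₀ g = 0 := (T.Φ.functor.map_isZero ((ev₁ T).map_isZero hE)).eq_of_src _ _
      rw [← cone.total₀, h, comp_zero, zero_add]⟩ rfl rfl

/-- The cone of a morphism to zero. -/
def coneOfIsZeroTgt {E F : Factorization T} (hF : IsZero F) (g : E ⟶ F) :
    cone g ≅ (shift T).obj E :=
  isoMk (cone.fst g)
    ⟨cone.fst₁ g, cone.inl₁ g, by
      have h : cone.inr₁ g = 0 := ((ev₁ T).map_isZero hF).eq_of_src _ _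
      rw [← cone.total₁, h, comp_zero, add_zero], by simp⟩
    ⟨cone.fst₀ g, cone.inl₀ g, by
      have h : cone.inr₀ g = 0 := ((ev₀ T).map_isZero hF).eq_of_src _ _
      rw [← cone.total₀, h, comp_zero, add_zero], by simp⟩ rfl rfl

/-! ### Cokernels and kernels -/

/-- The componentwise cokernel. -/
def coker {E F : Factorization T} (f : E ⟶ F) : Factorization T where
  X₁ := cokernel f.f₁
  X₀ := cokernel f.f₀
  d₁ := cokernel.map _ _ E.d₁ F.d₁ f.comm₁
  d₀ := cokernel.desc _ (F.d₀ ≫ T.Φ.functor.map (cokernel.π f.f₁)) (by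
    rw [f.comm₀_assoc, ← Functor.map_comp, cokernel.condition, Functor.map_zero, comp_zero])
  d₁_d₀ := by
    rw [← cancel_epi (cokernel.π f.f₁)]
    simp [T.w_nat]
  d₀_d₁ := by
    rw [← cancel_epi (cokernel.π f.f₀), T.w_nat, cokernel.π_desc_assoc, Category.assoc,
      ← Functor.map_comp, cokernel.π_desc, Functor.map_comp, d₀_d₁_assoc]

/-- The projection to the cokernel. -/
def toCoker {E F : Factorization T} (f : E ⟶ F) : F ⟶ coker f where
  f₁ := cokernel.π f.f₁
  f₀ := cokernel.π f.f₀
  comm₁ := cokernel.π_desc _ _ _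
  comm₀ := cokernel.π_desc _ _ _

theorem comp_toCoker {E F : Factorization T} (f : E ⟶ F) : f ≫ toCoker f = 0 :=
  hom_ext (cokernel.condition _) (cokernel.condition _)

theorem shortExact_cokernel {X Y : A} {f : X ⟶ Y} (hf : Mono f) (w : f ≫ cokernel.π f = 0) :
    (ShortComplex.mk f (cokernel.π f) w).ShortExact where
  exact := ShortComplex.exact_cokernel f

theorem kernelLift_iso_inv_comp {X Y Z : A} (f : X ⟶ Y) (k : Z ⟶ T.Φ.functor.obj X)
    (h : k ≫ T.Φ.functor.map f = 0) :
    (kernel.lift (T.Φ.functor.map f) k h ≫ (PreservesKernel.iso T.Φ.functor f).inv) ≫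
      T.Φ.functor.map (kernel.ι f) = k := by
  rw [Category.assoc, PreservesKernel.iso_inv_ι, kernel.lift_ι]

/-- The componentwise kernel. -/
def ker {E F : Factorization T} (f : E ⟶ F) : Factorization T where
  X₁ := kernel f.f₁
  X₀ := kernel f.f₀
  d₁ := kernel.map _ _ E.d₁ F.d₁ f.comm₁
  d₀ := kernel.lift (T.Φ.functor.map f.f₁) (kernel.ι f.f₀ ≫ E.d₀) (by
    rw [Category.assoc, ← f.comm₀, kernel.condition_assoc, zero_comp]) ≫
      (PreservesKernel.iso T.Φ.functor f.f₁).inv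
  d₁_d₀ := by
    rw [← cancel_mono (T.Φ.functor.map (kernel.ι f.f₁)), ← T.w_nat, Category.assoc, Category.assoc,
      PreservesKernel.iso_inv_ι, kernel.lift_ι, kernel.lift_ι_assoc, Category.assoc, d₁_d₀]
  d₀_d₁ := by
    rw [← cancel_mono (T.Φ.functor.map (kernel.ι f.f₀)), ← T.w_nat, Category.assoc, Category.assoc,
      ← Functor.map_comp, kernel.lift_ι, Functor.map_comp, PreservesKernel.iso_inv_ι_assoc,
      kernel.lift_ι_assoc, Category.assoc, d₀_d₁]

/-- The inclusion of the kernel. -/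
def fromKer {E F : Factorization T} (f : E ⟶ F) : ker f ⟶ E where
  f₁ := kernel.ι f.f₁
  f₀ := kernel.ι f.f₀
  comm₁ := (kernel.lift_ι _ _ _).symm
  comm₀ := (kernelLift_iso_inv_comp _ _ _).symm

theorem fromKer_comp {E F : Factorization T} (f : E ⟶ F) : fromKer f ≫ f = 0 :=
  hom_ext (kernel.condition _) (kernel.condition _)

theorem shortExact_kernel {X Y : A} {f : X ⟶ Y} (hf : Epi f) (w : kernel.ι f ≫ f = 0) :
    (ShortComplex.mk (kernel.ι f) f w).ShortExact where
  exact := ShortComplex.exact_kernel f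

/-! ### Contractible factorizations with injective or projective components -/

variable (T) in
/-- The contractible factorization with components `X ⊞ Y` and `Φ X ⊞ Y`. -/
abbrev cofree (X Y : A) : Factorization T where
  X₁ := X ⊞ Y
  X₀ := T.Φ.functor.obj X ⊞ Y
  d₁ := biprod.map (T.w.app X) (𝟙 Y)
  d₀ := biprod.desc (T.Φ.functor.map biprod.inl) (T.w.app Y ≫ T.Φ.functor.map biprod.inr)
  d₁_d₀ := by
    apply biprod.hom_ext' <;> simp [T.w_nat]
  d₀_d₁ := by
    apply biprod.hom_ext'
    · simp [T.w_nat, ← Functor.map_comp, T.w_map]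
    · simp [T.w_nat, ← Functor.map_comp]

/-- The morphism to a cofree factorization given by its components. -/
def toCofree {E : Factorization T} {X Y : A} (a : E.X₁ ⟶ X) (b : E.X₀ ⟶ Y) : E ⟶ cofree T X Y where
  f₁ := biprod.lift a (E.d₁ ≫ b)
  f₀ := biprod.lift (E.d₀ ≫ T.Φ.functor.map a) b
  comm₁ := by
    apply biprod.hom_ext
    · simp [← T.w_nat]
    · simp
  comm₀ := by
    have h : biprod.lift a (E.d₁ ≫ b) = a ≫ biprod.inl + (E.d₁ ≫ b) ≫ biprod.inr := by
      apply biprod.hom_ext <;> simp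
    rw [h]
    simp [biprod.lift_desc]
    rw [← Category.assoc, T.w_nat, Category.assoc]

/-- The morphism from a cofree factorization given by its components. -/
def ofCofree {E : Factorization T} {X Y : A} (a : T.Φ.functor.obj X ⟶ E.X₀) (b : Y ⟶ E.X₁)
    (p : X ⟶ E.X₁) (hp : T.Φ.functor.map p = a ≫ E.d₀) : cofree T X Y ⟶ E where
  f₁ := biprod.desc p b
  f₀ := biprod.desc a (b ≫ E.d₁)
  comm₁ := by
    apply biprod.hom_ext'
    · apply T.Φ.functor.map_injective
      simp [hp, ← T.w_nat, ← T.w_map]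
    · simp
  comm₀ := by
    apply biprod.hom_ext'
    · simp [← Functor.map_comp, hp]
    · simp [← T.w_nat]

/-- The cofree factorization on injectives containing `E₁` and `E₀` has injective components. Each
component of the map to it is monic because one of its two coordinates already is the chosen
embedding. -/
theorem exists_mono_to_injective [EnoughInjectives A] (E : Factorization T) :
    ∃ (I : Factorization T) (f : E ⟶ I), Injective I.X₁ ∧ Injective I.X₀ ∧ Mono f.f₁ ∧ Mono f.f₀ := by
  let f : E ⟶ cofree T (Injective.under E.X₁) (Injective.under E.X₀) :=
    toCofree (Injective.ι E.X₁) (Injective.ι E.X₀)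
  have := injective_Φ (T := T) (X := Injective.under E.X₁) inferInstance
  have h₁ : f.f₁ ≫ biprod.fst = Injective.ι E.X₁ := biprod.lift_fst _ _
  have h₀ : f.f₀ ≫ biprod.snd = Injective.ι E.X₀ := biprod.lift_snd _ _
  exact ⟨_, f, inferInstanceAs (Injective (Injective.under E.X₁ ⊞ Injective.under E.X₀)),
    inferInstanceAs (Injective (T.Φ.functor.obj (Injective.under E.X₁) ⊞ Injective.under E.X₀)),
    mono_of_mono_fac h₁, mono_of_mono_fac h₀⟩

/-- The dual uses the same contractible factorization, now with first parameter `Φ⁻¹` of a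
projective over `E₀`, so that its degree `0` part maps onto `E₀`, while the second parameter maps
onto `E₁`. -/
theorem exists_epi_from_projective [EnoughProjectives A] (E : Factorization T) :
    ∃ (P : Factorization T) (f : P ⟶ E), Projective P.X₁ ∧ Projective P.X₀ ∧
      Epi f.f₁ ∧ Epi f.f₀ := by
  let a := T.Φ.counit.app (Projective.over E.X₀) ≫ Projective.π E.X₀
  obtain ⟨p, hp⟩ := T.Φ.functor.map_surjective (a ≫ E.d₀)
  let f : cofree T (T.Φ.inverse.obj (Projective.over E.X₀)) (Projective.over E.X₁) ⟶ E :=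
    ofCofree a (Projective.π E.X₁) p hp
  have h := projective_Φ_inv (T := T) (X := Projective.over E.X₀) inferInstance
  have := projective_Φ (T := T) h
  have : Epi (T.Φ.counit.app (Projective.over E.X₀)) :=
    (inferInstance : Epi (T.Φ.counitIso.app (Projective.over E.X₀)).hom)
  have : Epi a := epi_comp _ _
  have h₁ : biprod.inr ≫ f.f₁ = Projective.π E.X₁ := biprod.inr_desc _ _
  have h₀ : biprod.inl ≫ f.f₀ = a := biprod.inl_desc _ _
  exact ⟨_, f, inferInstanceAs (Projective (T.Φ.inverse.obj (Projective.over E.X₀) ⊞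
      Projective.over E.X₁)),
    inferInstanceAs (Projective (T.Φ.functor.obj (T.Φ.inverse.obj (Projective.over E.X₀)) ⊞
      Projective.over E.X₁)),
    epi_of_epi_fac h₁, epi_of_epi_fac h₀⟩

/-- The morphism `E ⟶ (cone h)[-1]` given by `f : E ⟶ F` with `f ≫ h = 0`. -/
def toUnshiftCone {E F G : Factorization T} (f : E ⟶ F) (h : F ⟶ G) (w : f ≫ h = 0) :
    E ⟶ (unshift T).obj (cone h) :=
  (unshiftShift E).inv ≫ (unshift T).map (shiftToCone f h w)

/-- Makes the factorization through `F.X₁` visible; with injective middle term this is the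
factorization used in `exists_monoViaInjective`. -/
theorem toUnshiftCone_f₁ {E F G : Factorization T} (f : E ⟶ F) (h : F ⟶ G) (w : f ≫ h = 0) :
    (toUnshiftCone f h w).f₁ = f.f₁ ≫ T.Φ.unit.app F.X₁ ≫ T.Φ.inverse.map (cone.inl₀ h) := by
  have := T.Φ.unit.naturality f.f₁
  dsimp at this
  rw [reassoc_of% this, ← Functor.map_comp]
  rfl

theorem toUnshiftCone_f₀ {E F G : Factorization T} (f : E ⟶ F) (h : F ⟶ G) (w : f ≫ h = 0) :
    (toUnshiftCone f h w).f₀ = f.f₀ ≫ cone.inl₁ h :=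
  Category.id_comp _

theorem shift_map_toUnshiftCone {E F G : Factorization T} (f : E ⟶ F) (h : F ⟶ G) (w : f ≫ h = 0) :
    (shift T).map (toUnshiftCone f h w) ≫ (shiftUnshift _).hom = shiftToCone f h w := by
  ext
  · simp [toUnshiftCone, unshiftShift, shiftUnshift]
  · simp [toUnshiftCone, unshiftShift, shiftUnshift]

end Factorization

namespace IsThick

variable {N : ObjectProperty (K T)} (hN : IsThick N)
include hN

/-- Such an `E` is zero in the homotopy category, hence a retract of any object; `F` only provides
some object of `N`. -/
theorem of_null_id {E F : Factorization T} (hE : Null (𝟙 E)) (hF : N ((K.of T).obj F)) :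
    N ((K.of T).obj E) := by
  have := hN.retract
  refine N.prop_of_retract ⟨(K.of T).map (0 : E ⟶ F), (K.of T).map 0, ?_⟩ hF
  rw [← Functor.map_comp, comp_zero, eq_comm, ← (K.of T).map_id]
  exact (K.map_eq_iff _ _).2 (by rwa [sub_zero])

/-- Two out of three follows from `cone_comp` by precomposing with the map from zero, since the cone
of a map `0 ⟶ F` is `F`. -/
theorem of_cone_of_src {E F : Factorization T} (g : E ⟶ F)
    (hg : N ((K.of T).obj (Factorization.cone g))) (hE : N ((K.of T).obj E)) :
    N ((K.of T).obj F) :=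
  have hZ := isZero_zero (Factorization T)
  hN.of_iso (coneOfIsZeroSrc hZ (0 ≫ g)).symm
    (hN.cone_comp 0 g (hN.of_iso (coneOfIsZeroSrc hZ 0) hE) hg)

theorem of_cone_of_tgt {E F : Factorization T} (g : E ⟶ F)
    (hg : N ((K.of T).obj (Factorization.cone g))) (hF : N ((K.of T).obj F)) :
    N ((K.of T).obj E) :=
  have hZ := isZero_zero (Factorization T)
  (hN.shift_iff E).1 (hN.of_iso (coneOfIsZeroTgt hZ (g ≫ 0))
    (hN.cone_comp g 0 hg (hN.of_iso (coneOfIsZeroTgt hZ 0).symm ((hN.shift_iff F).2 hF))))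

/-- Shifting turns `toUnshiftCone` into `shiftToCone`, whose cone is isomorphic to that of `coneTo`.
-/
theorem cone_toUnshiftCone_iff {X Y Z : Factorization T} (f : X ⟶ Y) (h : Y ⟶ Z) (w : f ≫ h = 0) :
    N ((K.of T).obj (Factorization.cone (toUnshiftCone f h w))) ↔
      N ((K.of T).obj (Factorization.cone (coneTo f h w))) := by
  rw [← hN.cone_shiftToCone, ← hN.cone_shift_iff]
  have e : Factorization.cone ((Factorization.shift T).map (toUnshiftCone f h w)) ≅
      Factorization.cone (shiftToCone f h w) :=
    coneMapIso (Iso.refl _) (shiftUnshift _)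
      ((shift_map_toUnshiftCone f h w).trans (Category.id_comp _).symm)
  exact ⟨hN.of_iso e, hN.of_iso e.symm⟩

-- `IsThick` does not demand nonemptiness, so a first object of `N` has to come from exact
-- totalizations, here through the exact sequence of zero objects. The cone of an identity is
-- contractible and is a retract of it.
open scoped ZeroObject in
theorem cone_id (hN' : ContainsExactTotalizations N) (E : Factorization T) :
    N ((K.of T).obj (Factorization.cone (𝟙 E))) := by
  have hZ : IsZero (0 : Factorization T) := isZero_zero _
  have h : ∀ {X Y Z : A} (f : X ⟶ Y) (g : Y ⟶ Z) (w : f ≫ g = 0), IsZero X → IsZero Y → IsZero Z →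
      (ShortComplex.mk f g w).ShortExact := fun f g w hX hY hZ =>
    { exact := ShortComplex.exact_of_isZero_X₂ _ hY
      mono_f := ⟨fun _ _ _ => hX.eq_of_tgt _ _⟩
      epi_g := ⟨fun _ _ _ => hZ.eq_of_src _ _⟩ }
  have h₁ := (ev₁ T).map_isZero hZ
  have h₀ := (ev₀ T).map_isZero hZ
  exact hN.of_null_id (null_id_cone_id E) (hN.cone_coneTo hN' (0 : (0 : Factorization T) ⟶ 0)
    (0 : (0 : Factorization T) ⟶ 0) zero_comp (h _ _ _ h₁ h₁ h₁) (h _ _ _ h₀ h₀ h₀))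

end IsThick

end

/-! ### Splicing resolutions along short exact sequences -/

section

namespace IsThick

variable {N : ObjectProperty (K T)} (hN : IsThick N)
include hN

/-- The induction step for injective resolutions: when `q` resolves the quotient `Z`, the map
`coneTo f (h ≫ q)` is `coneTo f h` followed by `q`, and both have cone in `N`. -/
theorem cone_toUnshiftCone_comp (hN' : ContainsExactTotalizations N) {X Y Z J : Factorization T}
    {f : X ⟶ Y} {h : Y ⟶ Z} (w : f ≫ h = 0)
    (h₁ : (ShortComplex.mk f.f₁ h.f₁ (congrArg Hom.f₁ w)).ShortExact)
    (h₀ : (ShortComplex.mk f.f₀ h.f₀ (congrArg Hom.f₀ w)).ShortExact)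
    (q : Z ⟶ J) (hq : N ((K.of T).obj (Factorization.cone q))) (w' : f ≫ h ≫ q = 0) :
    N ((K.of T).obj (Factorization.cone (toUnshiftCone f (h ≫ q) w'))) := by
  rw [hN.cone_toUnshiftCone_iff]
  have : coneTo f (h ≫ q) w' = coneTo f h w ≫ q := by
    apply hom_ext
    · apply cone.ext_from₁ <;> simp [coneTo, cone.desc]
    · apply cone.ext_from₀ <;> simp [coneTo, cone.desc]
  rw [this]
  exact hN.cone_comp _ _ (hN.cone_coneTo hN' f h w h₁ h₀) hq

/-- The induction step for projective resolutions: `q` resolves the subobject `X`, and its shift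
precedes `shiftToCone f h`. -/
theorem cone_comp_coneTo (hN' : ContainsExactTotalizations N) {X Y Z Q : Factorization T}
    {f : X ⟶ Y} {h : Y ⟶ Z} (w : f ≫ h = 0)
    (h₁ : (ShortComplex.mk f.f₁ h.f₁ (congrArg Hom.f₁ w)).ShortExact)
    (h₀ : (ShortComplex.mk f.f₀ h.f₀ (congrArg Hom.f₀ w)).ShortExact)
    (q : Q ⟶ X) (hq : N ((K.of T).obj (Factorization.cone q))) (w' : (q ≫ f) ≫ h = 0) :
    N ((K.of T).obj (Factorization.cone (coneTo (q ≫ f) h w'))) := by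
  rw [← hN.cone_shiftToCone]
  have : shiftToCone (q ≫ f) h w' = (Factorization.shift T).map q ≫ shiftToCone f h w := by
    apply hom_ext <;> simp [shiftToCone]
  rw [this]
  exact hN.cone_comp _ _ ((hN.cone_shift_iff q).2 hq)
    ((hN.cone_shiftToCone f h w).2 (hN.cone_coneTo hN' f h w h₁ h₀))

end IsThick

theorem injective_cone {E F : Factorization T} (g : E ⟶ F) (hE₁ : Injective E.X₁)
    (hE₀ : Injective E.X₀) (hF₁ : Injective F.X₁) (hF₀ : Injective F.X₀) :
    Injective (cone g).X₁ ∧ Injective (cone g).X₀ :=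
  have := injective_Φ (T := T) hE₁
  ⟨inferInstanceAs (Injective (E.X₀ ⊞ F.X₁)), inferInstanceAs (Injective (T.Φ.functor.obj E.X₁ ⊞ F.X₀))⟩

theorem projective_cone {E F : Factorization T} (g : E ⟶ F) (hE₁ : Projective E.X₁)
    (hE₀ : Projective E.X₀) (hF₁ : Projective F.X₁) (hF₀ : Projective F.X₀) :
    Projective (cone g).X₁ ∧ Projective (cone g).X₀ :=
  have := projective_Φ (T := T) hE₁
  ⟨inferInstanceAs (Projective (E.X₀ ⊞ F.X₁)),
    inferInstanceAs (Projective (T.Φ.functor.obj E.X₁ ⊞ F.X₀))⟩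

/-! ### Finite resolutions -/

/-- Induction on a common bound for the injective dimensions of the two components. With `E`
embedded in `I` and `q` resolving the cokernel, which has smaller dimension, the shifted cone of `I
⟶ coker ⟶ J` resolves `E`. -/
theorem exists_injective_of_hasInjectiveDimensionLT [EnoughInjectives A]
    {N : ObjectProperty (K T)} (hN : IsThick N) (hN' : ContainsExactTotalizations N) (n : ℕ) :
    ∀ E : Factorization T, HasInjectiveDimensionLT E.X₁ (n + 1) →
      HasInjectiveDimensionLT E.X₀ (n + 1) →
      ∃ (J : Factorization T) (f : E ⟶ J), Injective J.X₁ ∧ Injective J.X₀ ∧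
        N ((K.of T).obj (cone f)) := by
  induction n with
  | zero =>
    exact fun E h₁ h₀ => ⟨E, 𝟙 E, injective_iff_hasInjectiveDimensionLT_one.2 h₁,
      injective_iff_hasInjectiveDimensionLT_one.2 h₀, hN.cone_id hN' E⟩
  | succ n ih =>
    intro E h₁ h₀
    obtain ⟨I, f, hI₁, hI₀, hf₁, hf₀⟩ := exists_mono_to_injective E
    have s₁ := shortExact_cokernel hf₁ (cokernel.condition _)
    have s₀ := shortExact_cokernel hf₀ (cokernel.condition _)
    obtain ⟨J, q, hJ₁, hJ₀, hq⟩ := ih (coker f) ((s₁.hasInjectiveDimensionLT_X₃_iff n hI₁).2 h₁)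
      ((s₀.hasInjectiveDimensionLT_X₃_iff n hI₀).2 h₀)
    have hw := comp_toCoker f
    have h := injective_cone (toCoker f ≫ q) hI₁ hI₀ hJ₁ hJ₀
    refine ⟨(unshift T).obj (cone (toCoker f ≫ q)), toUnshiftCone f (toCoker f ≫ q) ?_,
      injective_Φ_inv h.2, h.1, hN.cone_toUnshiftCone_comp hN' hw s₁ s₀ q hq _⟩
    rw [← Category.assoc, hw, zero_comp]

theorem exists_projective_of_hasProjectiveDimensionLT [EnoughProjectives A]
    {N : ObjectProperty (K T)} (hN : IsThick N) (hN' : ContainsExactTotalizations N) (n : ℕ) :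
    ∀ E : Factorization T, HasProjectiveDimensionLT E.X₁ (n + 1) →
      HasProjectiveDimensionLT E.X₀ (n + 1) →
      ∃ (J : Factorization T) (f : J ⟶ E), Projective J.X₁ ∧ Projective J.X₀ ∧
        N ((K.of T).obj (cone f)) := by
  induction n with
  | zero =>
    exact fun E h₁ h₀ => ⟨E, 𝟙 E, projective_iff_hasProjectiveDimensionLT_one.2 h₁,
      projective_iff_hasProjectiveDimensionLT_one.2 h₀, hN.cone_id hN' E⟩
  | succ n ih =>
    intro E h₁ h₀
    obtain ⟨P, f, hP₁, hP₀, hf₁, hf₀⟩ := exists_epi_from_projective E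
    have s₁ := shortExact_kernel hf₁ (kernel.condition _)
    have s₀ := shortExact_kernel hf₀ (kernel.condition _)
    obtain ⟨J, q, hJ₁, hJ₀, hq⟩ := ih (ker f) ((s₁.hasProjectiveDimensionLT_X₃_iff n hP₁).1 h₁)
      ((s₀.hasProjectiveDimensionLT_X₃_iff n hP₀).1 h₀)
    have hw := fromKer_comp f
    have h := projective_cone (q ≫ fromKer f) hJ₁ hJ₀ hP₁ hP₀
    refine ⟨cone (q ≫ fromKer f), coneTo (q ≫ fromKer f) f ?_, h.1, h.2,
      hN.cone_comp_coneTo hN' hw s₁ s₀ q hq _⟩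
    rw [Category.assoc, hw, comp_zero]

/-- Classes in `Ext^i(Y, X)` are represented by morphisms from `Y` to the degree `i` term of `I`,
which is zero for `i > n`. -/
theorem hasInjectiveDimensionLT_of_resolution {X : A} (I : InjectiveResolution X) {n : ℕ}
    (h : ∀ m, n < m → IsZero (I.cocomplex.X m)) : HasInjectiveDimensionLT X (n + 1) := by
  let := HasExt.standard A
  refine HasInjectiveDimensionLT.mk fun i hi Y e => ?_
  obtain ⟨f, hf, rfl⟩ := I.extMk_surjective e (i + 1) rfl
  obtain rfl := (h i hi).eq_of_tgt f 0
  exact I.extMk_zero (i + 1) rfl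

theorem hasProjectiveDimensionLT_of_resolution {X : A} (P : ProjectiveResolution X) {n : ℕ}
    (h : ∀ m, n < m → IsZero (P.complex.X m)) : HasProjectiveDimensionLT X (n + 1) := by
  let := HasExt.standard A
  refine HasProjectiveDimensionLT.mk fun i hi Y e => ?_
  obtain ⟨f, hf, rfl⟩ := P.extMk_surjective e (i + 1) rfl
  obtain rfl := (h i hi).eq_of_src f 0
  exact P.extMk_zero (i + 1) rfl

theorem enoughInjectives_of_resolutions (h : ∀ X : A, Nonempty (InjectiveResolution X)) :
    EnoughInjectives A where
  presentation X :=
    have I := (h X).some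
    have hι : Mono (I.ι.f 0) := inferInstance
    ⟨{ J := I.cocomplex.X 0, injective := I.injective 0, f := I.ι.f 0, mono := hι }⟩

theorem enoughProjectives_of_resolutions (h : ∀ X : A, Nonempty (ProjectiveResolution X)) :
    EnoughProjectives A where
  presentation X :=
    have P := (h X).some
    have hπ : Epi (P.π.f 0) := inferInstance
    ⟨{ p := P.complex.X 0, projective := P.projective 0, f := P.π.f 0, epi := hπ }⟩

theorem exists_quasiIso_injectiveComponents
    (h : ∀ X : A, ∃ (I : InjectiveResolution X) (n : ℕ), ∀ m, n < m → IsZero (I.cocomplex.X m))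
    {N : ObjectProperty (K T)} (hN : IsThick N) (hN' : ContainsExactTotalizations N) (X : K T) :
    ∃ (J : K T) (f : X ⟶ J), injectiveComponents T J ∧ quasiIso N f := by
  have := enoughInjectives_of_resolutions fun X => ⟨(h X).choose⟩
  obtain ⟨I₁, n₁, h₁⟩ := h X.as.X₁
  obtain ⟨I₀, n₀, h₀⟩ := h X.as.X₀
  obtain ⟨J, f, hJ₁, hJ₀, hf⟩ := exists_injective_of_hasInjectiveDimensionLT hN hN' (max n₁ n₀) X.as
    (hasInjectiveDimensionLT_of_resolution I₁ fun m hm => h₁ m (lt_of_le_of_lt (le_max_left _ _) hm))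
    (hasInjectiveDimensionLT_of_resolution I₀ fun m hm => h₀ m (lt_of_le_of_lt (le_max_right _ _) hm))
  exact ⟨(K.of T).obj J, (K.of T).map f, ⟨hJ₁, hJ₀⟩, f, rfl, hf⟩

theorem exists_quasiIso_projectiveComponents
    (h : ∀ X : A, ∃ (P : ProjectiveResolution X) (n : ℕ), ∀ m, n < m → IsZero (P.complex.X m))
    {N : ObjectProperty (K T)} (hN : IsThick N) (hN' : ContainsExactTotalizations N) (X : K T) :
    ∃ (J : K T) (f : J ⟶ X), projectiveComponents T J ∧ quasiIso N f := by
  have := enoughProjectives_of_resolutions fun X => ⟨(h X).choose⟩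
  obtain ⟨P₁, n₁, h₁⟩ := h X.as.X₁
  obtain ⟨P₀, n₀, h₀⟩ := h X.as.X₀
  obtain ⟨J, f, hJ₁, hJ₀, hf⟩ := exists_projective_of_hasProjectiveDimensionLT hN hN' (max n₁ n₀) X.as
    (hasProjectiveDimensionLT_of_resolution P₁ fun m hm => h₁ m (lt_of_le_of_lt (le_max_left _ _) hm))
    (hasProjectiveDimensionLT_of_resolution P₀ fun m hm => h₀ m (lt_of_le_of_lt (le_max_right _ _) hm))
  exact ⟨(K.of T).obj J, (K.of T).map f, ⟨hJ₁, hJ₀⟩, f, rfl, hf⟩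

end

section

/-! ### Sequential colimits and limits in an abelian category -/

/-- `c` exhibits `L` as the colimit of the sequence `x`. -/
structure IsSeqColim {X : ℕ → A} (x : ∀ n, X n ⟶ X (n + 1)) {L : A} (c : ∀ n, X n ⟶ L) : Prop where
  w : ∀ n, x n ≫ c (n + 1) = c n
  hom_ext : ∀ {W : A} (k k' : L ⟶ W), (∀ n, c n ≫ k = c n ≫ k') → k = k'
  exists_desc : ∀ {W : A} (k : ∀ n, X n ⟶ W), (∀ n, x n ≫ k (n + 1) = k n) →
    ∃ l, ∀ n, c n ≫ l = k n

/-- `c` exhibits `L` as the limit of the sequence `x`. -/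
structure IsSeqLim {X : ℕ → A} (x : ∀ n, X (n + 1) ⟶ X n) {L : A} (c : ∀ n, L ⟶ X n) : Prop where
  w : ∀ n, c (n + 1) ≫ x n = c n
  hom_ext : ∀ {W : A} (k k' : W ⟶ L), (∀ n, k ≫ c n = k' ≫ c n) → k = k'
  exists_lift : ∀ {W : A} (k : ∀ n, W ⟶ X n), (∀ n, k (n + 1) ≫ x n = k n) →
    ∃ l, ∀ n, l ≫ c n = k n

namespace IsSeqColim

theorem congr {X : ℕ → A} {x x' : ∀ n, X n ⟶ X (n + 1)} {L : A} {c c' : ∀ n, X n ⟶ L}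
    (h : IsSeqColim x c) (hx : ∀ n, x' n = x n) (hc : ∀ n, c' n = c n) : IsSeqColim x' c' := by
  obtain rfl := funext hx
  obtain rfl := funext hc
  exact h

/-- Compatibility forces the maps on the constant summand `Z` to be the same at every index, so
index `0` determines them. -/
theorem biprod {X : ℕ → A} {x : ∀ n, X n ⟶ X (n + 1)} {L : A} {c : ∀ n, X n ⟶ L}
    (h : IsSeqColim x c) (Z : A) : IsSeqColim (X := fun n => Z ⊞ X n)
      (fun n => biprod.map (𝟙 Z) (x n)) (fun n => biprod.map (𝟙 Z) (c n)) where
  w n := by apply biprod.hom_ext' <;> simp [reassoc_of% h.w n]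
  hom_ext k k' hk := by
    apply biprod.hom_ext'
    · simpa using biprod.inl ≫= hk 0
    · exact h.hom_ext _ _ fun n => by simpa using biprod.inr ≫= hk n
  exists_desc k hk := by
    obtain ⟨l, hl⟩ := h.exists_desc (fun n => biprod.inr ≫ k n) fun n => by
      rw [← hk n]; simp
    refine ⟨biprod.desc (biprod.inl ≫ k 0) l, fun n => biprod.hom_ext' _ _ ?_ ?_⟩
    · have h0 : biprod.inl ≫ k n = biprod.inl ≫ k 0 := by
        induction n with
        | zero => rfl
        | succ n ih => rw [← ih, ← hk n]; simp
      simp [h0]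
    · simp [hl]

/-- A sequence whose transition maps factor through `I n` has the same colimit as the `I n`. -/
theorem of_factor {X I : ℕ → A} (a : ∀ n, X n ⟶ I n) (b : ∀ n, I n ⟶ X (n + 1)) {L : A}
    {c : ∀ n, X n ⟶ L} (h : IsSeqColim (fun n => a n ≫ b n) c) :
    IsSeqColim (fun n => b n ≫ a (n + 1)) (fun n => b n ≫ c (n + 1)) where
  w n := by
    have := h.w (n + 1)
    simp only [Category.assoc] at this ⊢
    rw [this]
  hom_ext k k' hk := h.hom_ext _ _ fun n => by
    have := h.w n
    rw [← this]
    simpa using a n ≫= hk n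
  exists_desc k hk := by
    obtain ⟨l, hl⟩ := h.exists_desc (fun n => a n ≫ k n) fun n => by
      rw [← hk n]; simp
    refine ⟨l, fun n => ?_⟩
    rw [Category.assoc, hl, ← Category.assoc]
    exact hk n

end IsSeqColim

namespace IsSeqLim

theorem congr {X : ℕ → A} {x x' : ∀ n, X (n + 1) ⟶ X n} {L : A} {c c' : ∀ n, L ⟶ X n}
    (h : IsSeqLim x c) (hx : ∀ n, x' n = x n) (hc : ∀ n, c' n = c n) : IsSeqLim x' c' := by
  obtain rfl := funext hx
  obtain rfl := funext hc
  exact h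

/-- Limits of sequences commute with `· ⊞ Z`. -/
theorem biprod {X : ℕ → A} {x : ∀ n, X (n + 1) ⟶ X n} {L : A} {c : ∀ n, L ⟶ X n}
    (h : IsSeqLim x c) (Z : A) : IsSeqLim (X := fun n => X n ⊞ Z)
      (fun n => biprod.map (x n) (𝟙 Z)) (fun n => biprod.map (c n) (𝟙 Z)) where
  w n := by apply biprod.hom_ext <;> simp [h.w n]
  hom_ext k k' hk := by
    apply biprod.hom_ext
    · exact h.hom_ext _ _ fun n => by simpa using hk n =≫ biprod.fst
    · simpa using hk 0 =≫ biprod.snd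
  exists_lift k hk := by
    obtain ⟨l, hl⟩ := h.exists_lift (fun n => k n ≫ biprod.fst) fun n => by
      rw [← hk n]; simp
    refine ⟨biprod.lift l (k 0 ≫ biprod.snd), fun n => biprod.hom_ext _ _ ?_ ?_⟩
    · simp [hl]
    · have h0 : k n ≫ biprod.snd = k 0 ≫ biprod.snd := by
        induction n with
        | zero => rfl
        | succ n ih => rw [← ih, ← hk n]; simp
      simp [h0]

/-- A sequence whose transition maps factor through `P n` has the same limit as the `P n`. -/
theorem of_factor {X P : ℕ → A} (a : ∀ n, P n ⟶ X n) (b : ∀ n, X (n + 1) ⟶ P n) {L : A}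
    {c : ∀ n, L ⟶ X n} (h : IsSeqLim (fun n => b n ≫ a n) c) :
    IsSeqLim (fun n => a (n + 1) ≫ b n) (fun n => c (n + 1) ≫ b n) where
  w n := by
    have := h.w (n + 1)
    simp only [Category.assoc] at this ⊢
    rw [reassoc_of% this]
  hom_ext k k' hk := h.hom_ext _ _ fun n => by
    have := h.w n
    rw [← this]
    simpa using hk n =≫ a n
  exists_lift k hk := by
    obtain ⟨l, hl⟩ := h.exists_lift (fun n => k n ≫ a n) fun n => by
      rw [← hk n]; simp
    refine ⟨l, fun n => ?_⟩
    rw [← Category.assoc, hl, Category.assoc]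
    exact hk n

end IsSeqLim

section Coproduct

variable [HasCoproductsOfShape ℕ A]

/-- The morphism `1 - s`, where `s` is the shift given by the sequence `x`. -/
def telescope {X : ℕ → A} (x : ∀ n, X n ⟶ X (n + 1)) : (∐ X) ⟶ (∐ X) :=
  Limits.Sigma.desc fun n => Limits.Sigma.ι X n - x n ≫ Limits.Sigma.ι X (n + 1)

@[simp]
theorem ι_telescope {X : ℕ → A} (x : ∀ n, X n ⟶ X (n + 1)) (n : ℕ) :
    Limits.Sigma.ι X n ≫ telescope x = Limits.Sigma.ι X n - x n ≫ Limits.Sigma.ι X (n + 1) :=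
  Limits.Sigma.ι_desc _ _

@[simp]
theorem ι_telescope_assoc {X : ℕ → A} (x : ∀ n, X n ⟶ X (n + 1)) (n : ℕ) {Z : A}
    (k : (∐ X) ⟶ Z) : Limits.Sigma.ι X n ≫ telescope x ≫ k =
      Limits.Sigma.ι X n ≫ k - x n ≫ Limits.Sigma.ι X (n + 1) ≫ k := by
  rw [← Category.assoc, ι_telescope, Preadditive.sub_comp, Category.assoc]

theorem telescope_desc {X : ℕ → A} {x : ∀ n, X n ⟶ X (n + 1)} {L : A} {c : ∀ n, X n ⟶ L}
    (h : ∀ n, x n ≫ c (n + 1) = c n) : telescope x ≫ Limits.Sigma.desc c = 0 :=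
  Limits.Sigma.hom_ext _ _ fun n => by simp [h]

theorem isSeqColim_cokernel_telescope {X : ℕ → A} (x : ∀ n, X n ⟶ X (n + 1)) :
    IsSeqColim x fun n => Limits.Sigma.ι X n ≫ cokernel.π (telescope x) where
  w n := by
    have := Limits.Sigma.ι X n ≫= cokernel.condition (telescope x)
    rw [ι_telescope_assoc, comp_zero, sub_eq_zero] at this
    exact this.symm
  hom_ext k k' hk := by
    rw [← cancel_epi (cokernel.π (telescope x))]
    exact Limits.Sigma.hom_ext _ _ fun n => by simpa using hk n
  exists_desc k hk := ⟨cokernel.desc _ (Limits.Sigma.desc k) (telescope_desc hk), fun n => by simp⟩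

/-- Right exactness is the universal property of the colimit; only monicity of the telescope is a
genuine assumption. -/
theorem IsSeqColim.shortExact {X : ℕ → A} {x : ∀ n, X n ⟶ X (n + 1)} {L : A} {c : ∀ n, X n ⟶ L}
    (h : IsSeqColim x c) (hx : Mono (telescope x)) :
    (ShortComplex.mk (telescope x) (Limits.Sigma.desc c) (telescope_desc h.w)).ShortExact := by
  have : Epi (Limits.Sigma.desc c) := ⟨fun k k' hk => h.hom_ext _ _ fun n => by
    simpa using Limits.Sigma.ι X n ≫= hk⟩
  refine ⟨ShortComplex.exact_of_g_is_cokernel _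
    (CokernelCofork.IsColimit.ofπ' _ _ fun {W} k hk => ?_)⟩
  have hl := h.exists_desc (fun n => Limits.Sigma.ι X n ≫ k) fun n => by
    have := Limits.Sigma.ι X n ≫= hk
    dsimp at this
    rw [ι_telescope_assoc, comp_zero, sub_eq_zero] at this
    exact this.symm
  exact ⟨hl.choose, Limits.Sigma.hom_ext _ _ fun n => by simpa using hl.choose_spec n⟩

/-- Enough injectives replace exactness of coproducts. An embedding `i` of the coproduct in an
injective object factors through the telescope: starting from `l 0 = 0`, the maps `l` are defined
recursively by extension along the monomorphisms `x n`, so that `l n - x n ≫ l (n + 1)` is `i` on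
the summand `n`. -/
theorem mono_telescope [EnoughInjectives A] {X : ℕ → A} (x : ∀ n, X n ⟶ X (n + 1))
    (hx : ∀ n, Mono (x n)) : Mono (telescope x) := by
  let i := Injective.ι (∐ X)
  let l : ∀ n, X n ⟶ Injective.under (∐ X) := fun n => Nat.rec 0
    (fun n l => Injective.factorThru (l - Limits.Sigma.ι X n ≫ i) (x n)) n
  have hl : ∀ n, x n ≫ l (n + 1) = l n - Limits.Sigma.ι X n ≫ i := fun n =>
    Injective.comp_factorThru _ _
  have : telescope x ≫ Limits.Sigma.desc l = i :=
    Limits.Sigma.hom_ext _ _ fun n => by simp [hl]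
  exact mono_of_mono_fac this

/-- The telescopes are `1 - α ≫ β` and `1 - β ≫ α`. If `z` is killed by the second, then `z = z ≫ β
≫ α`, so `z ≫ β` is killed by the first and vanishes. The composites `b n ≫ a (n + 1)` need not be
monic, so `mono_telescope` does not apply to them. -/
theorem mono_telescope_of_factor {X I : ℕ → A} (a : ∀ n, X n ⟶ I n) (b : ∀ n, I n ⟶ X (n + 1))
    (h : Mono (telescope fun n => a n ≫ b n)) : Mono (telescope fun n => b n ≫ a (n + 1)) := by
  let α : (∐ X) ⟶ (∐ I) := Limits.Sigma.map a
  let β : (∐ I) ⟶ (∐ X) := Limits.Sigma.desc fun n => b n ≫ Limits.Sigma.ι X (n + 1)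
  have h₁ : telescope (fun n => a n ≫ b n) = 𝟙 _ - α ≫ β :=
    Limits.Sigma.hom_ext _ _ fun n => by simp [α, β]
  have h₂ : telescope (fun n => b n ≫ a (n + 1)) = 𝟙 _ - β ≫ α :=
    Limits.Sigma.hom_ext _ _ fun n => by simp [α, β]
  rw [h₁] at h
  rw [h₂]
  refine Preadditive.mono_of_cancel_zero _ fun z hz => ?_
  have hz : z = z ≫ β ≫ α := by simpa [sub_eq_zero] using hz
  have : z ≫ β = 0 := by
    rw [← cancel_mono (𝟙 _ - α ≫ β), zero_comp, Preadditive.comp_sub, sub_eq_zero,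
      Category.comp_id]
    nth_rewrite 1 [hz]
    simp
  rw [hz, reassoc_of% this, zero_comp]

/-- By interleaving, `L` is also the colimit of the `I n`. The telescope sequence of the `I n`
begins with an injective coproduct, hence splits, and `L` is a retract of that coproduct. -/
theorem IsSeqColim.injective [EnoughInjectives A]
    (hI : ∀ I : ℕ → A, (∀ n, Injective (I n)) → Injective (∐ I))
    {X I : ℕ → A} (hI' : ∀ n, Injective (I n)) (a : ∀ n, X n ⟶ I n) (b : ∀ n, I n ⟶ X (n + 1))
    (hx : ∀ n, Mono (a n ≫ b n)) {L : A} {c : ∀ n, X n ⟶ L}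
    (h : IsSeqColim (fun n => a n ≫ b n) c) : Injective L := by
  have hs := h.of_factor.shortExact (mono_telescope_of_factor a b (mono_telescope _ hx))
  have : Injective (∐ I) := hI I hI'
  have s := hs.splittingOfInjective
  exact (Retract.mk s.s (Limits.Sigma.desc fun n => b n ≫ c (n + 1)) s.s_g : Retract L (∐ I)).injective

end Coproduct

section Product

variable [HasProductsOfShape ℕ A]

/-- The morphism `1 - s`, where `s` is the shift given by the sequence `x`. -/
def cotelescope {X : ℕ → A} (x : ∀ n, X (n + 1) ⟶ X n) : (∏ᶜ X) ⟶ (∏ᶜ X) :=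
  Pi.lift fun n => Pi.π X n - Pi.π X (n + 1) ≫ x n

@[simp]
theorem cotelescope_π {X : ℕ → A} (x : ∀ n, X (n + 1) ⟶ X n) (n : ℕ) :
    cotelescope x ≫ Pi.π X n = Pi.π X n - Pi.π X (n + 1) ≫ x n :=
  Pi.lift_π _ _

theorem lift_cotelescope {X : ℕ → A} {x : ∀ n, X (n + 1) ⟶ X n} {L : A} {c : ∀ n, L ⟶ X n}
    (h : ∀ n, c (n + 1) ≫ x n = c n) : Pi.lift c ≫ cotelescope x = 0 :=
  Pi.hom_ext _ _ fun n => by simp [h]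

theorem isSeqLim_kernel_cotelescope {X : ℕ → A} (x : ∀ n, X (n + 1) ⟶ X n) :
    IsSeqLim x fun n => kernel.ι (cotelescope x) ≫ Pi.π X n where
  w n := by
    have := kernel.condition (cotelescope x) =≫ Pi.π X n
    rw [Category.assoc, cotelescope_π, zero_comp, Preadditive.comp_sub, sub_eq_zero] at this
    rw [this, Category.assoc]
  hom_ext k k' hk := by
    rw [← cancel_mono (kernel.ι (cotelescope x))]
    exact Pi.hom_ext _ _ fun n => by simpa using hk n
  exists_lift k hk := ⟨kernel.lift _ (Pi.lift k) (lift_cotelescope hk), fun n => by simp⟩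

theorem IsSeqLim.shortExact {X : ℕ → A} {x : ∀ n, X (n + 1) ⟶ X n} {L : A} {c : ∀ n, L ⟶ X n}
    (h : IsSeqLim x c) (hx : Epi (cotelescope x)) :
    (ShortComplex.mk (Pi.lift c) (cotelescope x) (lift_cotelescope h.w)).ShortExact := by
  have : Mono (Pi.lift c) := ⟨fun k k' hk => h.hom_ext _ _ fun n => by
    simpa using hk =≫ Pi.π X n⟩
  refine ⟨ShortComplex.exact_of_f_is_kernel _
    (KernelFork.IsLimit.ofι' _ _ fun {W} k hk => ?_)⟩
  have hl := h.exists_lift (fun n => k ≫ Pi.π X n) fun n => by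
    have := hk =≫ Pi.π X n
    dsimp at this
    rw [Category.assoc, cotelescope_π, zero_comp, Preadditive.comp_sub, sub_eq_zero] at this
    rw [this, Category.assoc]
  exact ⟨hl.choose, Pi.hom_ext _ _ fun n => by simpa using hl.choose_spec n⟩

/-- Enough projectives replace exactness of products: an epimorphism from a projective object to the
product is factored through the telescope map by recursive lifting along the `x n`. -/
theorem epi_cotelescope [EnoughProjectives A] {X : ℕ → A} (x : ∀ n, X (n + 1) ⟶ X n)
    (hx : ∀ n, Epi (x n)) : Epi (cotelescope x) := by
  let i := Projective.π (∏ᶜ X)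
  let l : ∀ n, Projective.over (∏ᶜ X) ⟶ X n := fun n => Nat.rec 0
    (fun n l => Projective.factorThru (l - i ≫ Pi.π X n) (x n)) n
  have hl : ∀ n, l (n + 1) ≫ x n = l n - i ≫ Pi.π X n := fun n =>
    Projective.factorThru_comp _ _
  have : Pi.lift l ≫ cotelescope x = i :=
    Pi.hom_ext _ _ fun n => by simp [hl]
  exact epi_of_epi_fac this

theorem epi_cotelescope_of_factor {X P : ℕ → A} (a : ∀ n, P n ⟶ X n) (b : ∀ n, X (n + 1) ⟶ P n)
    (h : Epi (cotelescope fun n => b n ≫ a n)) : Epi (cotelescope fun n => a (n + 1) ≫ b n) := by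
  let α : (∏ᶜ P) ⟶ (∏ᶜ X) := Limits.Pi.map a
  let β : (∏ᶜ X) ⟶ (∏ᶜ P) := Pi.lift fun n => Pi.π X (n + 1) ≫ b n
  have h₁ : cotelescope (fun n => b n ≫ a n) = 𝟙 _ - β ≫ α :=
    Pi.hom_ext _ _ fun n => by simp [α, β]
  have h₂ : cotelescope (fun n => a (n + 1) ≫ b n) = 𝟙 _ - α ≫ β :=
    Pi.hom_ext _ _ fun n => by simp [α, β]
  rw [h₁] at h
  rw [h₂]
  refine Preadditive.epi_of_cancel_zero _ fun z hz => ?_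
  have hz : z = α ≫ β ≫ z := by simpa [sub_eq_zero] using hz
  have : β ≫ z = 0 := by
    rw [← cancel_epi (𝟙 _ - β ≫ α), comp_zero, Preadditive.sub_comp, sub_eq_zero,
      Category.id_comp]
    nth_rewrite 1 [hz]
    simp
  rw [hz, this, comp_zero]

theorem IsSeqLim.projective [EnoughProjectives A]
    (hP : ∀ P : ℕ → A, (∀ n, Projective (P n)) → Projective (∏ᶜ P))
    {X P : ℕ → A} (hP' : ∀ n, Projective (P n)) (a : ∀ n, P n ⟶ X n) (b : ∀ n, X (n + 1) ⟶ P n)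
    (hx : ∀ n, Epi (b n ≫ a n)) {L : A} {c : ∀ n, L ⟶ X n}
    (h : IsSeqLim (fun n => b n ≫ a n) c) : Projective L := by
  have hs := h.of_factor.shortExact (epi_cotelescope_of_factor a b (epi_cotelescope _ hx))
  have : Projective (∏ᶜ P) := hP P hP'
  have s := hs.splittingOfProjective
  exact (Retract.mk (Pi.lift fun n => c (n + 1) ≫ b n) s.r s.f_r : Retract L (∏ᶜ P)).projective

end Product

end

section

namespace Factorization

/-! ### Coproducts -/

section Coproduct

variable [HasCoproductsOfShape ℕ A] (X : ℕ → Factorization T)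

/-- The coproduct of a sequence of factorizations. -/
abbrev sigma : Factorization T where
  X₁ := ∐ fun n => (X n).X₁
  X₀ := ∐ fun n => (X n).X₀
  d₁ := Limits.Sigma.map fun n => (X n).d₁
  d₀ := Limits.Sigma.desc fun n => (X n).d₀ ≫ T.Φ.functor.map (Limits.Sigma.ι (fun n => (X n).X₁) n)
  d₁_d₀ := Limits.Sigma.hom_ext _ _ fun n => by simp [T.w_nat]
  d₀_d₁ := Limits.Sigma.hom_ext _ _ fun n => by
    rw [Limits.Sigma.ι_desc_assoc, Category.assoc, ← Functor.map_comp, Limits.Sigma.ι_map,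
      Functor.map_comp, d₀_d₁_assoc, T.w_nat]

/-- The inclusion of a summand. -/
def sigmaι (n : ℕ) : X n ⟶ sigma X where
  f₁ := Limits.Sigma.ι (fun n => (X n).X₁) n
  f₀ := Limits.Sigma.ι (fun n => (X n).X₀) n
  comm₁ := Limits.Sigma.ι_map (fun n => (X n).d₁) n
  comm₀ := Limits.Sigma.ι_desc (f := fun n => (X n).X₀) _ n

variable {X}

/-- The morphism from the coproduct given by its restrictions. -/
def sigmaDesc {Y : Factorization T} (k : ∀ n, X n ⟶ Y) : sigma X ⟶ Y where
  f₁ := Limits.Sigma.desc fun n => (k n).f₁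
  f₀ := Limits.Sigma.desc fun n => (k n).f₀
  comm₁ := Limits.Sigma.hom_ext _ _ fun n => by simp [sigma, (k n).comm₁]
  comm₀ := Limits.Sigma.hom_ext _ _ fun n => by simp [sigma, (k n).comm₀, ← Functor.map_comp]

theorem sigmaι_desc {Y : Factorization T} (k : ∀ n, X n ⟶ Y) (n : ℕ) :
    sigmaι X n ≫ sigmaDesc k = k n :=
  hom_ext (Limits.Sigma.ι_desc _ _) (Limits.Sigma.ι_desc _ _)

/-- Homotopies on the summands assemble into one because `Φ` preserves coproducts. This gives the
uniqueness that makes coproducts of factorizations coproducts in the homotopy category. -/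
theorem null_of_sigma {Y : Factorization T} {f : sigma X ⟶ Y} (h : ∀ n, Null (sigmaι X n ≫ f)) :
    Null f := by
  choose s t hst using fun n => (h n).exists_isNullBy
  refine IsNullBy.null (s := mapSigmaDesc (X := fun n => (X n).X₁) s) (t := Limits.Sigma.desc t)
    ⟨mapSigma_hom_ext (X := fun n => (X n).X₁) fun n => ?_, Limits.Sigma.hom_ext _ _ fun n => ?_⟩
  · rw [← Functor.map_comp]
    refine (hst n).eq₁.trans ?_
    rw [Preadditive.comp_add, ← Functor.map_comp, ← Functor.map_comp, ← Functor.map_comp]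
    congr 1
    · congr 1
      simp [sigma]
    · rw [← Category.assoc, map_ι_mapSigmaDesc]
  · refine (hst n).eq₀.trans ?_
    simp [sigma, map_ι_mapSigmaDesc]

variable (X) in
/-- Coproducts of factorizations are coproducts in the homotopy category. -/
def isColimitSigma : IsColimit (Cofan.mk ((K.of T).obj (sigma X))
    fun n => (K.of T).map (sigmaι X n)) :=
  have h (t : Cofan fun n => (K.of T).obj (X n)) :
      ∃ k : sigma X ⟶ t.pt.as, ∀ n, (K.of T).map (sigmaι X n) ≫ (K.of T).map k = t.inj n := by
    choose k hk using fun n => K.map_surjective (E := X n) (F := t.pt.as) (t.inj n)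
    exact ⟨sigmaDesc k, fun n => by rw [← Functor.map_comp, sigmaι_desc, hk]⟩
  Cofan.IsColimit.mk _ (fun t => (K.of T).map (h t).choose) (fun t => (h t).choose_spec)
    fun t m hm => by
      obtain ⟨g, rfl⟩ := K.map_surjective (E := sigma X) (F := t.pt.as) m
      refine (K.map_eq_iff _ _).2 (null_of_sigma fun n => ?_)
      rw [Preadditive.comp_sub]
      refine (K.map_eq_iff _ _).1 ?_
      rw [Functor.map_comp, Functor.map_comp]
      exact (hm n).trans ((h t).choose_spec n).symm

/-- The morphism `1 - s` of the coproduct, where `s` is given by a sequence of morphisms. -/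
def sigmaTelescope (x : ∀ n, X n ⟶ X (n + 1)) : sigma X ⟶ sigma X where
  f₁ := telescope fun n => (x n).f₁
  f₀ := telescope fun n => (x n).f₀
  comm₁ := Limits.Sigma.hom_ext _ _ fun n => by simp [sigma, (x n).comm₁_assoc]
  comm₀ := Limits.Sigma.hom_ext _ _ fun n => by
    simp [sigma, (x n).comm₀_assoc, ← Functor.map_comp, Functor.map_sub]

end Coproduct

/-! ### Products -/

section Product

variable [HasProductsOfShape ℕ A]

theorem mapPi_hom_ext {P : ℕ → A} {Z : A} {a b : Z ⟶ T.Φ.functor.obj (∏ᶜ P)}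
    (h : ∀ n, a ≫ T.Φ.functor.map (Pi.π P n) = b ≫ T.Φ.functor.map (Pi.π P n)) : a = b := by
  rw [← cancel_mono (PreservesProduct.iso T.Φ.functor P).hom]
  refine Pi.hom_ext _ _ fun n => ?_
  simpa using h n

/-- Morphisms to the image under `Φ` of a product. -/
def mapPiLift {P : ℕ → A} {Z : A} (k : ∀ n, Z ⟶ T.Φ.functor.obj (P n)) :
    Z ⟶ T.Φ.functor.obj (∏ᶜ P) :=
  Pi.lift k ≫ (PreservesProduct.iso T.Φ.functor P).inv

@[simp]
theorem mapPiLift_π {P : ℕ → A} {Z : A} (k : ∀ n, Z ⟶ T.Φ.functor.obj (P n)) (n : ℕ) :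
    mapPiLift k ≫ T.Φ.functor.map (Pi.π P n) = k n := by
  rw [mapPiLift, ← piComparison_comp_π, ← PreservesProduct.iso_hom, Category.assoc,
    Iso.inv_hom_id_assoc, Pi.lift_π]

variable (X : ℕ → Factorization T)

/-- The product of a sequence of factorizations. -/
abbrev pi : Factorization T where
  X₁ := ∏ᶜ fun n => (X n).X₁
  X₀ := ∏ᶜ fun n => (X n).X₀
  d₁ := Limits.Pi.map fun n => (X n).d₁
  d₀ := mapPiLift fun n => Pi.π (fun n => (X n).X₀) n ≫ (X n).d₀
  d₁_d₀ := mapPi_hom_ext fun n => by simp [← T.w_nat]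
  d₀_d₁ := mapPi_hom_ext fun n => by
    rw [Category.assoc, ← Functor.map_comp, Limits.Pi.map_π, Functor.map_comp, ← Category.assoc,
      mapPiLift_π, Category.assoc, d₀_d₁, ← T.w_nat]

/-- The projection to a factor. -/
def piπ (n : ℕ) : pi X ⟶ X n where
  f₁ := Pi.π (fun n => (X n).X₁) n
  f₀ := Pi.π (fun n => (X n).X₀) n
  comm₁ := (Limits.Pi.map_π (fun n => (X n).d₁) n).symm
  comm₀ := (mapPiLift_π (fun n => Pi.π (fun n => (X n).X₀) n ≫ (X n).d₀) n).symm

variable {X}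

/-- The morphism to the product given by its components. -/
def piLift {Y : Factorization T} (k : ∀ n, Y ⟶ X n) : Y ⟶ pi X where
  f₁ := Pi.lift fun n => (k n).f₁
  f₀ := Pi.lift fun n => (k n).f₀
  comm₁ := Pi.hom_ext _ _ fun n => by simp [pi, (k n).comm₁]
  comm₀ := mapPi_hom_ext fun n => by
    simp [pi, (k n).comm₀, ← Functor.map_comp]

theorem piLift_π {Y : Factorization T} (k : ∀ n, Y ⟶ X n) (n : ℕ) :
    piLift k ≫ piπ X n = k n :=
  hom_ext (Pi.lift_π _ _) (Pi.lift_π _ _)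

theorem null_of_pi {Y : Factorization T} {f : Y ⟶ pi X} (h : ∀ n, Null (f ≫ piπ X n)) :
    Null f := by
  choose s t hst using fun n => (h n).exists_isNullBy
  refine IsNullBy.null (s := Pi.lift s) (t := Pi.lift t)
    ⟨mapPi_hom_ext (P := fun n => (X n).X₁) fun n => ?_, Pi.hom_ext _ _ fun n => ?_⟩
  · rw [← Functor.map_comp]
    refine (hst n).eq₁.trans ?_
    have ht : T.Φ.functor.map (Pi.lift t) ≫ T.Φ.functor.map (Pi.π (fun n => (X n).X₁) n) =
        T.Φ.functor.map (t n) := by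
      rw [← Functor.map_comp, Pi.lift_π]
    rw [Preadditive.add_comp, Category.assoc, Category.assoc, ht, mapPiLift_π, Pi.lift_π_assoc]
  · refine (hst n).eq₀.trans ?_
    simp [pi]

variable (X) in
/-- Products of factorizations are products in the homotopy category. -/
def isLimitPi : IsLimit (Fan.mk ((K.of T).obj (pi X)) fun n => (K.of T).map (piπ X n)) :=
  have h (t : Fan fun n => (K.of T).obj (X n)) :
      ∃ k : t.pt.as ⟶ pi X, ∀ n, (K.of T).map k ≫ (K.of T).map (piπ X n) = t.proj n := by
    choose k hk using fun n => K.map_surjective (E := t.pt.as) (F := X n) (t.proj n)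
    exact ⟨piLift k, fun n => by rw [← Functor.map_comp, piLift_π, hk]⟩
  Fan.IsLimit.mk _ (fun t => (K.of T).map (h t).choose) (fun t => (h t).choose_spec)
    fun t m hm => by
      obtain ⟨g, rfl⟩ := K.map_surjective (E := t.pt.as) (F := pi X) m
      refine (K.map_eq_iff _ _).2 (null_of_pi fun n => ?_)
      rw [Preadditive.sub_comp]
      refine (K.map_eq_iff _ _).1 ?_
      rw [Functor.map_comp, Functor.map_comp]
      exact (hm n).trans ((h t).choose_spec n).symm

/-- The morphism `1 - s` of the product, where `s` is given by a sequence of morphisms. -/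
def piTelescope (x : ∀ n, X (n + 1) ⟶ X n) : pi X ⟶ pi X where
  f₁ := cotelescope fun n => (x n).f₁
  f₀ := cotelescope fun n => (x n).f₀
  comm₁ := Pi.hom_ext _ _ fun n => by
    rw [Category.assoc, Category.assoc, Limits.Pi.map_π, ← Category.assoc, cotelescope_π,
      cotelescope_π, Preadditive.sub_comp, Category.assoc, (x n).comm₁, Preadditive.comp_sub,
      Limits.Pi.map_π, ← Category.assoc, ← Category.assoc, Limits.Pi.map_π]
  comm₀ := mapPi_hom_ext fun n => by
    rw [Category.assoc, Category.assoc, mapPiLift_π, ← Category.assoc, cotelescope_π,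
      ← Functor.map_comp, cotelescope_π, Functor.map_sub, Functor.map_comp, Preadditive.sub_comp,
      Preadditive.comp_sub, Category.assoc, (x n).comm₀, mapPiLift_π, ← Category.assoc,
      ← Category.assoc, mapPiLift_π]

end Product

end Factorization

/-! ### Sequential colimits and limits in thick subcategories -/

namespace IsThick

variable {N : ObjectProperty (K T)} (hN : IsThick N)
include hN

/-- `N` is closed under colimits of componentwise monomorphic sequences. -/
theorem of_isSeqColim [HasCoproductsOfShape ℕ A] [EnoughInjectives A]
    (hN' : ContainsExactTotalizations N) [N.IsClosedUnderColimitsOfShape (Discrete ℕ)]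
    {X : ℕ → Factorization T} {x : ∀ n, X n ⟶ X (n + 1)} {L : Factorization T} {c : ∀ n, X n ⟶ L}
    (h₁ : IsSeqColim (fun n => (x n).f₁) fun n => (c n).f₁)
    (h₀ : IsSeqColim (fun n => (x n).f₀) fun n => (c n).f₀)
    (hx₁ : ∀ n, Mono (x n).f₁) (hx₀ : ∀ n, Mono (x n).f₀) (hX : ∀ n, N ((K.of T).obj (X n))) :
    N ((K.of T).obj L) := by
  have hS : N ((K.of T).obj (sigma X)) :=
    N.prop_of_isColimit (isColimitSigma X) fun n => hX n.as
  have hw : sigmaTelescope x ≫ sigmaDesc c = 0 :=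
    hom_ext (telescope_desc h₁.w) (telescope_desc h₀.w)
  -- The telescope sequence is componentwise exact, so the cone of the map from the cone of the
  -- telescope to `L` is in `N`. The cone of the telescope is itself in `N`, being the cone of an
  -- endomorphism of a coproduct of objects of `N`.
  exact hN.of_cone_of_src _ (hN.cone_coneTo hN' _ _ hw (h₁.shortExact (mono_telescope _ hx₁))
    (h₀.shortExact (mono_telescope _ hx₀))) (hN.cone _ hS hS)

/-- `N` is closed under limits of componentwise epimorphic sequences. -/
theorem of_isSeqLim [HasProductsOfShape ℕ A] [EnoughProjectives A]
    (hN' : ContainsExactTotalizations N) [N.IsClosedUnderLimitsOfShape (Discrete ℕ)]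
    {X : ℕ → Factorization T} {x : ∀ n, X (n + 1) ⟶ X n} {L : Factorization T} {c : ∀ n, L ⟶ X n}
    (h₁ : IsSeqLim (fun n => (x n).f₁) fun n => (c n).f₁)
    (h₀ : IsSeqLim (fun n => (x n).f₀) fun n => (c n).f₀)
    (hx₁ : ∀ n, Epi (x n).f₁) (hx₀ : ∀ n, Epi (x n).f₀) (hX : ∀ n, N ((K.of T).obj (X n))) :
    N ((K.of T).obj L) := by
  have hS : N ((K.of T).obj (pi X)) :=
    N.prop_of_isLimit (isLimitPi X) fun n => hX n.as
  have hw : piLift c ≫ piTelescope x = 0 :=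
    hom_ext (lift_cotelescope h₁.w) (lift_cotelescope h₀.w)
  -- Here `L` is the left end of the exact sequence, so the sequence is used as a map from `L[1]` to
  -- the cone of the telescope.
  have hc : N ((K.of T).obj (Factorization.cone (shiftToCone (piLift c) (piTelescope x) hw))) :=
    (hN.cone_shiftToCone _ _ hw).2 (hN.cone_coneTo hN' _ _ hw
      (h₁.shortExact (epi_cotelescope _ hx₁)) (h₀.shortExact (epi_cotelescope _ hx₀)))
  exact (hN.shift_iff L).1 (hN.of_cone_of_tgt _ hc (hN.cone _ hS hS))

end IsThick

end

section

/-! ### Resolutions of countable length -/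

/-- In the limit argument the varying factorization is the source of the cones, which therefore
contain `Φ` of its degree `-1` component. For colimits it is the target, to which `Φ` is not
applied. -/
theorem IsSeqLim.map {X : ℕ → A} {x : ∀ n, X (n + 1) ⟶ X n} {L : A} {c : ∀ n, L ⟶ X n}
    (h : IsSeqLim x c) :
    IsSeqLim (fun n => T.Φ.functor.map (x n)) (fun n => T.Φ.functor.map (c n)) where
  w n := by rw [← Functor.map_comp, h.w]
  hom_ext k k' hk := by
    apply (T.Φ.symm.toAdjunction.homEquiv _ _).symm.injective
    refine h.hom_ext _ _ fun n => ?_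
    rw [← Adjunction.homEquiv_naturality_right_symm, ← Adjunction.homEquiv_naturality_right_symm]
    exact congrArg _ (hk n)
  exists_lift k hk := by
    obtain ⟨l, hl⟩ := h.exists_lift
      (fun n => (T.Φ.symm.toAdjunction.homEquiv _ _).symm (k n)) fun n => by
        rw [← Adjunction.homEquiv_naturality_right_symm]
        exact congrArg _ (hk n)
    refine ⟨T.Φ.symm.toAdjunction.homEquiv _ _ l, fun n => ?_⟩
    refine (Adjunction.homEquiv_naturality_right _ _ _).symm.trans ?_
    rw [hl, Equiv.apply_symm_apply]

namespace Factorization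

theorem coneMap_id_f₁ {E F F' : Factorization T} {g : E ⟶ F} {g' : E ⟶ F'} (b : F ⟶ F')
    (h : g ≫ b = 𝟙 E ≫ g') : (coneMap (𝟙 E) b h).f₁ = biprod.map (𝟙 E.X₀) b.f₁ := by
  apply cone.ext_from₁
  · exact Eq.trans (b := 𝟙 _ ≫ cone.inl₁ g') (by simp [coneMap]) (biprod.inl_map (𝟙 E.X₀) b.f₁).symm
  · exact Eq.trans (b := b.f₁ ≫ cone.inr₁ g') (by simp [coneMap]) (biprod.inr_map (𝟙 E.X₀) b.f₁).symm

theorem coneMap_id_f₀ {E F F' : Factorization T} {g : E ⟶ F} {g' : E ⟶ F'} (b : F ⟶ F')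
    (h : g ≫ b = 𝟙 E ≫ g') :
    (coneMap (𝟙 E) b h).f₀ = biprod.map (𝟙 (T.Φ.functor.obj E.X₁)) b.f₀ := by
  apply cone.ext_from₀
  · exact Eq.trans (b := 𝟙 _ ≫ cone.inl₀ g') (by simp [coneMap]) (biprod.inl_map (𝟙 (T.Φ.functor.obj E.X₁)) b.f₀).symm
  · exact Eq.trans (b := b.f₀ ≫ cone.inr₀ g') (by simp [coneMap]) (biprod.inr_map (𝟙 (T.Φ.functor.obj E.X₁)) b.f₀).symm

theorem coneMap_to_id_f₁ {E E' F : Factorization T} {g : E ⟶ F} {g' : E' ⟶ F} (a : E ⟶ E')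
    (h : g ≫ 𝟙 F = a ≫ g') : (coneMap a (𝟙 F) h).f₁ = biprod.map a.f₀ (𝟙 F.X₁) := by
  apply cone.ext_from₁
  · exact Eq.trans (b := a.f₀ ≫ cone.inl₁ g') (by simp [coneMap]) (biprod.inl_map a.f₀ (𝟙 F.X₁)).symm
  · exact Eq.trans (b := 𝟙 _ ≫ cone.inr₁ g') (by simp [coneMap]) (biprod.inr_map a.f₀ (𝟙 F.X₁)).symm

theorem coneMap_to_id_f₀ {E E' F : Factorization T} {g : E ⟶ F} {g' : E' ⟶ F} (a : E ⟶ E')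
    (h : g ≫ 𝟙 F = a ≫ g') :
    (coneMap a (𝟙 F) h).f₀ = biprod.map (T.Φ.functor.map a.f₁) (𝟙 F.X₀) := by
  apply cone.ext_from₀
  · exact Eq.trans (b := T.Φ.functor.map a.f₁ ≫ cone.inl₀ g') (by simp [coneMap]) (biprod.inl_map (T.Φ.functor.map a.f₁) (𝟙 F.X₀)).symm
  · exact Eq.trans (b := 𝟙 _ ≫ cone.inr₀ g') (by simp [coneMap]) (biprod.inr_map (T.Φ.functor.map a.f₁) (𝟙 F.X₀)).symm

end Factorization

/-- `f` is a monomorphism which factors through an injective object. -/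
def MonoViaInjective {X Y : A} (f : X ⟶ Y) : Prop :=
  Mono f ∧ ∃ (I : A) (a : X ⟶ I) (b : I ⟶ Y), Injective I ∧ a ≫ b = f

/-- `f` is an epimorphism which factors through a projective object. -/
def EpiViaProjective {X Y : A} (f : X ⟶ Y) : Prop :=
  Epi f ∧ ∃ (P : A) (b : X ⟶ P) (a : P ⟶ Y), Projective P ∧ b ≫ a = f

theorem IsSeqColim.injective_of_monoViaInjective [HasCoproductsOfShape ℕ A] [EnoughInjectives A]
    (hI : ∀ I : ℕ → A, (∀ n, Injective (I n)) → Injective (∐ I))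
    {X : ℕ → A} {x : ∀ n, X n ⟶ X (n + 1)} (hx : ∀ n, MonoViaInjective (x n)) {L : A}
    {c : ∀ n, X n ⟶ L} (h : IsSeqColim x c) : Injective L := by
  choose hm I a b hI' hab using hx
  obtain rfl : (fun n => a n ≫ b n) = x := funext hab
  exact h.injective hI hI' a b hm

theorem IsSeqLim.projective_of_epiViaProjective [HasProductsOfShape ℕ A] [EnoughProjectives A]
    (hP : ∀ P : ℕ → A, (∀ n, Projective (P n)) → Projective (∏ᶜ P))
    {X : ℕ → A} {x : ∀ n, X (n + 1) ⟶ X n} (hx : ∀ n, EpiViaProjective (x n)) {L : A}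
    {c : ∀ n, L ⟶ X n} (h : IsSeqLim x c) : Projective L := by
  choose hm P b a hP' hab using hx
  obtain rfl : (fun n => b n ≫ a n) = x := funext hab
  exact h.projective hP hP' a b hm

namespace IsThick

variable {N : ObjectProperty (K T)} (hN : IsThick N)
include hN

/-- One step of the infinite resolution: `E` is replaced by the shifted cone of `I ⟶ I/E`. The
components of the new factorization need not be injective, but the map to it passes through those of
`I`. -/
theorem exists_monoViaInjective [EnoughInjectives A] (hN' : ContainsExactTotalizations N)
    (E : Factorization T) : ∃ (F : Factorization T) (g : E ⟶ F),
      N ((K.of T).obj (Factorization.cone g)) ∧ MonoViaInjective g.f₁ ∧ MonoViaInjective g.f₀ := by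
  obtain ⟨I, f, hI₁, hI₀, hf₁, hf₀⟩ := exists_mono_to_injective E
  have hw := comp_toCoker f
  refine ⟨(Factorization.unshift T).obj (Factorization.cone (toCoker f)),
    toUnshiftCone f (toCoker f) hw, ?_, ⟨?_, I.X₁, f.f₁, _, hI₁, (toUnshiftCone_f₁ _ _ _).symm⟩,
    ⟨?_, I.X₀, f.f₀, _, hI₀, (toUnshiftCone_f₀ _ _ _).symm⟩⟩
  · exact (hN.cone_toUnshiftCone_iff _ _ _).2 (hN.cone_coneTo hN' _ _ hw
      (shortExact_cokernel hf₁ _) (shortExact_cokernel hf₀ _))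
  · rw [toUnshiftCone_f₁]
    have h : Mono (cone.inl₀ (toCoker f)) := mono_of_mono_fac (cone.inl_fst₀ (toCoker f))
    have h' : Mono (T.Φ.unit.app I.X₁) := (inferInstance : Mono (T.Φ.unitIso.app I.X₁).hom)
    exact mono_comp' hf₁ (mono_comp' h' inferInstance)
  · rw [toUnshiftCone_f₀]
    exact mono_comp' hf₀ (mono_of_mono_fac (cone.inl_fst₁ (toCoker f)))

/-- With `E` a quotient of `P`, the cone of the kernel inclusion replaces `E`. The map to `E` is the
projection to `P` followed by the given epimorphism, in each component. -/
theorem exists_epiViaProjective [EnoughProjectives A] (hN' : ContainsExactTotalizations N)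
    (E : Factorization T) : ∃ (F : Factorization T) (g : F ⟶ E),
      N ((K.of T).obj (Factorization.cone g)) ∧ EpiViaProjective g.f₁ ∧ EpiViaProjective g.f₀ := by
  obtain ⟨P, f, hP₁, hP₀, hf₁, hf₀⟩ := exists_epi_from_projective E
  have hw := fromKer_comp f
  have h₁ : (coneTo (fromKer f) f hw).f₁ = cone.snd₁ (fromKer f) ≫ f.f₁ := by
    apply cone.ext_from₁ <;> simp [coneTo, cone.desc]
  have h₀ : (coneTo (fromKer f) f hw).f₀ = cone.snd₀ (fromKer f) ≫ f.f₀ := by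
    apply cone.ext_from₀ <;> simp [coneTo, cone.desc]
  refine ⟨Factorization.cone (fromKer f), coneTo (fromKer f) f hw, hN.cone_coneTo hN' _ _ hw
    (shortExact_kernel hf₁ _) (shortExact_kernel hf₀ _), ⟨?_, P.X₁, _, f.f₁, hP₁, h₁.symm⟩,
    ⟨?_, P.X₀, _, f.f₀, hP₀, h₀.symm⟩⟩
  · rw [h₁]
    exact epi_comp' (epi_of_epi_fac (cone.inr_snd₁ (fromKer f))) hf₁
  · rw [h₀]
    exact epi_comp' (epi_of_epi_fac (cone.inr_snd₀ (fromKer f))) hf₀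

/-- The step `exists_monoViaInjective` is iterated to a sequence `B n` starting at `E`. Its colimit
has injective components since the transition maps factor through injectives, and the cone of `E`
mapping to the colimit is the colimit of the cones of `E ⟶ B n`, which are in `N` by `cone_comp`. -/
theorem exists_injective_of_coproducts [HasCoproductsOfShape ℕ A] [EnoughInjectives A]
    (hI : ∀ I : ℕ → A, (∀ n, Injective (I n)) → Injective (∐ I))
    (hN' : ContainsExactTotalizations N) [N.IsClosedUnderColimitsOfShape (Discrete ℕ)]
    (E : Factorization T) : ∃ (J : Factorization T) (f : E ⟶ J), Injective J.X₁ ∧ Injective J.X₀ ∧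
      N ((K.of T).obj (Factorization.cone f)) := by
  choose succ g hg hg₁ hg₀ using hN.exists_monoViaInjective hN'
  let B : ℕ → Factorization T := fun n => Nat.rec E (fun _ F => succ F) n
  let x : ∀ n, B n ⟶ B (n + 1) := fun n => g (B n)
  let e : ∀ n, E ⟶ B n := fun n => Nat.rec (motive := fun n => E ⟶ B n) (𝟙 E) (fun n e => e ≫ x n) n
  let c : ∀ n, B n ⟶ coker (sigmaTelescope x) := fun n => sigmaι B n ≫ toCoker _
  have h₁ : IsSeqColim (fun n => (x n).f₁) fun n => (c n).f₁ := isSeqColim_cokernel_telescope _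
  have h₀ : IsSeqColim (fun n => (x n).f₀) fun n => (c n).f₀ := isSeqColim_cokernel_telescope _
  have hc : ∀ n, x n ≫ c (n + 1) = c n := fun n => hom_ext (h₁.w n) (h₀.w n)
  have he : ∀ n, e n ≫ c n = c 0 := fun n => by
    induction n with
    | zero => exact Category.id_comp _
    | succ n ih => exact (Category.assoc _ _ _).trans ((congrArg _ (hc n)).trans ih)
  have heN : ∀ n, N ((K.of T).obj (Factorization.cone (e n))) := fun n => by
    induction n with
    | zero => exact hN.cone_id hN' E
    | succ n ih => exact hN.cone_comp _ _ ih (hg _)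
  refine ⟨coker (sigmaTelescope x), c 0, h₁.injective_of_monoViaInjective hI fun n => hg₁ _,
    h₀.injective_of_monoViaInjective hI fun n => hg₀ _, ?_⟩
  have hx : ∀ n, e n ≫ x n = 𝟙 E ≫ e (n + 1) := fun n => (Category.id_comp _).symm
  have hc' : ∀ n, e n ≫ c n = 𝟙 E ≫ c 0 := fun n => (he n).trans (Category.id_comp _).symm
  refine hN.of_isSeqColim hN' (x := fun n => coneMap (𝟙 E) (x n) (hx n))
    (c := fun n => coneMap (𝟙 E) (c n) (hc' n))
    -- In each degree the sequence of cones is the sequence `B n` plus a constant summand coming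
    -- from `E[1]`.
    ((h₁.biprod E.X₀).congr (fun n => coneMap_id_f₁ _ _) fun n => coneMap_id_f₁ _ _)
    ((h₀.biprod _).congr (fun n => coneMap_id_f₀ _ _) fun n => coneMap_id_f₀ _ _)
    (fun n => ?_) (fun n => ?_) heN
  · have : Mono (x n).f₁ := (hg₁ _).1
    rw [coneMap_id_f₁]
    exact biprod.map_mono _ _
  · have : Mono (x n).f₀ := (hg₀ _).1
    rw [coneMap_id_f₀]
    exact biprod.map_mono _ _

theorem exists_projective_of_products [HasProductsOfShape ℕ A] [EnoughProjectives A]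
    (hP : ∀ P : ℕ → A, (∀ n, Projective (P n)) → Projective (∏ᶜ P))
    (hN' : ContainsExactTotalizations N) [N.IsClosedUnderLimitsOfShape (Discrete ℕ)]
    (E : Factorization T) : ∃ (J : Factorization T) (f : J ⟶ E), Projective J.X₁ ∧
      Projective J.X₀ ∧ N ((K.of T).obj (Factorization.cone f)) := by
  choose succ g hg hg₁ hg₀ using hN.exists_epiViaProjective hN'
  let B : ℕ → Factorization T := fun n => Nat.rec E (fun _ F => succ F) n
  let x : ∀ n, B (n + 1) ⟶ B n := fun n => g (B n)
  let e : ∀ n, B n ⟶ E := fun n => Nat.rec (motive := fun n => B n ⟶ E) (𝟙 E) (fun n e => x n ≫ e) n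
  let c : ∀ n, ker (piTelescope x) ⟶ B n := fun n => fromKer _ ≫ piπ B n
  have h₁ : IsSeqLim (fun n => (x n).f₁) fun n => (c n).f₁ := isSeqLim_kernel_cotelescope _
  have h₀ : IsSeqLim (fun n => (x n).f₀) fun n => (c n).f₀ := isSeqLim_kernel_cotelescope _
  have hc : ∀ n, c (n + 1) ≫ x n = c n := fun n => hom_ext (h₁.w n) (h₀.w n)
  have he : ∀ n, c n ≫ e n = c 0 := fun n => by
    induction n with
    | zero => exact Category.comp_id _
    | succ n ih => exact (Category.assoc _ _ _).symm.trans ((congrArg (· ≫ e n) (hc n)).trans ih)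
  have heN : ∀ n, N ((K.of T).obj (Factorization.cone (e n))) := fun n => by
    induction n with
    | zero => exact hN.cone_id hN' E
    | succ n ih => exact hN.cone_comp _ _ (hg _) ih
  refine ⟨ker (piTelescope x), c 0, h₁.projective_of_epiViaProjective hP fun n => hg₁ _,
    h₀.projective_of_epiViaProjective hP fun n => hg₀ _, ?_⟩
  have hx : ∀ n, e (n + 1) ≫ 𝟙 E = x n ≫ e n := fun n => Category.comp_id _
  have hc' : ∀ n, c 0 ≫ 𝟙 E = c n ≫ e n := fun n => (Category.comp_id _).trans (he n).symm
  refine hN.of_isSeqLim hN' (x := fun n => coneMap (x n) (𝟙 E) (hx n))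
    (c := fun n => coneMap (c n) (𝟙 E) (hc' n))
    -- The cone shifts its source `B n`: degree `-1` of the cones contains the degree `0` component
    -- of `B n`, and degree `0` contains `Φ` of the degree `-1` component, so the two limits change
    -- places.
    ((h₀.biprod E.X₁).congr (fun n => coneMap_to_id_f₁ _ _) fun n => coneMap_to_id_f₁ _ _)
    (((h₁.map (T := T)).biprod E.X₀).congr (fun n => coneMap_to_id_f₀ _ _)
      fun n => coneMap_to_id_f₀ _ _)
    (fun n => ?_) (fun n => ?_) heN
  · have : Epi (x n).f₀ := (hg₀ _).1
    rw [coneMap_to_id_f₁]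
    exact biprod.map_epi _ _
  · have : Epi (x n).f₁ := (hg₁ _).1
    rw [coneMap_to_id_f₀]
    exact biprod.map_epi _ _

end IsThick

end

/-! ### The four cases of the theorem -/

section

/-- Only countable coproducts are used; `ULift ℕ` brings the assumption from the universe `w` to
`ℕ`. -/
theorem injective_sigma_nat [HasCoproducts.{w} A] [HasCoproductsOfShape ℕ A]
    (h : ∀ (J : Type w) (I : J → A), (∀ j, Injective (I j)) → Injective (∐ I))
    (I : ℕ → A) (hI : ∀ n, Injective (I n)) : Injective (∐ I) :=
  Injective.of_iso (Limits.Sigma.whiskerEquiv (f := fun j : ULift.{w} ℕ => I j.down) (g := I)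
    Equiv.ulift fun _ => Iso.refl _) (h _ _ fun j => hI j.down)

theorem projective_pi_nat [HasProducts.{w} A] [HasProductsOfShape ℕ A]
    (h : ∀ (J : Type w) (P : J → A), (∀ j, Projective (P j)) → Projective (∏ᶜ P))
    (P : ℕ → A) (hP : ∀ n, Projective (P n)) : Projective (∏ᶜ P) :=
  Projective.of_iso (Limits.Pi.whiskerEquiv (f := fun j : ULift.{w} ℕ => P j.down) (g := P)
    Equiv.ulift fun _ => Iso.refl _) (h _ _ fun j => hP j.down)

section

variable {B : Type u₂} [Category.{v₂} B] [Abelian B] {U : FactTriple B} {θ γ : FactoredFunctor T U}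
  (η : FactoredNatTrans θ γ) {N : ObjectProperty (K T)} {N' : ObjectProperty (K U)}

/-- Common to the co-derived and absolute cases: orthogonality gives locality, and the
quasi-isomorphisms on injective components give invertibility of `η^f`. Only the existence of
resolutions distinguishes the two. -/
theorem inducesRightIso_of_injective (hN : N ≤ leftOrthInjective A T) (hN' : IsThick N')
    (hN'' : ContainsExactTotalizations N')
    (hres : ∀ X, ∃ (J : K T) (f : X ⟶ J), injectiveComponents T J ∧ quasiIso N f)
    (h : η.InducesOrdinaryRightIsoFinite) : InducesRightIso η N N' :=
  inducesRightIso_of_resolutions η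
    (fun _ hJ _ _ f hf => bijective_precomp_of_injectiveComponents hN hJ f hf) hres
    fun J hJ => isIso_toD_app η hN' hN'' J (quasiIso_app_of_injective η h hJ.1)
      (quasiIso_app_of_injective η h hJ.2)

theorem inducesLeftIso_of_projective (hN : N ≤ rightOrthProjective A T) (hN' : IsThick N')
    (hN'' : ContainsExactTotalizations N')
    (hres : ∀ X, ∃ (J : K T) (f : J ⟶ X), projectiveComponents T J ∧ quasiIso N f)
    (h : η.InducesOrdinaryLeftIsoFinite) : InducesLeftIso η N N' :=
  inducesLeftIso_of_resolutions η
    (fun _ hJ _ _ f hf => bijective_postcomp_of_projectiveComponents hN hJ f hf) hres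
    fun J hJ => isIso_toD_app η hN' hN'' J (quasiIso_app_of_projective η h hJ.1)
      (quasiIso_app_of_projective η h hJ.2)

end

end

end FactorizationCategory

end

theorem mainTheorem8
    {A : Type u₁} [Category.{v₁} A] [Abelian A] {B : Type u₂} [Category.{v₂} B] [Abelian B]
    (T : FactTriple A) (U : FactTriple B) (θ γ : FactoredFunctor T U)
    (η : FactoredNatTrans θ γ) :
    (∀ [HasCoproducts.{w} A] [HasCoproducts.{w} B] [EnoughInjectives A],
      (∀ (J : Type w) (I : J → A), (∀ j, Injective (I j)) → Injective (∐ I)) →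
      PreservesFiniteLimits θ.F → PreservesFiniteLimits γ.F →
      η.InducesOrdinaryRightIso →
      InducesRightIso η (coAcyclic.{w} T) (coAcyclic.{w} U)) ∧
    (∀ [HasProducts.{w} A] [HasProducts.{w} B] [EnoughProjectives A],
      (∀ (J : Type w) (P : J → A), (∀ j, Projective (P j)) → Projective (∏ᶜ P)) →
      PreservesFiniteColimits θ.F → PreservesFiniteColimits γ.F →
      η.InducesOrdinaryLeftIso →
      InducesLeftIso η (ctrAcyclic.{w} T) (ctrAcyclic.{w} U)) ∧
    ((∀ X : A, ∃ (I : InjectiveResolution X) (n : ℕ), ∀ m, n < m → IsZero (I.cocomplex.X m)) →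
      PreservesFiniteLimits θ.F → PreservesFiniteLimits γ.F →
      η.InducesOrdinaryRightIsoFinite →
      InducesRightIso η (absAcyclic T) (absAcyclic U)) ∧
    ((∀ X : A, ∃ (P : ProjectiveResolution X) (n : ℕ), ∀ m, n < m → IsZero (P.complex.X m)) →
      PreservesFiniteColimits θ.F → PreservesFiniteColimits γ.F →
      η.InducesOrdinaryLeftIsoFinite →
      InducesLeftIso η (absAcyclic T) (absAcyclic U)) := by
  refine ⟨fun hI _ _ h => ?_, fun hP _ _ h => ?_, fun hI _ _ h => ?_, fun hP _ _ h => ?_⟩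
  · have : HasCoproductsOfShape ℕ A :=
      hasColimitsOfShape_of_equivalence (Discrete.equivalence (Equiv.ulift.{w} (α := ℕ)))
    -- Closure under coproducts indexed by `ULift ℕ` is transported along the equivalence with `ℕ`.
    have := (coAcyclic_closed (T := T) (ULift.{w} ℕ)).of_equivalence
      (Discrete.equivalence (Equiv.ulift.{w} (α := ℕ)))
    -- The hypothesis on derived functors is applied only to resolutions of length zero, so its
    -- restriction to finite resolutions suffices here too.
    refine inducesRightIso_of_injective η coAcyclic_le_leftOrthInjective coAcyclic_isThick
      coAcyclic_tot (fun X => ?_) fun X I _ => h X I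
    obtain ⟨J, f, h₁, h₀, hf⟩ := coAcyclic_isThick.exists_injective_of_coproducts
      (injective_sigma_nat hI) coAcyclic_tot X.as
    exact ⟨(K.of T).obj J, (K.of T).map f, ⟨h₁, h₀⟩, f, rfl, hf⟩
  · have : HasProductsOfShape ℕ A :=
      hasLimitsOfShape_of_equivalence (Discrete.equivalence (Equiv.ulift.{w} (α := ℕ)))
    have := (ctrAcyclic_closed (T := T) (ULift.{w} ℕ)).of_equivalence
      (Discrete.equivalence (Equiv.ulift.{w} (α := ℕ)))
    refine inducesLeftIso_of_projective η ctrAcyclic_le_rightOrthProjective ctrAcyclic_isThick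
      ctrAcyclic_tot (fun X => ?_) fun X P _ => h X P
    obtain ⟨J, f, h₁, h₀, hf⟩ := ctrAcyclic_isThick.exists_projective_of_products
      (projective_pi_nat hP) ctrAcyclic_tot X.as
    exact ⟨(K.of T).obj J, (K.of T).map f, ⟨h₁, h₀⟩, f, rfl, hf⟩
  · exact inducesRightIso_of_injective η absAcyclic_le_leftOrthInjective absAcyclic_isThick
      absAcyclic_tot (exists_quasiIso_injectiveComponents hI absAcyclic_isThick absAcyclic_tot) h
  · exact inducesLeftIso_of_projective η absAcyclic_le_rightOrthProjective absAcyclic_isThick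
      absAcyclic_tot (exists_quasiIso_projectiveComponents hP absAcyclic_isThick absAcyclic_tot) h
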